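/- \textbf{Setting.} Let $1\le k<n$ and $q\ge 1$ be integers. For an $n\times k$ matrix $X$ of rank $k$, a $q\times k$ matrix $R$ of rank $q$ and $r\in\mathbb{R}^q$, put $\mathfrak{M}_0=\{X\beta: R\beta=r\}$, $\mathfrak{M}_0^{lin}=\{X\beta: R\beta=0\}$, $\hat\beta(y)=(X'X)^{-1}X'y$, $\hat u(y)=y-X\hat\beta(y)$ for $y\in\mathbb{R}^n$, $B(y)=R(X'X)^{-1}X'\operatorname{diag}(\hat u_1(y),\ldots,\hat u_n(y))$ and $\mathsf{B}=\{y\in\mathbb{R}^n:\operatorname{rank}B(y)<q\}$; $\operatorname{span}(A)$ is the column span of a matrix $A$ and $e_i(n)$ the $i$-th standard basis vector of $\mathbb{R}^n$. For $\omega\in[0,\pi]$ and an integer $s\ge0$ let $E_{n,s}(\omega)$ be the $n\times2$ matrix with $j$-th row $(j^s\cos(j\omega),j^s\sin(j\omega))$, $j=1,\ldots,n$, and for a proper linear subspace $\mathcal{L}$ of $\mathbb{R}^n$ let $\rho(\omega,\mathcal{L})=\min\{s\ge0:\operatorname{span}(E_{n,s}(\omega))\not\subseteq\mathcal{L}\}$.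 For a $k\times k$-matrix-valued function $\hat\Psi$ on $\mathbb{R}^n$ let $\hat\Omega(y)=nR(X'X)^{-1}\hat\Psi(y)(X'X)^{-1}R'$ and let the associated test statistic be $T(y)=(R\hat\beta(y)-r)'\hat\Omega(y)^{-1}(R\hat\beta(y)-r)$ if $\det\hat\Omega(y)\ne0$ and $T(y)=0$ otherwise. \begin{itemize} \item $T_w$ is obtained from $\hat\Psi_w=\sum_{j=-(n-1)}^{n-1}w(j)\hat\Gamma_j$, where $\hat\Gamma_j(y)=n^{-1}\sum_{t=j+1}^n\hat v_t(y)\hat v_{t-j}(y)'$ for $j\ge0$, $\hat\Gamma_j=\hat\Gamma_{-j}'$ for $j<0$, and $\hat v_t(y)=\hat u_t(y)x_t'$ with $x_t$ the $t$-th row of $X$. The weights are called admissible if they are real constants with $w(0)=1$, $w(-j)=w(j)$, and the matrix $(w(i-j))_{i,j=1}^n$ is positive definite. \item $T_{E,\mathsf{W}}$ is obtained from $\hat\Psi_{E,\mathsf{W}}(y)=n^{-1}X'(\hat K(y)\bullet\mathsf{W})X$, where $\bullet$ is the Hadamard product, $\hat K_{ij}(y)=n^{-1}\sum_{l=|i-j|+1}^n\hat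 u_l(y)\hat u_{l-|i-j|}(y)$, and $\mathsf{W}$ is a symmetric nonnegative definite $n\times n$ Toeplitz matrix with ones on the main diagonal. \end{itemize} Let $\mathfrak{F}_{\mathrm{all}}$ be the set of all even, nonnegative, integrable functions $f$ on $[-\pi,\pi]$ with $\int_{-\pi}^{\pi}f=1$, let $\Sigma(f)=\bigl[\int_{-\pi}^{\pi}e^{-\iota(j-l)\omega}f(\omega)\,d\omega\bigr]_{j,l=1}^n$, $\mathfrak{C}=\{\Sigma(f):f\in\mathfrak{F}_{\mathrm{all}}\}$, and let $P_{\mu,A}$ be the Gaussian distribution on $\mathbb{R}^n$ with mean $\mu$ and covariance matrix $A$. For $T:\mathbb{R}^n\to\mathbb{R}$ and $C\in\mathbb{R}$ put $$\mathrm{size}_T(C)=\sup_{\mu_0\in\mathfrak{M}_0}\ \sup_{0<\sigma^2<\infty}\ \sup_{f\in\mathfrak{F}_{\mathrm{all}}}P_{\mu_0,\sigma^2\Sigma(f)}(T\ge C).$$ With $\mathcal{L}=\mathfrak{M}_0^{lin}$ and $\Pi$ the orthogonal projection onto $\mathcal{L}^\perp$, let $\mathbb{J}$ be the set of all $\operatorname{span}(\bar\Sigma)$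 with $\bar\Sigma$ in the closure of $\{\Pi\Sigma\Pi/\|\Pi\Sigma\Pi\|:\Sigma\in\mathfrak{C}\}$ and $\operatorname{rank}(\bar\Sigma)<n-\dim\mathcal{L}$; let $C^*\in[-\infty,\infty]$ be the supremum of those real $c$ for which there are $\mathcal{S}\in\mathbb{J}$ and $\mu_0\in\mathfrak{M}_0$ such that $T=c$ holds Lebesgue-almost everywhere on $\mu_0+\mathcal{S}$ (with $\sup\emptyset=-\infty$), and let $\alpha^*(T)=\sup_{C^*<C<\infty}\mathrm{size}_T(C)$. \textbf{Theorem.} Let $0\le k_F<k$ and let $F$ be an $n\times k_F$ matrix of rank $k_F$ (the empty matrix, of rank $0$ and span $\{0\}$, if $k_F=0$). Let $R=(0,\tilde R)$ be of rank $q$ with $\tilde R$ of dimension $q\times(k-k_F)$. Suppose that the columns of $F$ together with $e_{i_1}(n),\ldots,e_{i_q}(n)$ are linearly independent for every choice of $1\le i_1<\cdots<i_q\le n$. Suppose furthermore that (i) $n>k+2$, or (ii) $\operatorname{rank}(F,E_{n,0}(\gamma^*))=k_F+2$ for some $\gamma^*\in(0,\pi)$. Then there is a Lebesgue-null set in $\mathbb{R}^{n\times(k-k_F)}$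 such that for every $\tilde X$ outside it the matrix $X=(F,\tilde X)$ satisfies: \begin{enumerate} \item $\operatorname{rank}(X)=k$. \item $\mathsf{B}=\operatorname{span}(X)$. \item The matrix obtained from $R(X'X)^{-1}X'$ by deleting in $X'$ all columns with an index $i$ such that $e_i(n)\in\operatorname{span}(X)$ has rank $q$. \item $\rho(\gamma,\mathfrak{M}_0^{lin})=\rho(\gamma,\operatorname{span}(F))$ for every $\gamma\in[0,\pi]$. \item For every $\gamma\in[0,\pi]$, with $\rho=\rho(\gamma,\mathfrak{M}_0^{lin})$: $\operatorname{span}(E_{n,\rho}(\gamma))\not\subseteq\mathsf{B}$, $\operatorname{span}(E_{n,\rho}(\gamma))\not\subseteq\operatorname{span}(X)$, and $\operatorname{rank}(X,E_{n,\rho}(\gamma))>k$. \item For every $r\in\mathbb{R}^q$, all admissible weights $w$ and every $0<\alpha<1$ there is a real $C(\alpha)$ with $\mathrm{size}_{T_w}(C(\alpha))\le\alpha$; and if $\alpha\le\alpha^*(T_w)$, then $C(\alpha)$ can be chosen such that $\mathrm{size}_{T_w}(C(\alpha))=\alpha$. \item For every $r\in\mathbb{R}^q$, every $\mathsf{W}$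 as above and every $0<\alpha<1$ there is a real $C(\alpha)$ with $\mathrm{size}_{T_{E,\mathsf{W}}}(C(\alpha))\le\alpha$; and if $\alpha\le\alpha^*(T_{E,\mathsf{W}})$, then $C(\alpha)$ can be chosen such that $\mathrm{size}_{T_{E,\mathsf{W}}}(C(\alpha))=\alpha$. \end{enumerate} -/

import Mathlib

namespace SizeControl

open MeasureTheory ProbabilityTheory Matrix

noncomputable section

/-- The span of the columns of `A`, as a linear subspace of Euclidean space `ℝⁿ`. -/
def colSpan {n : ℕ} {κ : Type*} (A : Matrix (Fin n) κ ℝ) :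
    Submodule ℝ (EuclideanSpace ℝ (Fin n)) :=
  Submodule.span ℝ (Set.range fun c : κ => WithLp.toLp 2 fun i : Fin n => A i c)

/-- The `n × 2` matrix `E_{n,s}(ω)` whose `j`-th row, `1 ≤ j ≤ n`, is
`(j ^ s * cos (j ω), j ^ s * sin (j ω))`; rows are indexed from zero here. -/
def trigMat (n s : ℕ) (ω : ℝ) : Matrix (Fin n) (Fin 2) ℝ :=
  Matrix.of fun j =>
    ![((j : ℝ) + 1) ^ s * Real.cos (((j : ℝ) + 1) * ω),
      ((j : ℝ) + 1) ^ s * Real.sin (((j : ℝ) + 1) * ω)]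

/-- `ρ(ω, L) = min {s ∈ ℕ ∪ {0} : span E_{n,s}(ω) ⊄ L}`; the set is nonempty for every proper
subspace `L` and every `ω ∈ [0, π]`. -/
def rho {n : ℕ} (ω : ℝ) (L : Submodule ℝ (EuclideanSpace ℝ (Fin n))) : ℕ :=
  sInf {s : ℕ | ¬ colSpan (trigMat n s ω) ≤ L}

section Regression

variable {n q : ℕ} {κ : Type*} [Fintype κ]

/-- The affine space `M₀ = {X β : R β = r}` of means satisfying the null hypothesis. -/
def nullMeans (X : Matrix (Fin n) κ ℝ) (R : Matrix (Fin q) κ ℝ) (r : Fin q → ℝ) :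
    Set (EuclideanSpace ℝ (Fin n)) :=
  {μ | ∃ β : κ → ℝ, μ = WithLp.toLp 2 (X *ᵥ β) ∧ R *ᵥ β = r}

/-- The linear space `M₀^lin = {X β : R β = 0}` parallel to `M₀` (see `coe_nullDir`). -/
def nullDir (X : Matrix (Fin n) κ ℝ) (R : Matrix (Fin q) κ ℝ) :
    Submodule ℝ (EuclideanSpace ℝ (Fin n)) where
  carrier := {v | ∃ β : κ → ℝ, v = WithLp.toLp 2 (X *ᵥ β) ∧ R *ᵥ β = 0}
  add_mem' := by
    rintro _ _ ⟨b, rfl, hb⟩ ⟨c, rfl, hc⟩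
    exact ⟨b + c, by rw [Matrix.mulVec_add, WithLp.toLp_add],
      by rw [Matrix.mulVec_add, hb, hc, add_zero]⟩
  zero_mem' := ⟨0, by simp, by simp⟩
  smul_mem' := by
    rintro a _ ⟨b, rfl, hb⟩
    exact ⟨a • b, by rw [Matrix.mulVec_smul, WithLp.toLp_smul],
      by rw [Matrix.mulVec_smul, hb, smul_zero]⟩

/-- `M₀^lin = M₀ - μ₀` for every `μ₀ ∈ M₀`. -/
theorem coe_nullDir (X : Matrix (Fin n) κ ℝ) (R : Matrix (Fin q) κ ℝ) (r : Fin q → ℝ)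
    (μ₀ : EuclideanSpace ℝ (Fin n)) (h : μ₀ ∈ nullMeans X R r) :
    (nullDir X R : Set (EuclideanSpace ℝ (Fin n))) = (fun μ => μ - μ₀) '' nullMeans X R r := by
  obtain ⟨b, rfl, hb⟩ := h
  ext v
  constructor
  · rintro ⟨c, rfl, hc⟩
    refine ⟨WithLp.toLp 2 (X *ᵥ (c + b)), ⟨c + b, rfl, ?_⟩, ?_⟩
    · rw [Matrix.mulVec_add, hb, hc, zero_add]
    · simp [Matrix.mulVec_add]
  · rintro ⟨_, ⟨c, rfl, hc⟩, rfl⟩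
    refine ⟨c - b, ?_, ?_⟩
    · simp [Matrix.mulVec_sub]
    · rw [Matrix.mulVec_sub, hb, hc, sub_self]

variable [DecidableEq κ]

/-- The ordinary least squares estimator `(X'X)⁻¹ X' y`. -/
def ols (X : Matrix (Fin n) κ ℝ) (y : EuclideanSpace ℝ (Fin n)) : κ → ℝ :=
  (Xᵀ * X)⁻¹ *ᵥ (Xᵀ *ᵥ y.ofLp)

/-- The least squares residual vector `y - X (X'X)⁻¹ X' y`. -/
def resid (X : Matrix (Fin n) κ ℝ) (y : EuclideanSpace ℝ (Fin n)) : Fin n → ℝ :=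
  y.ofLp - X *ᵥ ols X y

/-- The matrix `B(y) = R (X'X)⁻¹ X' diag(û₁(y), …, ûₙ(y))`. -/
def bMat (X : Matrix (Fin n) κ ℝ) (R : Matrix (Fin q) κ ℝ) (y : EuclideanSpace ℝ (Fin n)) :
    Matrix (Fin q) (Fin n) ℝ :=
  R * (Xᵀ * X)⁻¹ * Xᵀ * Matrix.diagonal (resid X y)

/-- The set `B = {y : rank B(y) < q}`. -/
def bSet (X : Matrix (Fin n) κ ℝ) (R : Matrix (Fin q) κ ℝ) : Set (EuclideanSpace ℝ (Fin n)) :=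
  {y | (bMat X R y).rank < q}

open Classical in
/-- The matrix `R (X'X)⁻¹ X'` has rank `q` also after deletion, in `X'`, of all columns whose
index `i` satisfies `eᵢ ∈ span X`. -/
def RankAssumption (X : Matrix (Fin n) κ ℝ) (R : Matrix (Fin q) κ ℝ) : Prop :=
  (R * (Xᵀ * X)⁻¹ *
    Xᵀ.submatrix id
      (fun i : {i : Fin n // EuclideanSpace.single i (1 : ℝ) ∉ colSpan X} => (i : Fin n))).rank = q

/-- `n R (X'X)⁻¹ Ψ (X'X)⁻¹ R'`. -/
def omegaOf (X : Matrix (Fin n) κ ℝ) (R : Matrix (Fin q) κ ℝ) (Ψ : Matrix κ κ ℝ) :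
    Matrix (Fin q) (Fin q) ℝ :=
  (n : ℝ) • (R * (Xᵀ * X)⁻¹ * Ψ * (Xᵀ * X)⁻¹ * Rᵀ)

/-- The test statistic `(R β̂ - r)' Ω̂⁻¹ (R β̂ - r)` with `Ω̂(y) = n R (X'X)⁻¹ Ψ̂(y) (X'X)⁻¹ R'`,
set to zero where `Ω̂(y)` is singular. -/
def quadStat (X : Matrix (Fin n) κ ℝ) (R : Matrix (Fin q) κ ℝ) (r : Fin q → ℝ)
    (Ψ : EuclideanSpace ℝ (Fin n) → Matrix κ κ ℝ) (y : EuclideanSpace ℝ (Fin n)) : ℝ :=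
  open Classical in
  if (omegaOf X R (Ψ y)).det ≠ 0 then
    (R *ᵥ ols X y - r) ⬝ᵥ ((omegaOf X R (Ψ y))⁻¹ *ᵥ (R *ᵥ ols X y - r))
  else 0

/-- The vector `v̂ₜ(y) = ûₜ(y) xₜ'`, where `xₜ` is the `t`-th row of `X`. -/
def vHat (X : Matrix (Fin n) κ ℝ) (y : EuclideanSpace ℝ (Fin n)) (t : Fin n) : κ → ℝ :=
  resid X y t • X t

/-- `n⁻¹ ∑_{t = j+1}^{n} v̂ₜ(y) v̂ₜ₋ⱼ(y)'` for a lag `j ≥ 0`. -/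
def gammaNat (X : Matrix (Fin n) κ ℝ) (y : EuclideanSpace ℝ (Fin n)) (j : ℕ) : Matrix κ κ ℝ :=
  (n : ℝ)⁻¹ • ∑ t : Fin n, ∑ s : Fin n,
    if (t : ℕ) = (s : ℕ) + j then Matrix.vecMulVec (vHat X y t) (vHat X y s) else 0

/-- `Γ̂ⱼ(y)` for an integer lag, with `Γ̂ⱼ = Γ̂₋ⱼ'` for `j < 0`. -/
def gammaHat (X : Matrix (Fin n) κ ℝ) (y : EuclideanSpace ℝ (Fin n)) (j : ℤ) : Matrix κ κ ℝ :=
  if 0 ≤ j then gammaNat X y j.toNat else (gammaNat X y (-j).toNat)ᵀ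

/-- `Ψ̂_w(y) = ∑_{j = -(n-1)}^{n-1} w(j) Γ̂ⱼ(y)`. -/
def psiW (X : Matrix (Fin n) κ ℝ) (w : ℤ → ℝ) (y : EuclideanSpace ℝ (Fin n)) : Matrix κ κ ℝ :=
  ∑ j ∈ Finset.Icc (-((n : ℤ) - 1)) ((n : ℤ) - 1), w j • gammaHat X y j

/-- The autocorrelation robust test statistic `T_w`. -/
def statW (X : Matrix (Fin n) κ ℝ) (R : Matrix (Fin q) κ ℝ) (r : Fin q → ℝ) (w : ℤ → ℝ) :
    EuclideanSpace ℝ (Fin n) → ℝ :=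
  quadStat X R r (psiW X w)

/-- The `n × n` Toeplitz matrix with `(i,j)`-th element
`n⁻¹ ∑_{l = |i-j|+1}^{n} û_l(y) û_{l-|i-j|}(y)`. -/
def kHat (X : Matrix (Fin n) κ ℝ) (y : EuclideanSpace ℝ (Fin n)) : Matrix (Fin n) (Fin n) ℝ :=
  Matrix.of fun i j => (n : ℝ)⁻¹ * ∑ l : Fin n, ∑ m : Fin n,
    if (l : ℕ) = (m : ℕ) + ((i : ℤ) - (j : ℤ)).natAbs then resid X y l * resid X y m else 0

/-- `Ψ̂_{E,W}(y) = n⁻¹ X' (K̂(y) • W) X` with the Hadamard product `•`. -/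
def psiE (X : Matrix (Fin n) κ ℝ) (W : Matrix (Fin n) (Fin n) ℝ)
    (y : EuclideanSpace ℝ (Fin n)) : Matrix κ κ ℝ :=
  (n : ℝ)⁻¹ • (Xᵀ * Matrix.hadamard (kHat X y) W * X)

/-- The weighted Eicker-test statistic `T_{E,W}`. -/
def statE (X : Matrix (Fin n) κ ℝ) (R : Matrix (Fin q) κ ℝ) (r : Fin q → ℝ)
    (W : Matrix (Fin n) (Fin n) ℝ) : EuclideanSpace ℝ (Fin n) → ℝ :=
  quadStat X R r (psiE X W)

end Regression

/-- The condition on the weights `w(j)`, `|j| ≤ n - 1`, of `T_w`: `w(0) = 1`, `w(-j) = w(j)`, and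
the Toeplitz matrix `(w(i-j))` is positive definite. -/
def WeightAssumption (n : ℕ) (w : ℤ → ℝ) : Prop :=
  w 0 = 1 ∧ (∀ j : ℤ, |j| ≤ (n : ℤ) - 1 → w (-j) = w j) ∧
    (Matrix.of fun i j : Fin n => w ((i : ℤ) - (j : ℤ))).PosDef

/-- Symmetric nonnegative definite Toeplitz matrices with ones on the main diagonal. -/
def EickerWeights {n : ℕ} (W : Matrix (Fin n) (Fin n) ℝ) : Prop :=
  W.PosSemidef ∧ (∀ i, W i i = 1) ∧
    ∀ i j i' j' : Fin n, (i : ℤ) - (j : ℤ) = (i' : ℤ) - (j' : ℤ) → W i j = W i' j'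

/-- The set `F_all` of all normalized spectral densities: even, nonnegative, integrable functions
on `[-π, π]` with integral one. -/
def specAll : Set (ℝ → ℝ) :=
  {f | (∀ ω ∈ Set.Icc (-Real.pi) Real.pi, f (-ω) = f ω) ∧
    (∀ ω ∈ Set.Icc (-Real.pi) Real.pi, 0 ≤ f ω) ∧
    IntegrableOn f (Set.Icc (-Real.pi) Real.pi) ∧
    ∫ ω in (-Real.pi)..Real.pi, f ω = 1}

/-- The covariance matrix `Σ(f)` with entries `∫_{-π}^{π} exp(-ι (j - l) ω) f(ω) dω`
(these are real since `f` is even). -/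
def specCov (n : ℕ) (f : ℝ → ℝ) : Matrix (Fin n) (Fin n) ℝ :=
  Matrix.of fun j l =>
    (∫ ω in (-Real.pi)..Real.pi,
      Complex.exp (-Complex.I * (((j : ℝ) - (l : ℝ) : ℝ) : ℂ) * (ω : ℂ)) * ((f ω : ℝ) : ℂ)).re

/-- The covariance model `C(F_all) = {Σ(f) : f ∈ F_all}`. -/
def covModel (n : ℕ) : Set (Matrix (Fin n) (Fin n) ℝ) :=
  specCov n '' specAll

section Size

variable {n : ℕ}

/-- The size `sup_{μ₀ ∈ M₀} sup_{0 < σ² < ∞} sup_{Σ ∈ C} P_{μ₀, σ² Σ}(T ≥ c)` of the test that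
rejects for `T ≥ c`, where `P_{μ, A}` is the Gaussian distribution with mean `μ` and covariance
matrix `A`. -/
def testSize (M₀ : Set (EuclideanSpace ℝ (Fin n))) (cov : Set (Matrix (Fin n) (Fin n) ℝ))
    (T : EuclideanSpace ℝ (Fin n) → ℝ) (c : ℝ) : ENNReal :=
  ⨆ μ ∈ M₀, ⨆ v ∈ Set.Ioi (0 : ℝ), ⨆ S ∈ cov, multivariateGaussian μ (v • S) {y | c ≤ T y}

/-- The matrix of the orthogonal projection onto the orthogonal complement of `L`. -/
def projPerp (L : Submodule ℝ (EuclideanSpace ℝ (Fin n))) : Matrix (Fin n) (Fin n) ℝ :=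
  (Matrix.toEuclideanCLM (n := Fin n) (𝕜 := ℝ)).symm Lᗮ.starProjection

/-- The Frobenius norm of a matrix. -/
def frobNorm (A : Matrix (Fin n) (Fin n) ℝ) : ℝ :=
  Real.sqrt (∑ i, ∑ j, A i j ^ 2)

/-- `L(Σ) = Π Σ Π / ‖Π Σ Π‖` with `Π` the orthogonal projection onto the orthogonal complement
of `L`. -/
def normProj (L : Submodule ℝ (EuclideanSpace ℝ (Fin n))) (S : Matrix (Fin n) (Fin n) ℝ) :
    Matrix (Fin n) (Fin n) ℝ :=
  (frobNorm (projPerp L * S * projPerp L))⁻¹ • (projPerp L * S * projPerp L)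

/-- The collection `J(L, C)` of the spans of those matrices in the closure of `{L(Σ) : Σ ∈ C}`
whose rank is smaller than `n - dim L`. -/
def concSpaces (L : Submodule ℝ (EuclideanSpace ℝ (Fin n)))
    (cov : Set (Matrix (Fin n) (Fin n) ℝ)) : Set (Submodule ℝ (EuclideanSpace ℝ (Fin n))) :=
  {S | ∃ A ∈ closure (normProj L '' cov), A.rank + Module.finrank ℝ L < n ∧ S = colSpan A}

/-- Lebesgue measure on the affine space `μ + S`, as a measure on `ℝⁿ`. -/
def affineLebesgue (μ : EuclideanSpace ℝ (Fin n))
    (S : Submodule ℝ (EuclideanSpace ℝ (Fin n))) : Measure (EuclideanSpace ℝ (Fin n)) :=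
  Measure.map (fun s : S => μ + (s : EuclideanSpace ℝ (Fin n))) (volume : Measure S)

/-- `C^*`, the supremum of the constants `C(S)`, over all `S ∈ J(L, C)` such that `T` is equal to
a constant `C(S)` almost everywhere on `μ₀ + S` for some `μ₀ ∈ M₀`; it is `-∞` if there are no
such `S`. -/
def cStar (M₀ : Set (EuclideanSpace ℝ (Fin n))) (L : Submodule ℝ (EuclideanSpace ℝ (Fin n)))
    (cov : Set (Matrix (Fin n) (Fin n) ℝ)) (T : EuclideanSpace ℝ (Fin n) → ℝ) : EReal :=
  sSup {x : EReal | ∃ c : ℝ, x = (c : EReal) ∧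
    ∃ S ∈ concSpaces L cov, ∃ μ₀ ∈ M₀, ∀ᵐ y ∂(affineLebesgue μ₀ S), T y = c}

/-- `α^*`, the supremum over all real `c > C^*` of the size of the test rejecting for `T ≥ c`. -/
def alphaStar (M₀ : Set (EuclideanSpace ℝ (Fin n)))
    (L : Submodule ℝ (EuclideanSpace ℝ (Fin n)))
    (cov : Set (Matrix (Fin n) (Fin n) ℝ)) (T : EuclideanSpace ℝ (Fin n) → ℝ) : ENNReal :=
  ⨆ (c : ℝ) (_ : cStar M₀ L cov T < (c : EReal)), testSize M₀ cov T c

/-- For every `0 < α < 1` there is a real critical value for which the size is at most `α`; and if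
moreover `α ≤ α^*`, then there is one for which the size equals `α`. -/
def SizeControllable (M₀ : Set (EuclideanSpace ℝ (Fin n)))
    (L : Submodule ℝ (EuclideanSpace ℝ (Fin n)))
    (cov : Set (Matrix (Fin n) (Fin n) ℝ)) (T : EuclideanSpace ℝ (Fin n) → ℝ) : Prop :=
  ∀ α : ℝ, 0 < α → α < 1 →
    (∃ c : ℝ, testSize M₀ cov T c ≤ ENNReal.ofReal α) ∧
    (ENNReal.ofReal α ≤ alphaStar M₀ L cov T →
      ∃ c : ℝ, testSize M₀ cov T c = ENNReal.ofReal α)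

end Size

end

end SizeControl

/-! The argument splits into a genericity part for the design and a compactness part for the size.

Genericity. Every exceptional set of matrices `Xt` is covered by countably many images of smooth
maps from spaces of dimension smaller than that of the matrix space; such images are null
(`ae_notMem_range_of_finrank_lt`). A frequency may enter these maps as one more parameter, which
handles uncountably many γ at once. Two facts come out. By `ae_rows_dichotomy`, for every set I of
rows, either vanishing of Xβ on I kills the `Xt`-part of β, or no nonzero vector supported on I is
orthogonal to span X. Applied to the support of a nonzero residual vector the second case is
impossible, and since R = (0, Rt) only sees the `Xt`-part, B(y) has rank q off span X. By
`ae_forall_not_colSpan_trigMat_rho_le`, the first matrix E_{n,s}(γ) that leaves span F also leaves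
span X. As span F ≤ M₀^lin ≤ span X, the index ρ is the same for all three spaces.

Size control. Write L = M₀^lin and M = span X. Both statistics are ratios of polynomials with
positive denominator off M, vanish on M, and are invariant under the affine maps that fix the null
hypothesis (`RegularStat`). Invariance reduces the size to a supremum over normalized matrices
ΠΣΠ/‖ΠΣΠ‖ with one fixed mean. The closure of this set is compact, so the only danger is a limit law
sitting on M, where the statistic is discontinuous. The trace of ΠΣ(f)Π is the integral of f against
the squared distance of E_{n,0}(ω) from L, and likewise for M. At γ the first distance vanishes to
order at least 2ρ and, by the frequency condition, the second to order at most 2ρ; compactness of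
[0,π] makes the ratio bounded (`exists_energy_le`). Hence the part of a limit matrix outside M stays
bounded away from zero (`exists_forall_mem_closure_normProj`), and limiting Gaussian laws give M
probability zero.

Weak convergence and the portmanteau theorem then show that the size tends to zero, is right
continuous, and is left continuous above C^*. For the last two points the law of the statistic must
have no atom; the zero set of an analytic function is either null for a Gaussian law or contains its
whole support, and the latter is what C^* records (`RegularStat.ae_ne`). An exact critical value
comes from an intermediate-value argument (`RegularStat.sizeControllable`). -/

namespace SizeControl

open MeasureTheory ProbabilityTheory Matrix

/-! ### Null sets -/

/-- The range of a `C¹` map from a space of lower dimension is a null set. -/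
theorem ae_notMem_range_of_finrank_lt {D V : Type*} [NormedAddCommGroup D] [NormedSpace ℝ D]
    [FiniteDimensional ℝ D] [NormedAddCommGroup V] [NormedSpace ℝ V] [FiniteDimensional ℝ V]
    [MeasurableSpace V] [BorelSpace V] (μ : Measure V) [μ.IsAddHaarMeasure]
    {f : D → V} (hf : ContDiff ℝ 1 f) (h : Module.finrank ℝ D < Module.finrank ℝ V) :
    ∀ᵐ x ∂μ, x ∉ Set.range f := by
  have h1 : dimH (Set.range f) < ((Module.finrank ℝ V : NNReal) : ENNReal) :=
    lt_of_le_of_lt hf.dimH_range_le (by exact_mod_cast h)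
  -- In top dimension Hausdorff measure is itself a Haar measure, so a set of smaller Hausdorff
  -- dimension is null for μ.
  have h2 : μ ≪ Measure.hausdorffMeasure ((Module.finrank ℝ V : NNReal) : ℝ) := by
    have : (Measure.hausdorffMeasure ((Module.finrank ℝ V : NNReal) : ℝ) :
        Measure V).IsAddHaarMeasure := by
      simpa using MeasureTheory.isAddHaarMeasure_hausdorffMeasure (E := V)
    exact Measure.absolutelyContinuous_isAddHaarMeasure _ _
  have h3 := measure_zero_of_dimH_lt h2 h1
  rw [ae_iff]
  simpa only [not_not, Set.ofPred_mem_eq] using h3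

/-- For almost every matrix, the columns with index in `J` are not all combinations of the other
columns and of the vectors `G p a`, for any value of the parameter `p`. -/
theorem ae_not_exists_columns_eq {n m : ℕ} {P K : Type*} [NormedAddCommGroup P] [NormedSpace ℝ P]
    [FiniteDimensional ℝ P] [Fintype K] (G : P → K → Fin n → ℝ)
    (hG : ∀ a i, ContDiff ℝ 1 fun p => G p a i) (J : Finset (Fin m))
    (h : Module.finrank ℝ P + J.card * (Fintype.card K + (m - J.card)) < n * J.card) :
    ∀ᵐ Xt : Fin n → Fin m → ℝ, ¬ ∃ p, ∀ j ∈ J, ∃ (b : K → ℝ) (c : {l // l ∉ J} → ℝ),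
      ∀ i, Xt i j = ∑ a, b a * G p a i + ∑ l, c l * Xt i l := by
  classical
  -- A bad matrix is determined by the parameter p, the coefficients of its dependent columns, and
  -- its remaining columns; the hypothesis `h` says exactly that these data have fewer than n·m
  -- dimensions.
  let D := P × (J → K → ℝ) × (J → {l // l ∉ J} → ℝ) × (Fin n → {l // l ∉ J} → ℝ)
  let φ : D → Fin n → Fin m → ℝ := fun d i l =>
    if hl : l ∈ J then ∑ a, d.2.1 ⟨l, hl⟩ a * G d.1 a i
      + ∑ l', d.2.2.1 ⟨l, hl⟩ l' * d.2.2.2 i l' else d.2.2.2 i ⟨l, hl⟩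
  have hφ : ContDiff ℝ 1 φ := by
    rw [contDiff_pi]; intro i; rw [contDiff_pi]; intro l
    by_cases hl : l ∈ J
    · simp only [φ, hl, dite_true]
      refine ContDiff.add (ContDiff.sum fun a _ => ContDiff.mul ?_ ((hG a i).comp contDiff_fst))
        (ContDiff.sum fun a _ => ContDiff.mul ?_ ?_) <;> fun_prop
    · simp only [φ, hl, dite_false]; fun_prop
  have hJ : J.card ≤ m := by simpa using Finset.card_le_univ J
  have hdim : Module.finrank ℝ D < Module.finrank ℝ (Fin n → Fin m → ℝ) := by
    have hc : Fintype.card {l // l ∉ J} = m - J.card := by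
      rw [Fintype.card_subtype_compl]; simp
    simp only [D, Module.finrank_prod, Module.finrank_pi_fintype, Module.finrank_self, hc,
      Finset.sum_const, Finset.card_univ, Fintype.card_coe, Fintype.card_fin, smul_eq_mul, mul_one]
    generalize hd : m - J.card = d at h ⊢
    have hm : m = J.card + d := by omega
    have hnm : n * m = n * J.card + n * d := by rw [← mul_add, ← hm]
    nlinarith
  filter_upwards [ae_notMem_range_of_finrank_lt volume hφ hdim] with Xt hXt
  rintro ⟨p, hp⟩
  choose b c hbc using hp
  refine hXt ⟨(p, fun j => b j j.2, fun j => c j j.2, fun i l => Xt i l), ?_⟩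
  ext i l
  by_cases hl : l ∈ J
  · simp only [φ, hl, dite_true]; exact (hbc l hl i).symm
  · simp [φ, hl]

/-- Solving a linear relation between columns for the column with index `j`. -/
theorem exists_column_eq {n m : ℕ} {K : Type*} [Fintype K] (g : K → Fin n → ℝ)
    (Xt : Fin n → Fin m → ℝ) {J : Finset (Fin m)} {j : Fin m} (hj : j ∈ J) {c : Fin m → ℝ}
    (hcj : c j ≠ 0) (hc : ∀ l ∈ J, l ≠ j → c l = 0) {b : K → ℝ}
    (h : ∀ i, ∑ l, Xt i l * c l = ∑ a, b a * g a i) :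
    ∃ (b' : K → ℝ) (c' : {l // l ∉ J} → ℝ),
      ∀ i, Xt i j = ∑ a, b' a * g a i + ∑ l, c' l * Xt i l := by
  refine ⟨fun a => (c j)⁻¹ * b a, fun l => -((c j)⁻¹ * c l), fun i => ?_⟩
  have h2 : ∑ l, Xt i l * c l = Xt i j * c j + ∑ l : {l // l ∉ J}, Xt i l * c l := by
    rw [← Fintype.sum_subtype_add_sum_subtype (fun l => l ∈ J) fun l => Xt i l * c l]
    congr 1
    rw [Finset.sum_eq_single (⟨j, hj⟩ : {l // l ∈ J})]
    · rintro ⟨l, hl⟩ _ hne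
      rw [hc l hl (by simpa using hne), mul_zero]
    · simp
  have h4 := h i
  rw [h2] at h4
  have h5 : ∑ l : {l // l ∉ J}, -((c j)⁻¹ * c l) * Xt i l
      = -((c j)⁻¹ * ∑ l : {l // l ∉ J}, Xt i l * c l) := by
    rw [Finset.mul_sum, ← Finset.sum_neg_distrib]
    exact Finset.sum_congr rfl fun l _ => by ring
  simp only [mul_assoc, ← Finset.mul_sum] at h5 ⊢
  rw [h5, ← h4]
  field_simp
  ring

/-- For almost every matrix, no nontrivial combination of its columns is a combination of the
vectors `G p a`, for any value of the parameter `p`. -/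
theorem ae_forall_eq_zero_of_sum_eq {n m : ℕ} {P K : Type*} [NormedAddCommGroup P]
    [NormedSpace ℝ P] [FiniteDimensional ℝ P] [Fintype K] (G : P → K → Fin n → ℝ)
    (hG : ∀ a i, ContDiff ℝ 1 fun p => G p a i)
    (h : Module.finrank ℝ P + Fintype.card K + m ≤ n) :
    ∀ᵐ Xt : Fin n → Fin m → ℝ, ∀ (p : P) (b : K → ℝ) (c : Fin m → ℝ),
      (∀ i, ∑ l, Xt i l * c l = ∑ a, b a * G p a i) → c = 0 := by
  -- Some coefficient c j is nonzero, so it suffices to exclude, for each j, that column j alone is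
  -- dependent: |J| = 1 in the dimension count.
  have key := fun j : Fin m => ae_not_exists_columns_eq (m := m) G hG {j}
    (by have := j.pos; simp; omega)
  filter_upwards [ae_all_iff.2 key] with Xt hXt p b c hc
  by_contra hne
  obtain ⟨j, hj⟩ := Function.ne_iff.1 hne
  refine hXt j ⟨p, ?_⟩
  simp only [Finset.mem_singleton, forall_eq]
  exact exists_column_eq (G p) Xt (by simp) hj (by simp) hc

/-- For almost every matrix, the combinations of its columns that are combinations of the
vectors `G p a` form a space of dimension at most one, for any value of the parameter `p`. -/
theorem ae_forall_eq_smul_of_sum_eq {n m : ℕ} {P K : Type*} [NormedAddCommGroup P]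
    [NormedSpace ℝ P] [FiniteDimensional ℝ P] [Fintype K] (G : P → K → Fin n → ℝ)
    (hG : ∀ a i, ContDiff ℝ 1 fun p => G p a i)
    (h : Module.finrank ℝ P + 2 * Fintype.card K + 2 * m < 2 * n + 4) :
    ∀ᵐ Xt : Fin n → Fin m → ℝ, ∀ (p : P) (b b' : K → ℝ) (c c' : Fin m → ℝ),
      (∀ i, ∑ l, Xt i l * c l = ∑ a, b a * G p a i) →
      (∀ i, ∑ l, Xt i l * c' l = ∑ a, b' a * G p a i) → c = 0 ∨ ∃ s : ℝ, c' = s • c := by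
  classical
  have key : ∀ j l : Fin m, j ≠ l → ∀ᵐ Xt : Fin n → Fin m → ℝ, ¬ ∃ p, ∀ j' ∈ ({j, l} : Finset _),
      ∃ (b : K → ℝ) (c : {l' // l' ∉ ({j, l} : Finset (Fin m))} → ℝ),
      ∀ i, Xt i j' = ∑ a, b a * G p a i + ∑ l, c l * Xt i l := by
    intro j l hjl
    apply ae_not_exists_columns_eq G hG
    have := j.isLt
    have := l.isLt
    have : (j : ℕ) ≠ l := fun h => hjl (Fin.ext h)
    rw [Finset.card_pair hjl]
    omega
  simp only [← ae_all_iff] at key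
  filter_upwards [key] with Xt hXt p b b' c c' hc hc'
  by_contra! hne
  obtain ⟨hne, hs⟩ := hne
  obtain ⟨j, hj⟩ := Function.ne_iff.1 hne
  have hj : c j ≠ 0 := hj
  obtain ⟨l, hl⟩ := Function.ne_iff.1 (hs (c' j / c j))
  have hd : c' l - (c' j / c j) * c l ≠ 0 := by
    simpa [sub_eq_zero] using hl
  have hjl : j ≠ l := by
    rintro rfl
    exact hd (by field_simp; ring)
  -- Gaussian elimination on the two relations: d has no entry at j, and below e has none at l,
  -- while d l and e j are nonzero. So both columns j and l depend on the columns outside {j, l}.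
  set d := c' - (c' j / c j) • c with hdd
  have hdj : d j = 0 := by simp [d]; field_simp; ring
  have hdl : d l ≠ 0 := by simpa [d] using hd
  have hde : ∀ i, ∑ l, Xt i l * d l = ∑ a, (b' - (c' j / c j) • b) a * G p a i := by
    intro i
    simp only [d, Pi.sub_apply, Pi.smul_apply, smul_eq_mul, mul_sub, sub_mul,
      Finset.sum_sub_distrib, hc', mul_left_comm _ (c' j / c j), mul_assoc,
      ← Finset.mul_sum, hc]
  set e := c - (c l / d l) • d with hee
  have hel : e l = 0 := by simp [e]; field_simp; ring
  have hej : e j ≠ 0 := by simpa [e, hdj] using hj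
  have hed : ∀ i, ∑ l, Xt i l * e l
      = ∑ a, (b - (c l / d l) • (b' - (c' j / c j) • b)) a * G p a i := by
    intro i
    simp only [e, Pi.sub_apply _ ((c l / d l) • d), Pi.smul_apply (c l / d l),
      Pi.sub_apply b, smul_eq_mul, mul_sub (Xt _ _),
      sub_mul (b _), Finset.sum_sub_distrib, hc, mul_left_comm _ (c l / d l),
      mul_assoc (c l / d l), ← Finset.mul_sum, hde]
  refine hXt j l hjl ⟨p, ?_⟩
  simp only [Finset.mem_insert, Finset.mem_singleton, forall_eq_or_imp, forall_eq]
  exact ⟨exists_column_eq (G p) Xt (by simp) hej (by simp [hel]) hed,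
    exists_column_eq (G p) Xt (by simp) hdl (by simp [hdj]) hde⟩

/-- The columns of almost every `n × m` matrix are linearly independent modulo a given subspace
of dimension at most `n - m`. -/
theorem ae_eq_zero_of_mulVec_mem {n m : ℕ} (U : Submodule ℝ (Fin n → ℝ))
    (h : Module.finrank ℝ U + m ≤ n) :
    ∀ᵐ Xt : Fin n → Fin m → ℝ, ∀ c : Fin m → ℝ, Matrix.of Xt *ᵥ c ∈ U → c = 0 := by
  let B := Module.finBasis ℝ U
  have := ae_forall_eq_zero_of_sum_eq (m := m)
    (fun (_ : Fin 0 → ℝ) a => (B a : Fin n → ℝ)) (fun _ _ => contDiff_const) (by simpa using h)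
  filter_upwards [this] with Xt hXt c hc
  refine hXt 0 (B.repr ⟨_, hc⟩) c fun i => ?_
  have := congrFun (congrArg (Subtype.val) (B.sum_repr ⟨_, hc⟩)) i
  simp only [AddSubmonoidClass.coe_finsetSum, SetLike.val_smul, Finset.sum_apply,
    Pi.smul_apply, smul_eq_mul] at this
  exact this.symm

/-- The columns of almost every `n × m` matrix, together with a given subspace of dimension at
least `n - m`, span everything. -/
theorem ae_eq_zero_of_dotProduct_eq_zero {n m : ℕ} (U : Submodule ℝ (Fin n → ℝ)) (hm : m ≤ n)
    (h : n ≤ Module.finrank ℝ U + m) :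
    ∀ᵐ Xt : Fin n → Fin m → ℝ, ∀ u : Fin n → ℝ, (∀ x ∈ U, u ⬝ᵥ x = 0) →
      u ᵥ* Matrix.of Xt = 0 → u = 0 := by
  -- Shrinking U to dimension exactly n - m makes generic independence modulo V the same as spanning
  -- a complement of V, so that u is orthogonal to the whole space.
  obtain ⟨V, hVU, hV⟩ : ∃ V ≤ U, Module.finrank ℝ V = n - m := by
    obtain ⟨f, hf⟩ := exists_linearIndependent_of_le_finrank (R := ℝ) (M := U) (n := n - m)
      (by omega)
    refine ⟨Submodule.span ℝ (Set.range (U.subtype ∘ f)), ?_, ?_⟩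
    · rw [Submodule.span_le]
      rintro _ ⟨a, rfl⟩
      exact (f a).2
    · rw [finrank_span_eq_card (hf.map' _ U.ker_subtype), Fintype.card_fin]
  filter_upwards [ae_eq_zero_of_mulVec_mem (m := m) V (by omega)] with Xt hXt u hu hu'
  have hinj : Function.Injective (Matrix.mulVecLin (Matrix.of Xt)) := by
    rw [← LinearMap.ker_eq_bot, LinearMap.ker_eq_bot']
    intro c hc
    apply hXt c
    rw [← Matrix.mulVecLin_apply, hc]
    exact V.zero_mem
  have hdis : V ⊓ LinearMap.range (Matrix.mulVecLin (Matrix.of Xt)) = ⊥ := by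
    rw [eq_bot_iff]
    rintro _ ⟨hxV, c, rfl⟩
    simp [hXt c hxV]
  have htop : V ⊔ LinearMap.range (Matrix.mulVecLin (Matrix.of Xt)) = ⊤ := by
    apply Submodule.eq_top_of_finrank_eq
    have := Submodule.finrank_sup_add_finrank_inf_eq V
      (LinearMap.range (Matrix.mulVecLin (Matrix.of Xt)))
    rw [hdis, finrank_bot, hV, LinearMap.finrank_range_of_inj hinj] at this
    simp at this ⊢
    omega
  have hmem : u ∈ V ⊔ LinearMap.range (Matrix.mulVecLin (Matrix.of Xt)) := htop ▸ trivial
  obtain ⟨x, hx, _, ⟨c, rfl⟩, hxy⟩ := Submodule.mem_sup.1 hmem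
  have : u ⬝ᵥ u = 0 := by
    nth_rewrite 2 [← hxy]
    rw [dotProduct_add, Matrix.mulVecLin_apply, Matrix.dotProduct_mulVec, hu', hu x (hVU hx)]
    simp
  exact dotProduct_self_eq_zero.1 this

/-! ### Zero sets of analytic functions -/

/-- By the identity theorem the zeros of a function that is not identically zero are discrete, and a
discrete subset of a hereditarily Lindelöf space is countable. -/
theorem countable_setOf_eq_zero_of_analyticOnNhd {f : ℝ → ℝ} (hf : AnalyticOnNhd ℝ f Set.univ)
    {x₀ : ℝ} (h₀ : f x₀ ≠ 0) : {x | f x = 0}.Countable := by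
  have h := (hf.eqOn_zero_or_eventually_ne_zero_of_preconnected isPreconnected_univ).resolve_left
    fun h => h₀ (h (Set.mem_univ x₀))
  have hd : IsDiscrete ({x | f x = 0} ∩ Set.univ) := isDiscrete_of_codiscreteWithin h
  simpa using (HereditarilyLindelofSpace.isLindelof _).countable_of_isDiscrete hd

/-- Induction on the dimension with Fubini. The only property of ν that matters is that countable
sets are null. -/
theorem ae_pi_ne_zero_of_analyticOnNhd (ν : Measure ℝ) [SigmaFinite ν] [NullSingletonClass ν] (n : ℕ)
    {f : (Fin n → ℝ) → ℝ} (hf : AnalyticOnNhd ℝ f Set.univ) {x₀ : Fin n → ℝ} (h₀ : f x₀ ≠ 0) :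
    ∀ᵐ x ∂Measure.pi (fun _ : Fin n => ν), f x ≠ 0 := by
  induction n with
  | zero => exact Filter.Eventually.of_forall fun x => by rwa [Subsingleton.elim x x₀]
  | succ n ih =>
    have hmp := measurePreserving_piFinSuccAbove (fun _ : Fin (n + 1) => ν) 0
    have hc : Continuous f := continuousOn_univ.1 hf.continuousOn
    have hcons : AnalyticOnNhd ℝ (fun z : ℝ × (Fin n → ℝ) => (Fin.cons z.1 z.2 : Fin (n + 1) → ℝ))
        Set.univ := by
      rw [analyticOnNhd_pi_iff]
      intro i
      refine Fin.cases ?_ (fun j => ?_) i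
      · simpa using analyticOnNhd_fst
      · exact
          ((ContinuousLinearMap.proj (R := ℝ) (φ := fun _ : Fin n => ℝ) j).analyticOnNhd
            Set.univ).comp analyticOnNhd_snd (Set.mapsTo_univ _ _)
    have hg : AnalyticOnNhd ℝ (fun z : ℝ × (Fin n → ℝ) => f (Fin.cons z.1 z.2)) Set.univ :=
      hf.comp hcons (Set.mapsTo_univ _ _)
    have hgc : Continuous fun z : ℝ × (Fin n → ℝ) => f (Fin.cons z.1 z.2) :=
      continuousOn_univ.1 hg.continuousOn
    have hae : ∀ᵐ z ∂(ν.prod (Measure.pi fun _ : Fin n => ν)), f (Fin.cons z.1 z.2) ≠ 0 := by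
      have hm : MeasurableSet {z : ℝ × (Fin n → ℝ) | f (Fin.cons z.1 z.2) ≠ 0} :=
        (isOpen_ne.preimage hgc).measurableSet
      refine (Measure.ae_prod_mem_iff_ae_ae_mem hm).2 ?_
      -- With the other coordinates frozen at those of x₀, the function of the first coordinate is
      -- not identically zero. So for almost every t the slice at t is nonzero at the tail of x₀, as
      -- the induction hypothesis requires.
      have h1 : AnalyticOnNhd ℝ (fun t : ℝ => f (Fin.cons t (Fin.tail x₀))) Set.univ :=
        hg.comp (analyticOnNhd_id.prod analyticOnNhd_const) (Set.mapsTo_univ _ _)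
      have h2 := countable_setOf_eq_zero_of_analyticOnNhd h1 (x₀ := x₀ 0) (by simpa using h₀)
      have h3 : ∀ᵐ t ∂ν, f (Fin.cons t (Fin.tail x₀)) ≠ 0 := by
        rw [ae_iff]; simpa using h2.measure_zero ν
      filter_upwards [h3] with t ht
      exact ih (hg.comp (analyticOnNhd_const.prod analyticOnNhd_id) (Set.mapsTo_univ _ _)) ht
    filter_upwards [hmp.quasiMeasurePreserving.ae hae] with x hx
    have : (Fin.cons (x 0) (fun j => x (Fin.succAbove 0 j)) : Fin (n + 1) → ℝ) = x := by
      ext i; refine Fin.cases ?_ (fun j => ?_) i <;> simp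
    simpa [MeasurableEquiv.piFinSuccAbove, Fin.insertNthEquiv, Fin.removeNth, Fin.tail, this]
      using hx

/-- The zero set of a nonzero analytic function is a null set of the standard Gaussian. -/
theorem ae_stdGaussian_ne_zero_of_analyticOnNhd {E : Type*} [NormedAddCommGroup E]
    [InnerProductSpace ℝ E] [FiniteDimensional ℝ E] [MeasurableSpace E] [BorelSpace E]
    {f : E → ℝ} (hf : AnalyticOnNhd ℝ f Set.univ) {x₀ : E} (h₀ : f x₀ ≠ 0) :
    ∀ᵐ x ∂stdGaussian E, f x ≠ 0 := by
  let b := stdOrthonormalBasis ℝ E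
  have hc : Continuous f := continuousOn_univ.1 hf.continuousOn
  have hm : MeasurableSet {x | f x ≠ 0} := (isOpen_ne.preimage hc).measurableSet
  rw [stdGaussian, ae_map_iff (Measurable.aemeasurable (by fun_prop)) hm]
  have hlin : AnalyticOnNhd ℝ (fun x : Fin (Module.finrank ℝ E) → ℝ => ∑ i, x i • b i)
      Set.univ := by
    refine Finset.analyticOnNhd_fun_sum _ fun i _ => ?_
    exact ((ContinuousLinearMap.proj (R := ℝ) (φ := fun _ : Fin (Module.finrank ℝ E) => ℝ)
      i).analyticOnNhd Set.univ).smul analyticOnNhd_const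
  have : NullSingletonClass (gaussianReal 0 1) := nullSingletonClass_gaussianReal (by simp)
  refine ae_pi_ne_zero_of_analyticOnNhd (gaussianReal 0 1) _
    (hf.comp hlin (Set.mapsTo_univ _ _)) (x₀ := fun i => b.repr x₀ i) ?_
  change f (∑ i, b.repr x₀ i • b i) ≠ 0
  rwa [b.sum_repr]

/-! ### Linear algebra of the regression model -/

theorem mem_colSpan_iff {n : ℕ} {κ : Type*} [Fintype κ] (A : Matrix (Fin n) κ ℝ)
    (y : EuclideanSpace ℝ (Fin n)) : y ∈ colSpan A ↔ ∃ β : κ → ℝ, A *ᵥ β = y.ofLp := by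
  rw [colSpan, Submodule.mem_span_range_iff_exists_fun]
  refine exists_congr fun β => ?_
  rw [← (WithLp.linearEquiv 2 ℝ (Fin n → ℝ)).injective.eq_iff]
  simp only [WithLp.linearEquiv_apply, map_sum, map_smul]
  have : A *ᵥ β = ∑ c, β c • fun i => A i c := by
    ext i; simp [Matrix.mulVec, dotProduct, mul_comm]
  rw [this]
  rfl

theorem toLp_mulVec_mem_colSpan {n : ℕ} {κ : Type*} [Fintype κ] (A : Matrix (Fin n) κ ℝ)
    (β : κ → ℝ) : WithLp.toLp 2 (A *ᵥ β) ∈ colSpan A := (mem_colSpan_iff _ _).2 ⟨β, rfl⟩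

theorem colSpan_trigMat_le_iff {n : ℕ} (s : ℕ) (γ : ℝ)
    (L : Submodule ℝ (EuclideanSpace ℝ (Fin n))) :
    colSpan (trigMat n s γ) ≤ L ↔
      ∀ c : Fin 2, (WithLp.toLp 2 fun i => trigMat n s γ i c) ∈ L := by
  rw [colSpan, Submodule.span_le, Set.range_subset_iff]
  rfl

theorem rank_eq_iff_forall_vecMul {q : ℕ} {ι : Type*} [Fintype ι] (M : Matrix (Fin q) ι ℝ) :
    M.rank = q ↔ ∀ a, a ᵥ* M = 0 → a = 0 := by
  constructor
  · intro h
    have h1 : LinearIndependent ℝ M.row := by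
      rw [linearIndependent_iff_card_eq_finrank_span, Set.finrank, ← Matrix.rank_eq_finrank_span_row, h]
      simp
    have h2 := Matrix.vecMul_injective_iff.2 h1
    intro a ha
    exact h2 (by simpa using ha)
  · intro h
    have h2 : Function.Injective M.vecMul := by
      intro a b hab
      rw [← sub_eq_zero]
      apply h
      rw [Matrix.sub_vecMul]
      exact sub_eq_zero.2 hab
    have := (Matrix.vecMul_injective_iff.1 h2).rank_matrix
    simpa using this

theorem rank_eq_card_iff_forall_mulVec {n : ℕ} {κ : Type*} [Fintype κ] (A : Matrix (Fin n) κ ℝ) :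
    A.rank = Fintype.card κ ↔ ∀ β, A *ᵥ β = 0 → β = 0 := by
  rw [← Module.finrank_fintype_fun_eq_card (R := ℝ) (η := κ), Matrix.rank]
  have := LinearMap.finrank_range_add_finrank_ker A.mulVecLin
  constructor
  · intro h β hβ
    have h0 : Module.finrank ℝ (LinearMap.ker A.mulVecLin) = 0 := by omega
    have : β ∈ LinearMap.ker A.mulVecLin := by simpa using hβ
    rw [Submodule.finrank_eq_zero.1 h0] at this
    simpa using this
  · intro h
    have h0 : LinearMap.ker A.mulVecLin = ⊥ := by
      rw [LinearMap.ker_eq_bot']; simpa using h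
    rwa [h0, finrank_bot, add_zero] at this

section Ols

variable {n q : ℕ} {κ : Type*} [Fintype κ] {X : Matrix (Fin n) κ ℝ} {R : Matrix (Fin q) κ ℝ}

theorem posDef_gram (hX : ∀ β, X *ᵥ β = 0 → β = 0) : (Xᵀ * X).PosDef := by
  have := Matrix.PosDef.conjTranspose_mul_self X (fun a b hab => by
    rw [← sub_eq_zero]; apply hX; rw [Matrix.mulVec_sub]; exact sub_eq_zero.2 hab)
  simpa using this

theorem exists_notMem_colSpan (hcard : Fintype.card κ < n) :
    ∃ y : EuclideanSpace ℝ (Fin n), y ∉ colSpan X := by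
  by_contra! h
  have h1 : colSpan X = ⊤ := by rw [eq_top_iff]; intro y _; exact h y
  have h2 := finrank_range_le_card (R := ℝ)
    (fun c : κ => (WithLp.toLp 2 fun i : Fin n => X i c : EuclideanSpace ℝ (Fin n)))
  rw [Set.finrank, ← colSpan, h1, finrank_top, finrank_euclideanSpace_fin] at h2
  omega

variable [DecidableEq κ]

theorem isUnit_det_gram (hX : ∀ β, X *ᵥ β = 0 → β = 0) : IsUnit (Xᵀ * X).det :=
  (posDef_gram hX).det_pos.ne'.isUnit

theorem ols_mulVec (hX : ∀ β, X *ᵥ β = 0 → β = 0) (β : κ → ℝ) :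
    ols X (WithLp.toLp 2 (X *ᵥ β)) = β := by
  simp [ols, Matrix.mulVec_mulVec,
    Matrix.nonsing_inv_mul _ (isUnit_det_gram hX)]

theorem ols_add (y z : EuclideanSpace ℝ (Fin n)) : ols X (y + z) = ols X y + ols X z := by
  simp [ols, Matrix.mulVec_add]

theorem ols_smul (a : ℝ) (y : EuclideanSpace ℝ (Fin n)) : ols X (a • y) = a • ols X y := by
  simp [ols, Matrix.mulVec_smul]

theorem resid_add (y z : EuclideanSpace ℝ (Fin n)) : resid X (y + z) = resid X y + resid X z := by
  simp only [resid, ols_add, Matrix.mulVec_add, WithLp.ofLp_add]; abel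

theorem resid_smul (a : ℝ) (y : EuclideanSpace ℝ (Fin n)) : resid X (a • y) = a • resid X y := by
  simp [resid, ols_smul, Matrix.mulVec_smul, smul_sub]

theorem resid_vecMul (hX : ∀ β, X *ᵥ β = 0 → β = 0) (y : EuclideanSpace ℝ (Fin n)) :
    resid X y ᵥ* X = 0 := by
  rw [← Matrix.mulVec_transpose, resid, ols, Matrix.mulVec_sub, Matrix.mulVec_mulVec,
    Matrix.mulVec_mulVec, Matrix.mul_nonsing_inv _ (isUnit_det_gram hX), Matrix.one_mulVec,
    sub_self]

theorem resid_eq_zero_iff (hX : ∀ β, X *ᵥ β = 0 → β = 0) (y : EuclideanSpace ℝ (Fin n)) :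
    resid X y = 0 ↔ y ∈ colSpan X := by
  constructor
  · intro h
    exact (mem_colSpan_iff _ _).2 ⟨ols X y, (sub_eq_zero.1 h).symm⟩
  · intro h
    obtain ⟨β, hβ⟩ := (mem_colSpan_iff _ _).1 h
    have : y = WithLp.toLp 2 (X *ᵥ β) := by rw [hβ]
    rw [this, resid, ols_mulVec hX]
    simp

/-- `a' R (X'X)⁻¹ X'` is the fitted vector `X (X'X)⁻¹ R' a`. -/
theorem vecMul_olsMat (a : Fin q → ℝ) :
    a ᵥ* (R * (Xᵀ * X)⁻¹ * Xᵀ) = X *ᵥ ((Xᵀ * X)⁻¹ *ᵥ (Rᵀ *ᵥ a)) := by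
  have hs : ((Xᵀ * X)⁻¹)ᵀ = (Xᵀ * X)⁻¹ := by
    rw [Matrix.transpose_nonsing_inv]; simp
  rw [← Matrix.mulVec_transpose, Matrix.transpose_mul, Matrix.transpose_mul, hs,
    Matrix.transpose_transpose, Matrix.mulVec_mulVec, Matrix.mulVec_mulVec, Matrix.mul_assoc]

/-- If `R (X'X)⁻¹ R' a` vanishes, then so does `a`. -/
theorem eq_zero_of_mulVec_inv_gram (hX : ∀ β, X *ᵥ β = 0 → β = 0)
    (hR : R.rank = q) {a : Fin q → ℝ} (h : R *ᵥ ((Xᵀ * X)⁻¹ *ᵥ (Rᵀ *ᵥ a)) = 0) : a = 0 := by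
  have h1 : (Rᵀ *ᵥ a) ⬝ᵥ ((Xᵀ * X)⁻¹ *ᵥ (Rᵀ *ᵥ a)) = 0 := by
    nth_rewrite 1 [Matrix.mulVec_transpose]
    rw [← Matrix.dotProduct_mulVec, h, dotProduct_zero]
  have h2 : Rᵀ *ᵥ a = 0 := by
    by_contra hne
    have := (posDef_gram hX).inv.dotProduct_mulVec_pos hne
    simp only [star_trivial] at this
    exact this.ne' h1
  rw [Matrix.mulVec_transpose] at h2
  exact (rank_eq_iff_forall_vecMul R).1 hR a h2

/-- The condition that makes `rank B(y) = q` for all `y ∉ span X`. -/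
theorem bSet_eq_of_forall (hX : ∀ β, X *ᵥ β = 0 → β = 0) (hR : R.rank = q) (hq : 1 ≤ q)
    (h : ∀ u : Fin n → ℝ, u ᵥ* X = 0 → u ≠ 0 → ∀ β, (∀ i, u i ≠ 0 → (X *ᵥ β) i = 0) →
      R *ᵥ β = 0) :
    bSet X R = (colSpan X : Set (EuclideanSpace ℝ (Fin n))) := by
  ext y
  simp only [bSet, Set.mem_ofPred_eq, SetLike.mem_coe, ← resid_eq_zero_iff hX]
  constructor
  · intro hy
    by_contra hne
    refine hy.ne ((rank_eq_iff_forall_vecMul _).2 fun a ha => ?_)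
    rw [bMat, ← Matrix.vecMul_vecMul, vecMul_olsMat] at ha
    -- If a'B(y) = 0, then β = (X'X)⁻¹R'a satisfies (Xβ)ᵢ = 0 wherever the residual is nonzero; the
    -- hypothesis `h` then gives R(X'X)⁻¹R'a = 0.
    refine eq_zero_of_mulVec_inv_gram hX hR (h _ (resid_vecMul hX y) hne _ fun i hi => ?_)
    have := congrFun ha i
    rw [Matrix.vecMul_diagonal] at this
    simpa [hi] using this
  · intro hy
    rw [bMat, hy]
    have : (Matrix.diagonal (0 : Fin n → ℝ)) = 0 := by simp
    rw [this, Matrix.mul_zero, Matrix.rank_zero]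
    omega

open Classical in
-- Residuals are orthogonal to span X, so the i-th residual vanishes whenever eᵢ lies in span X. The
-- deleted columns thus contribute nothing to B(y), which has rank q for any y outside span X.
theorem rankAssumption_of_bSet_eq (hX : ∀ β, X *ᵥ β = 0 → β = 0) (hcard : Fintype.card κ < n)
    (h : bSet X R = (colSpan X : Set (EuclideanSpace ℝ (Fin n)))) : RankAssumption X R := by
  obtain ⟨y, hy⟩ := exists_notMem_colSpan (X := X) hcard
  have hy' : y ∉ bSet X R := by rw [h]; exact hy
  have hrank : (bMat X R y).rank = q :=
    le_antisymm (by simpa using Matrix.rank_le_height (bMat X R y)) (not_lt.1 hy')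
  rw [RankAssumption, rank_eq_iff_forall_vecMul]
  intro a ha
  refine (rank_eq_iff_forall_vecMul _).1 hrank a ?_
  rw [bMat, ← Matrix.vecMul_vecMul]
  ext i
  rw [Matrix.vecMul_diagonal]
  by_cases hi : EuclideanSpace.single i (1 : ℝ) ∈ colSpan X
  · obtain ⟨β, hβ⟩ := (mem_colSpan_iff _ _).1 hi
    have h1 : resid X y ⬝ᵥ (X *ᵥ β) = 0 := by
      rw [Matrix.dotProduct_mulVec, resid_vecMul hX, zero_dotProduct]
    rw [hβ] at h1
    have h2 : resid X y i = 0 := by simpa [EuclideanSpace.single] using h1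
    simp [h2]
  · have h1 : _ = (0 : ℝ) := congrFun ha ⟨i, hi⟩
    have h2 : (a ᵥ* (R * (Xᵀ * X)⁻¹ * Xᵀ)) i = 0 := by
      rw [← h1]
      simp [Matrix.vecMul, dotProduct, Matrix.mul_apply]
    simp [h2]

end Ols

/-! ### Generic design matrices -/

/-- A vector a orthogonal to L would have all moments ∑ aⱼ jˢ cos(jγ) and ∑ aⱼ jˢ sin(jγ) equal to
zero. The nodes j are distinct, so Vandermonde gives aⱼ cos(jγ) = aⱼ sin(jγ) = 0, hence a = 0. -/
theorem exists_colSpan_trigMat_not_le {n : ℕ} (γ : ℝ)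
    {L : Submodule ℝ (EuclideanSpace ℝ (Fin n))} (hL : L ≠ ⊤) :
    ∃ s, ¬ colSpan (trigMat n s γ) ≤ L := by
  by_contra! h
  have hb : Lᗮ ≠ ⊥ := fun hb => hL (Submodule.orthogonal_eq_bot_iff.1 hb)
  obtain ⟨a, ha, ha0⟩ := Submodule.exists_mem_ne_zero_of_ne_bot hb
  refine ha0 ?_
  have h1 : ∀ s (c : Fin 2), ∑ i, a i * trigMat n s γ i c = 0 := by
    intro s c
    have := (Submodule.mem_orthogonal _ _).1 ha _ ((colSpan_trigMat_le_iff s γ L).1 (h s) c)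
    simpa [PiLp.inner_apply] using this
  have h2 : ∀ c : Fin 2, (fun i => a i * trigMat n 0 γ i c) = 0 := by
    intro c
    refine Matrix.eq_zero_of_forall_pow_sum_mul_pow_eq_zero
      (f := fun i : Fin n => (i : ℝ) + 1) ?_ ?_
    · intro i j hij
      simpa [Fin.ext_iff] using hij
    · intro s
      rw [← h1 s c]
      refine Finset.sum_congr rfl fun i _ => ?_
      fin_cases c <;> simp [trigMat] <;> ring
  ext i
  have hc := congrFun (h2 0) i
  have hs := congrFun (h2 1) i
  simp only [trigMat, pow_zero, one_mul, Matrix.of_apply, Matrix.cons_val_zero,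
    Matrix.cons_val_one, Pi.zero_apply] at hc hs
  have : a i ^ 2 = 0 := by
    have := Real.sin_sq_add_cos_sq (((i : ℝ) + 1) * γ)
    linear_combination (a i) * Real.cos (((i : ℝ) + 1) * γ) * hc
      + (a i) * Real.sin (((i : ℝ) + 1) * γ) * hs - a i ^ 2 * this
  simpa using this

theorem rho_mem {n : ℕ} (γ : ℝ) {L : Submodule ℝ (EuclideanSpace ℝ (Fin n))} (hL : L ≠ ⊤) :
    ¬ colSpan (trigMat n (rho γ L) γ) ≤ L :=
  Nat.sInf_mem (s := {s : ℕ | ¬ colSpan (trigMat n s γ) ≤ L}) (exists_colSpan_trigMat_not_le γ hL)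

theorem colSpan_ne_top {n : ℕ} {κ : Type*} [Fintype κ] {X : Matrix (Fin n) κ ℝ}
    (hcard : Fintype.card κ < n) : colSpan X ≠ ⊤ := by
  obtain ⟨y, hy⟩ := exists_notMem_colSpan (X := X) hcard
  intro h
  exact hy (h ▸ trivial)

theorem analyticOnNhd_det {E : Type*} [NormedAddCommGroup E] [NormedSpace ℝ E] {q : ℕ}
    {A : E → Matrix (Fin q) (Fin q) ℝ}
    (h : ∀ i j, AnalyticOnNhd ℝ (fun y => A y i j) Set.univ) :
    AnalyticOnNhd ℝ (fun y => (A y).det) Set.univ := by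
  simp only [Matrix.det_apply']
  exact Finset.analyticOnNhd_fun_sum _ fun σ _ =>
    analyticOnNhd_const.mul (Finset.analyticOnNhd_fun_prod _ fun i _ => h _ _)

theorem analyticOnNhd_trigMat (n s : ℕ) (i : Fin n) (c : Fin 2) :
    AnalyticOnNhd ℝ (fun γ => trigMat n s γ i c) Set.univ := by
  intro γ _
  fin_cases c <;> simp [trigMat] <;> fun_prop

theorem contDiff_trigMat (n s : ℕ) (i : Fin n) (c : Fin 2) :
    ContDiff ℝ 1 (fun γ => trigMat n s γ i c) := by
  fin_cases c <;> simp [trigMat] <;> fun_prop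

section Generic

variable {n kF m : ℕ} (F : Matrix (Fin n) (Fin kF) ℝ)

/-- For almost every `Xt` and each set `I` of rows: either the rows of `(F, Xt)` in `I` are
linearly independent, or they determine the coefficients of `Xt`. -/
theorem ae_rows_dichotomy (hm : m ≤ n) :
    ∀ᵐ Xt : Fin n → Fin m → ℝ, ∀ I : Set (Fin n),
      (∀ b c, (∀ i ∈ I, (F *ᵥ b + Matrix.of Xt *ᵥ c) i = 0) → c = 0) ∨
      ∀ u : Fin n → ℝ, (∀ i ∉ I, u i = 0) → u ᵥ* F = 0 → u ᵥ* Matrix.of Xt = 0 → u = 0 := by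
  classical
  rw [ae_all_iff]
  intro I
  let Z : Submodule ℝ (Fin n → ℝ) := ⨅ i ∈ I, LinearMap.ker (LinearMap.proj i)
  have hZ : ∀ x, x ∈ Z ↔ ∀ i ∈ I, x i = 0 := fun x => by simp [Z, Submodule.mem_iInf]
  -- U consists of the vectors that agree on I with an element of span F. The m generic columns are
  -- independent modulo U if dim U ≤ n - m, and span everything together with U if dim U ≥ n - m;
  -- these are the two alternatives.
  let U := LinearMap.range F.mulVecLin ⊔ Z
  rcases le_total (Module.finrank ℝ U + m) n with h | h
  · filter_upwards [ae_eq_zero_of_mulVec_mem U h] with Xt hXt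
    left
    intro b c hbc
    refine hXt c ?_
    have h1 : F *ᵥ b + Matrix.of Xt *ᵥ c ∈ U := Submodule.mem_sup_right ((hZ _).2 hbc)
    have h2 : F *ᵥ b ∈ U := Submodule.mem_sup_left ⟨b, rfl⟩
    simpa using U.sub_mem h1 h2
  · filter_upwards [ae_eq_zero_of_dotProduct_eq_zero U hm h] with Xt hXt
    right
    intro u hu huF huX
    refine hXt u (fun x hx => ?_) huX
    obtain ⟨_, ⟨b, rfl⟩, z, hz, rfl⟩ := Submodule.mem_sup.1 hx
    rw [dotProduct_add, Matrix.mulVecLin_apply, Matrix.dotProduct_mulVec, huF, zero_dotProduct,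
      zero_add]
    refine Finset.sum_eq_zero fun i _ => ?_
    by_cases hi : i ∈ I
    · rw [(hZ z).1 hz i hi, mul_zero]
    · rw [hu i hi, zero_mul]

theorem mem_colSpan_fromCols_iff {Xt : Matrix (Fin n) (Fin m) ℝ}
    (y : EuclideanSpace ℝ (Fin n)) : y ∈ colSpan (Matrix.fromCols F Xt) ↔
      ∃ b c, F *ᵥ b + Xt *ᵥ c = y.ofLp := by
  rw [mem_colSpan_iff]
  constructor
  · rintro ⟨β, hβ⟩
    exact ⟨β ∘ Sum.inl, β ∘ Sum.inr, by rw [← hβ, Matrix.fromCols_mulVec]⟩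
  · rintro ⟨b, c, h⟩
    exact ⟨Sum.elim b c, by rw [← h, Matrix.fromCols_mulVec]; rfl⟩

/-- A fixed vector outside `span F` lies outside `span (F, Xt)` for almost every `Xt`. -/
theorem ae_mem_colSpan_of_mem (h : kF + m < n) (v : EuclideanSpace ℝ (Fin n)) :
    ∀ᵐ Xt : Fin n → Fin m → ℝ, v ∈ colSpan (Matrix.fromCols F (Matrix.of Xt)) → v ∈ colSpan F := by
  have := ae_forall_eq_zero_of_sum_eq (m := m)
    (fun (_ : Fin 0 → ℝ) (a : Fin kF ⊕ Unit) i => Sum.elim (fun a => F i a) (fun _ => v i) a)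
    (fun _ _ => contDiff_const) (by simp; omega)
  filter_upwards [this] with Xt hXt hv
  obtain ⟨b, c, hbc⟩ := (mem_colSpan_fromCols_iff F v).1 hv
  have hc : c = 0 := by
    refine hXt 0 (Sum.elim (-b) 1) c fun i => ?_
    have := congrFun hbc i
    simp [Matrix.mulVec, dotProduct] at this ⊢
    rw [← this]
    simp [mul_comm]
  rw [mem_colSpan_iff]
  exact ⟨b, by simpa [hc] using hbc⟩

/-- The frequency costs one dimension. Each column of E_{n,s}(γ) is treated separately, so the count
is 1 + (kF + 1) + m ≤ n, and only s and the column index range over a countable set. -/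
theorem ae_forall_colSpan_trigMat_le (h : kF + m + 2 ≤ n) :
    ∀ᵐ Xt : Fin n → Fin m → ℝ, ∀ s γ,
      colSpan (trigMat n s γ) ≤ colSpan (Matrix.fromCols F (Matrix.of Xt)) →
      colSpan (trigMat n s γ) ≤ colSpan F := by
  have key : ∀ s (κ : Fin 2), _ := fun s κ => ae_forall_eq_zero_of_sum_eq (m := m)
    (fun (γ : ℝ) (a : Fin kF ⊕ Unit) (i : Fin n) =>
      Sum.elim (fun a => F i a) (fun _ => trigMat n s γ i κ) a)
    (by
      rintro (a | a) i
      · exact contDiff_const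
      · exact contDiff_trigMat n s i κ) (by simp; omega)
  simp only [← ae_all_iff] at key
  filter_upwards [key] with Xt hXt s γ hle
  rw [colSpan_trigMat_le_iff] at hle ⊢
  intro κ
  obtain ⟨b, c, hbc⟩ := (mem_colSpan_fromCols_iff F _).1 (hle κ)
  have hc : c = 0 := by
    refine hXt s κ γ (Sum.elim (-b) 1) c fun i => ?_
    have := congrFun hbc i
    simp [Matrix.mulVec, dotProduct] at this ⊢
    rw [← this]
    simp [mul_comm]
  rw [mem_colSpan_iff]
  exact ⟨b, by simpa [hc] using hbc⟩

/-- The frequencies at which `(F, E_{n,0}(γ))` does not have full column rank are countable,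
unless they are all frequencies. -/
theorem countable_rank_trigMat_ne {γ₀ : ℝ}
    (h : (Matrix.fromCols F (trigMat n 0 γ₀)).rank = kF + 2) :
    {γ : ℝ | (Matrix.fromCols F (trigMat n 0 γ)).rank ≠ kF + 2}.Countable := by
  let A : ℝ → Matrix (Fin n) (Fin (kF + 2)) ℝ := fun γ =>
    (Matrix.fromCols F (trigMat n 0 γ)).submatrix id finSumFinEquiv.symm
  have hA : ∀ γ, (A γ).rank = (Matrix.fromCols F (trigMat n 0 γ)).rank := fun γ =>
    Matrix.rank_submatrix _ (Equiv.refl _) _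
  have hdet : ∀ γ, ((A γ)ᵀ * A γ).det ≠ 0 ↔
      (Matrix.fromCols F (trigMat n 0 γ)).rank = kF + 2 := by
    intro γ
    rw [← hA, ← Matrix.rank_transpose_mul_self, ← isUnit_iff_ne_zero, ← Matrix.isUnit_iff_isUnit_det]
    constructor
    · intro hu
      simpa using Matrix.rank_of_isUnit _ hu
    · intro hr
      rw [← Matrix.linearIndependent_rows_iff_isUnit, linearIndependent_iff_card_eq_finrank_span,
        Set.finrank, ← Matrix.rank_eq_finrank_span_row, hr]
      simp
  have hAa : ∀ i j, AnalyticOnNhd ℝ (fun γ => A γ i j) Set.univ := by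
    intro i j
    simp only [A, Matrix.submatrix_apply, id]
    rcases finSumFinEquiv.symm j with a | a
    · exact analyticOnNhd_const
    · exact analyticOnNhd_trigMat n 0 i a
  have han : AnalyticOnNhd ℝ (fun γ => ((A γ)ᵀ * A γ).det) Set.univ := by
    refine analyticOnNhd_det fun i j => ?_
    simp only [Matrix.mul_apply, Matrix.transpose_apply]
    exact Finset.analyticOnNhd_fun_sum _ fun l _ => (hAa l i).mul (hAa l j)
  have := countable_setOf_eq_zero_of_analyticOnNhd han ((hdet γ₀).2 h)
  refine this.mono fun γ hγ => ?_
  by_contra hne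
  exact hγ ((hdet γ).1 hne)

/-- Under full rank, placing both columns of E_{n,0}(γ) in span (F, Xt) forces two independent
relations among the columns of `Xt` modulo (F, E). Two relations impose twice the codimension, which
pays for the free frequency already when kF + m < n. -/
theorem ae_forall_not_colSpan_trigMat_le (h : kF + m < n) :
    ∀ᵐ Xt : Fin n → Fin m → ℝ, ∀ γ, (Matrix.fromCols F (trigMat n 0 γ)).rank = kF + 2 →
      ¬ colSpan (trigMat n 0 γ) ≤ colSpan (Matrix.fromCols F (Matrix.of Xt)) := by
  have key := ae_forall_eq_smul_of_sum_eq (m := m)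
    (fun (γ : ℝ) (a : Fin kF ⊕ Fin 2) (i : Fin n) => Matrix.fromCols F (trigMat n 0 γ) i a)
    (by
      rintro (a | a) i
      · exact contDiff_const
      · exact contDiff_trigMat n 0 i a) (by simp; omega)
  filter_upwards [key] with Xt hXt γ hrank hle
  have hinj := (rank_eq_card_iff_forall_mulVec (Matrix.fromCols F (trigMat n 0 γ))).1
    (by simpa using hrank)
  rw [colSpan_trigMat_le_iff] at hle
  obtain ⟨b, c, hbc⟩ := (mem_colSpan_fromCols_iff F _).1 (hle 0)
  obtain ⟨b', c', hbc'⟩ := (mem_colSpan_fromCols_iff F _).1 (hle 1)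
  have hE : ∀ x : Fin 2 → ℝ, trigMat n 0 γ *ᵥ x =
      fun i => trigMat n 0 γ i 0 * x 0 + trigMat n 0 γ i 1 * x 1 := by
    intro x; ext i; simp [Matrix.mulVec, dotProduct]
  -- A vanishing combination of c and c' would turn into a linear relation between the columns of
  -- (F, E_{n,0}(γ)).
  have comb : ∀ s t : ℝ, s • c + t • c' = 0 → s = 0 ∧ t = 0 := by
    intro s t hst
    have h0 : Matrix.fromCols F (trigMat n 0 γ) *ᵥ
        (Sum.elim (s • b + t • b') (-![s, t])) = 0 := by
      rw [Matrix.fromCols_mulVec, Sum.elim_comp_inl, Sum.elim_comp_inr, Matrix.mulVec_add,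
        Matrix.mulVec_smul, Matrix.mulVec_smul, hE]
      have e1 : F *ᵥ b = (fun i => trigMat n 0 γ i 0) - Matrix.of Xt *ᵥ c :=
        eq_sub_of_add_eq hbc
      have e2 : F *ᵥ b' = (fun i => trigMat n 0 γ i 1) - Matrix.of Xt *ᵥ c' :=
        eq_sub_of_add_eq hbc'
      have e3 : s • (Matrix.of Xt *ᵥ c) + t • (Matrix.of Xt *ᵥ c') = 0 := by
        rw [← Matrix.mulVec_smul, ← Matrix.mulVec_smul, ← Matrix.mulVec_add, hst,
          Matrix.mulVec_zero]
      rw [e1, e2]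
      ext i
      have := congrFun e3 i
      simp at this ⊢
      linarith
    have h1 := hinj _ h0
    have hs := congrFun h1 (Sum.inr 0)
    have ht := congrFun h1 (Sum.inr 1)
    simp at hs ht
    exact ⟨hs, ht⟩
  have hsum : ∀ (b : Fin kF → ℝ) (c : Fin m → ℝ) (x : Fin 2 → ℝ),
      F *ᵥ b + Matrix.of Xt *ᵥ c = trigMat n 0 γ *ᵥ x → ∀ i, ∑ l, Xt i l * c l =
        ∑ a, Sum.elim (-b) x a * Matrix.fromCols F (trigMat n 0 γ) i a := by
    intro b c x hx i
    have := congrFun hx i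
    simp [Matrix.mulVec, dotProduct] at this ⊢
    simp only [mul_comm (b _), mul_comm (x _)]
    linarith
  rcases hXt γ _ _ c c' (hsum b c ![1, 0] (by rw [hbc, hE]; ext i; simp))
    (hsum b' c' ![0, 1] (by rw [hbc', hE]; ext i; simp)) with h0 | ⟨s, hs⟩
  · exact one_ne_zero (comb 1 0 (by simp [h0])).1
  · exact one_ne_zero (comb (-s) 1 (by simp [hs])).2

/-- The frequency condition on generic design matrices. -/
theorem ae_forall_not_colSpan_trigMat_rho_le (h : kF + m < n)
    (hcond : kF + m + 2 < n ∨
      ∃ γ, (Matrix.fromCols F (trigMat n 0 γ)).rank = kF + 2) :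
    ∀ᵐ Xt : Fin n → Fin m → ℝ, ∀ γ, ¬ colSpan (trigMat n (rho γ (colSpan F)) γ) ≤
      colSpan (Matrix.fromCols F (Matrix.of Xt)) := by
  have hF : colSpan F ≠ ⊤ := colSpan_ne_top (by simp; omega)
  rcases hcond with h2 | ⟨γ₀, hγ₀⟩
  · filter_upwards [ae_forall_colSpan_trigMat_le F (m := m) (by omega)] with Xt hXt γ hle
    exact rho_mem γ hF (hXt _ _ hle)
  -- Frequencies with full rank have ρ = 0 and are handled simultaneously. The exceptional ones are
  -- countable, so there each fixed column of E_{n,s}(γ) can be kept out of span X separately.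
  · have hc := countable_rank_trigMat_ne F hγ₀
    have h3 : ∀ᵐ Xt : Fin n → Fin m → ℝ,
        ∀ γ ∈ {γ : ℝ | (Matrix.fromCols F (trigMat n 0 γ)).rank ≠ kF + 2}, ∀ s (c : Fin 2),
        (WithLp.toLp 2 fun i => trigMat n s γ i c) ∈ colSpan (Matrix.fromCols F (Matrix.of Xt)) →
        (WithLp.toLp 2 fun i => trigMat n s γ i c) ∈ colSpan F := by
      rw [ae_ball_iff hc]
      intro γ _
      rw [ae_all_iff]
      intro s
      rw [ae_all_iff]
      intro c
      exact ae_mem_colSpan_of_mem F h _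
    filter_upwards [h3, ae_forall_not_colSpan_trigMat_le F h] with Xt h3 h4 γ hle
    by_cases hγ : (Matrix.fromCols F (trigMat n 0 γ)).rank = kF + 2
    · have hle' : colSpan F ≤ colSpan (Matrix.fromCols F (Matrix.of Xt)) := by
        intro y hy
        obtain ⟨b, hb⟩ := (mem_colSpan_iff _ _).1 hy
        exact (mem_colSpan_fromCols_iff F _).2 ⟨b, 0, by simpa using hb⟩
      have h0 : rho γ (colSpan F) = 0 := by
        rw [rho, Nat.sInf_eq_zero]
        exact Or.inl fun h => h4 γ hγ (h.trans hle')
      rw [h0] at hle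
      exact h4 γ hγ hle
    · refine rho_mem γ hF ?_
      rw [colSpan_trigMat_le_iff] at hle ⊢
      exact fun c => h3 γ hγ _ c (hle c)

end Generic

/-! ### Projections -/

section ProjPerp

variable {n : ℕ} (L : Submodule ℝ (EuclideanSpace ℝ (Fin n)))

theorem toEuclideanCLM_projPerp :
    Matrix.toEuclideanCLM (n := Fin n) (𝕜 := ℝ) (projPerp L) = Lᗮ.starProjection := by
  rw [projPerp]
  exact StarAlgEquiv.apply_symm_apply _ _

theorem projPerp_mulVec (x : EuclideanSpace ℝ (Fin n)) :
    projPerp L *ᵥ x.ofLp = (Lᗮ.starProjection x).ofLp := by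
  rw [← toEuclideanCLM_projPerp, Matrix.ofLp_toEuclideanCLM]

theorem projPerp_mul_self : projPerp L * projPerp L = projPerp L := by
  apply EquivLike.injective (Matrix.toEuclideanCLM (n := Fin n) (𝕜 := ℝ))
  rw [map_mul, toEuclideanCLM_projPerp]
  exact Submodule.isIdempotentElem_starProjection _

theorem transpose_projPerp : (projPerp L)ᵀ = projPerp L := by
  rw [← Matrix.conjTranspose_eq_transpose_of_trivial, ← Matrix.star_eq_conjTranspose]
  apply EquivLike.injective (Matrix.toEuclideanCLM (n := Fin n) (𝕜 := ℝ))
  rw [map_star, toEuclideanCLM_projPerp]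
  exact isSelfAdjoint_starProjection _

theorem projPerp_mulVec_eq_zero_iff (x : EuclideanSpace ℝ (Fin n)) :
    projPerp L *ᵥ x.ofLp = 0 ↔ x ∈ L := by
  rw [projPerp_mulVec]
  have : (Lᗮ.starProjection x).ofLp = 0 ↔ Lᗮ.starProjection x = 0 := by
    rw [← WithLp.ofLp_zero 2]; exact (WithLp.ofLp_injective 2).eq_iff
  rw [this, Submodule.starProjection_apply_eq_zero_iff, Submodule.orthogonal_orthogonal]

theorem projPerp_mulVec_eq_self_iff (x : EuclideanSpace ℝ (Fin n)) :
    projPerp L *ᵥ x.ofLp = x.ofLp ↔ x ∈ Lᗮ := by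
  rw [projPerp_mulVec, (WithLp.ofLp_injective 2).eq_iff, Submodule.starProjection_eq_self_iff]

theorem projPerp_mul_of_le {M : Submodule ℝ (EuclideanSpace ℝ (Fin n))} (h : L ≤ M) :
    projPerp M * projPerp L = projPerp M := by
  apply EquivLike.injective (Matrix.toEuclideanCLM (n := Fin n) (𝕜 := ℝ))
  rw [map_mul, toEuclideanCLM_projPerp, toEuclideanCLM_projPerp]
  exact Submodule.starProjection_comp_starProjection_of_le (Submodule.orthogonal_le h)

theorem projPerp_row_dotProduct_eq_zero {x : EuclideanSpace ℝ (Fin n)} (hx : x ∈ L) (i : Fin n) :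
    ∑ j, projPerp L i j * x j = 0 :=
  congrFun ((projPerp_mulVec_eq_zero_iff L x).2 hx) i

end ProjPerp

/-! ### Comparison of spectral energies -/

/-- `∑ⱼ xⱼ jˢ exp(ι j γ)`. -/
noncomputable def trigSum {n : ℕ} (x : Fin n → ℝ) (s : ℕ) (γ : ℝ) : ℂ :=
  ∑ j : Fin n, (x j : ℂ) * ((((j : ℝ) + 1 : ℝ) : ℂ) ^ s *
    Complex.exp ((((j : ℝ) + 1 : ℝ) : ℂ) * (γ : ℂ) * Complex.I))

section TrigSum

open Asymptotics Filter Topology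

variable {n : ℕ}

theorem trigSum_re (x : Fin n → ℝ) (s : ℕ) (γ : ℝ) :
    (trigSum x s γ).re = ∑ j, x j * trigMat n s γ j 0 := by
  rw [trigSum, Complex.re_sum]
  refine Finset.sum_congr rfl fun j _ => ?_
  rw [Complex.re_ofReal_mul, ← Complex.ofReal_pow, Complex.re_ofReal_mul, ← Complex.ofReal_mul,
    Complex.exp_ofReal_mul_I_re]
  rfl

theorem trigSum_im (x : Fin n → ℝ) (s : ℕ) (γ : ℝ) :
    (trigSum x s γ).im = ∑ j, x j * trigMat n s γ j 1 := by
  rw [trigSum, Complex.im_sum]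
  refine Finset.sum_congr rfl fun j _ => ?_
  rw [Complex.im_ofReal_mul, ← Complex.ofReal_pow, Complex.im_ofReal_mul, ← Complex.ofReal_mul,
    Complex.exp_ofReal_mul_I_im]
  rfl

theorem normSq_trigSum (x : Fin n → ℝ) (s : ℕ) (γ : ℝ) :
    Complex.normSq (trigSum x s γ) =
      (∑ j, x j * trigMat n s γ j 0) ^ 2 + (∑ j, x j * trigMat n s γ j 1) ^ 2 := by
  rw [Complex.normSq_apply, trigSum_re, trigSum_im]; ring

theorem normSq_trigSum_zero_neg (x : Fin n → ℝ) (γ : ℝ) :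
    Complex.normSq (trigSum x 0 (-γ)) = Complex.normSq (trigSum x 0 γ) := by
  simp [normSq_trigSum, trigMat]

theorem continuous_trigSum (x : Fin n → ℝ) (s : ℕ) : Continuous (trigSum x s) := by
  unfold trigSum; fun_prop

/-- Taylor expansion: up to the factor ι^s, `trigSum x s γ` is the s-th derivative of `trigSum x 0`
at γ. Hence the vanishing of these sums for s < r is a zero of order at least r, and the r-th sum is
the leading coefficient. -/
theorem trigSum_sub_isLittleO (x : Fin n → ℝ) (γ : ℝ) (r : ℕ)
    (h : ∀ s < r, trigSum x s γ = 0) :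
    (fun t : ℝ => trigSum x 0 (γ + t) - ((t : ℂ) * Complex.I) ^ r / r.factorial * trigSum x r γ)
      =o[𝓝 0] fun t : ℝ => t ^ r := by
  have key : (fun t : ℝ => trigSum x 0 (γ + t) -
      ((t : ℂ) * Complex.I) ^ r / r.factorial * trigSum x r γ) = fun t : ℝ =>
      ∑ j : Fin n, (x j : ℂ) * (Complex.exp ((((j : ℝ) + 1 : ℝ) : ℂ) * (γ : ℂ) * Complex.I) *
        (Complex.exp ((((j : ℝ) + 1 : ℝ) : ℂ) * (t : ℂ) * Complex.I) -
        ∑ s ∈ Finset.range (r + 1),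
          ((((j : ℝ) + 1 : ℝ) : ℂ) * (t : ℂ) * Complex.I) ^ s / s.factorial)) := by
    ext t
    have h1 : ((t : ℂ) * Complex.I) ^ r / r.factorial * trigSum x r γ =
        ∑ s ∈ Finset.range (r + 1), ((t : ℂ) * Complex.I) ^ s / s.factorial * trigSum x s γ := by
      rw [Finset.sum_range_succ, Finset.sum_eq_zero, zero_add]
      intro s hs
      rw [h s (Finset.mem_range.1 hs), mul_zero]
    rw [h1]
    simp only [trigSum, Finset.mul_sum, mul_sub, Finset.sum_sub_distrib, pow_zero, one_mul]
    congr 1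
    · refine Finset.sum_congr rfl fun j _ => ?_
      rw [← Complex.exp_add]
      congr 2
      push_cast; ring
    · rw [Finset.sum_comm]
      refine Finset.sum_congr rfl fun j _ => Finset.sum_congr rfl fun s _ => ?_
      ring
  rw [key]
  refine IsLittleO.fun_sum fun j _ => IsLittleO.const_mul_left (IsLittleO.const_mul_left ?_ _) _
  have ht : Tendsto (fun t : ℝ => (((j : ℝ) + 1 : ℝ) : ℂ) * (t : ℂ) * Complex.I) (𝓝 0) (𝓝 0) := by
    have : Continuous fun t : ℝ => (((j : ℝ) + 1 : ℝ) : ℂ) * (t : ℂ) * Complex.I := by fun_prop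
    simpa using this.tendsto 0
  refine ((Complex.exp_sub_sum_range_succ_isLittleO_pow r).comp_tendsto ht).trans_isBigO ?_
  refine IsBigO.pow (IsBigO.of_bound (|(j : ℝ) + 1|) (Eventually.of_forall fun t => ?_)) r
  simp only [norm_mul, Complex.norm_I, mul_one, Complex.norm_real, Real.norm_eq_abs]
  exact le_rfl

theorem trigSum_isBigO_pow (x : Fin n → ℝ) (γ : ℝ) (r : ℕ) (h : ∀ s < r, trigSum x s γ = 0) :
    (fun t : ℝ => trigSum x 0 (γ + t)) =O[𝓝 0] fun t : ℝ => t ^ r := by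
  have h1 := (trigSum_sub_isLittleO x γ r h).isBigO
  have h2 : (fun t : ℝ => ((t : ℂ) * Complex.I) ^ r / r.factorial * trigSum x r γ)
      =O[𝓝 0] fun t : ℝ => t ^ r := by
    refine IsBigO.of_bound (‖(r.factorial : ℂ)‖⁻¹ * ‖trigSum x r γ‖)
      (Eventually.of_forall fun t => ?_)
    simp only [norm_mul, norm_div, norm_pow, Complex.norm_I, mul_one, Complex.norm_real]
    apply le_of_eq; ring
  simpa using h1.add h2

theorem pow_isBigO_trigSum (x : Fin n → ℝ) (γ : ℝ) (r : ℕ) (h : ∀ s < r, trigSum x s γ = 0)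
    (hr : trigSum x r γ ≠ 0) :
    (fun t : ℝ => t ^ r) =O[𝓝 0] fun t : ℝ => trigSum x 0 (γ + t) := by
  have h2 : (fun t : ℝ => t ^ r) =O[𝓝 0]
      fun t : ℝ => ((t : ℂ) * Complex.I) ^ r / r.factorial * trigSum x r γ := by
    refine IsBigO.of_bound (‖(r.factorial : ℂ)‖ * ‖trigSum x r γ‖⁻¹)
      (Eventually.of_forall fun t => ?_)
    have : ‖trigSum x r γ‖ ≠ 0 := norm_ne_zero_iff.2 hr
    have h3 : ‖(r.factorial : ℂ)‖ ≠ 0 := by simp [Nat.factorial_ne_zero]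
    simp only [norm_mul, norm_div, norm_pow, Complex.norm_I, mul_one, Complex.norm_real]
    apply le_of_eq
    field_simp
  have h1 : IsEquivalent (𝓝 0) (fun t : ℝ => trigSum x 0 (γ + t))
      (fun t : ℝ => ((t : ℂ) * Complex.I) ^ r / r.factorial * trigSum x r γ) :=
    (trigSum_sub_isLittleO x γ r h).trans_isBigO h2
  exact h2.trans h1.isBigO_symm

/-- The squared distance of the columns of `E_{n,0}(γ)` from `L`. -/
noncomputable def energy (L : Submodule ℝ (EuclideanSpace ℝ (Fin n))) (γ : ℝ) : ℝ :=
  ∑ i, Complex.normSq (trigSum (projPerp L i) 0 γ)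

theorem energy_nonneg (L : Submodule ℝ (EuclideanSpace ℝ (Fin n))) (γ : ℝ) : 0 ≤ energy L γ :=
  Finset.sum_nonneg fun _ _ => Complex.normSq_nonneg _

theorem trigSum_eq_zero_of_le {L M : Submodule ℝ (EuclideanSpace ℝ (Fin n))} (hLM : L ≤ M)
    {s : ℕ} {γ : ℝ} (h : colSpan (trigMat n s γ) ≤ L) (i : Fin n) :
    trigSum (projPerp M i) s γ = 0 := by
  rw [← Complex.normSq_eq_zero, normSq_trigSum]
  rw [colSpan_trigMat_le_iff] at h
  have := fun c => projPerp_row_dotProduct_eq_zero M (hLM (h c)) i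
  simp only at this
  rw [this 0, this 1]
  simp

theorem exists_trigSum_ne_zero {M : Submodule ℝ (EuclideanSpace ℝ (Fin n))}
    {s : ℕ} {γ : ℝ} (h : ¬ colSpan (trigMat n s γ) ≤ M) :
    ∃ i, trigSum (projPerp M i) s γ ≠ 0 := by
  by_contra! h0
  apply h
  rw [colSpan_trigMat_le_iff]
  intro c
  rw [← projPerp_mulVec_eq_zero_iff]
  ext i
  have h1 := h0 i
  rw [Complex.ext_iff, trigSum_re, trigSum_im] at h1
  fin_cases c
  · exact h1.1
  · exact h1.2

/-- If `E_{n,ρ}(γ)` with `ρ = ρ(γ, L)` is not contained in `M ⊇ L`, the energy outside of `L` is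
locally bounded by the energy outside of `M`. -/
theorem energy_isBigO {L M : Submodule ℝ (EuclideanSpace ℝ (Fin n))} (hLM : L ≤ M) {γ : ℝ}
    (h : ¬ colSpan (trigMat n (rho γ L) γ) ≤ M) : energy L =O[𝓝 γ] energy M := by
  have hlt : ∀ s < rho γ L, colSpan (trigMat n s γ) ≤ L := fun s hs => by
    simpa using Nat.notMem_of_lt_sInf hs
  -- All columns of E_{n,s}(γ) with s < ρ lie in L, so every row sum has a zero of order at least ρ
  -- and the energy one of order at least 2ρ.
  have hL : (fun t => energy L (γ + t)) =O[𝓝 0] fun t : ℝ => (t ^ rho γ L) * (t ^ rho γ L) := by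
    unfold energy
    refine IsBigO.fun_sum fun i _ => ?_
    have := (trigSum_isBigO_pow (projPerp L i) γ _
      fun s hs => trigSum_eq_zero_of_le le_rfl (hlt s hs) i).norm_left
    simpa [Complex.normSq_eq_norm_sq, sq] using this.mul this
  obtain ⟨i, hi⟩ := exists_trigSum_ne_zero h
  -- Some row of the projection off M has a nonzero ρ-th derivative, so the energy off M decays no
  -- faster than t^(2ρ).
  have hM : (fun t : ℝ => (t ^ rho γ L) * (t ^ rho γ L)) =O[𝓝 0] fun t => energy M (γ + t) := by
    have := (pow_isBigO_trigSum (projPerp M i) γ _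
      (fun s hs => trigSum_eq_zero_of_le hLM (hlt s hs) i) hi).norm_right
    refine (this.mul this).trans (IsBigO.of_bound 1 (Eventually.of_forall fun t => ?_))
    rw [one_mul, Real.norm_of_nonneg (energy_nonneg _ _), Real.norm_of_nonneg (by positivity), ← sq,
      ← Complex.normSq_eq_norm_sq]
    exact Finset.single_le_sum (f := fun i => Complex.normSq (trigSum (projPerp M i) 0 (γ + t)))
      (fun _ _ => Complex.normSq_nonneg _) (Finset.mem_univ i)
  have ht : Tendsto (fun ω => ω - γ) (𝓝 γ) (𝓝 0) := by
    have : Continuous fun ω : ℝ => ω - γ := by fun_prop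
    simpa using this.tendsto γ
  simpa [Function.comp_def] using (hL.trans hM).comp_tendsto ht

/-- The local bounds at each γ are patched together by compactness of [0,π]; negative frequencies
follow because the energy is even. -/
theorem exists_energy_le {L M : Submodule ℝ (EuclideanSpace ℝ (Fin n))} (hLM : L ≤ M)
    (h : ∀ γ ∈ Set.Icc 0 Real.pi, ¬ colSpan (trigMat n (rho γ L) γ) ≤ M) :
    ∃ C : ℝ, 0 < C ∧ ∀ ω ∈ Set.Icc (-Real.pi) Real.pi, energy L ω ≤ C * energy M ω := by
  have key : ∃ C : ℝ, 0 < C ∧ ∀ ω ∈ Set.Icc 0 Real.pi, energy L ω ≤ C * energy M ω := by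
    refine isCompact_Icc.induction_on (p := fun s => ∃ C : ℝ, 0 < C ∧ ∀ ω ∈ s,
      energy L ω ≤ C * energy M ω) ⟨1, one_pos, by simp⟩ ?_ ?_ ?_
    · rintro s t hst ⟨C, hC, h⟩
      exact ⟨C, hC, fun ω hω => h ω (hst hω)⟩
    · rintro s t ⟨C, hC, h⟩ ⟨D, hD, h'⟩
      refine ⟨max C D, lt_max_of_lt_left hC, ?_⟩
      rintro ω (hω | hω)
      · exact (h ω hω).trans (mul_le_mul_of_nonneg_right (le_max_left _ _) (energy_nonneg _ _))
      · exact (h' ω hω).trans (mul_le_mul_of_nonneg_right (le_max_right _ _) (energy_nonneg _ _))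
    · intro γ hγ
      obtain ⟨C, hC, hb⟩ := (energy_isBigO hLM (h γ hγ)).exists_pos
      refine ⟨_, mem_nhdsWithin_of_mem_nhds hb.bound, C, hC, fun ω hω => ?_⟩
      have h1 : ‖energy L ω‖ ≤ C * ‖energy M ω‖ := hω
      rwa [Real.norm_of_nonneg (energy_nonneg _ _), Real.norm_of_nonneg (energy_nonneg _ _)] at h1
  obtain ⟨C, hC, hb⟩ := key
  refine ⟨C, hC, fun ω hω => ?_⟩
  rcases le_total 0 ω with h0 | h0
  · exact hb ω ⟨h0, hω.2⟩
  · have := hb (-ω) ⟨by linarith, by linarith [hω.1]⟩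
    simpa [energy, normSq_trigSum_zero_neg] using this

end TrigSum

/-! ### The covariance model -/

section CovModel

variable {n : ℕ}

theorem intervalIntegrable_of_mem_specAll {f : ℝ → ℝ} (hf : f ∈ specAll) :
    IntervalIntegrable f volume (-Real.pi) Real.pi := by
  rw [intervalIntegrable_iff_integrableOn_Icc_of_le (by linarith [Real.pi_pos])]
  exact hf.2.2.1

theorem intervalIntegrable_continuous_mul {f g : ℝ → ℝ} (hf : f ∈ specAll) (hg : Continuous g) :
    IntervalIntegrable (fun ω => g ω * f ω) volume (-Real.pi) Real.pi :=
  (intervalIntegrable_of_mem_specAll hf).continuousOn_mul hg.continuousOn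

theorem continuous_trigMat (s : ℕ) (i : Fin n) (c : Fin 2) :
    Continuous fun γ => trigMat n s γ i c := (contDiff_trigMat n s i c).continuous

theorem specCov_apply {f : ℝ → ℝ} (hf : f ∈ specAll) (j l : Fin n) :
    specCov n f j l = ∫ ω in (-Real.pi)..Real.pi,
      (trigMat n 0 ω j 0 * trigMat n 0 ω l 0 + trigMat n 0 ω j 1 * trigMat n 0 ω l 1) * f ω := by
  rw [specCov, Matrix.of_apply]
  have hint : IntervalIntegrable (fun ω : ℝ =>
      Complex.exp (-Complex.I * (((j : ℝ) - (l : ℝ) : ℝ) : ℂ) * (ω : ℂ)) * ((f ω : ℝ) : ℂ))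
      volume (-Real.pi) Real.pi := by
    refine IntervalIntegrable.continuousOn_mul ?_ (by fun_prop)
    exact ⟨(intervalIntegrable_of_mem_specAll hf).1.ofReal,
      (intervalIntegrable_of_mem_specAll hf).2.ofReal⟩
  have h1 := (Complex.reCLM.intervalIntegral_comp_comm hint).symm
  simp only [Complex.reCLM_apply] at h1
  rw [h1]
  refine intervalIntegral.integral_congr fun ω _ => ?_
  simp only [trigMat, pow_zero, one_mul, Matrix.of_apply, Matrix.cons_val_zero,
    Matrix.cons_val_one]
  rw [← Real.cos_sub, Complex.re_mul_ofReal]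
  congr 1
  have : -Complex.I * (((j : ℝ) - (l : ℝ) : ℝ) : ℂ) * (ω : ℂ) =
      ((-(((j : ℝ) - l) * ω) : ℝ) : ℂ) * Complex.I := by push_cast; ring
  rw [this, Complex.exp_ofReal_mul_I_re, Real.cos_neg]
  congr 1; ring

/-- This turns statements about covariance matrices into statements about trigonometric polynomials
weighted by f. -/
theorem dotProduct_specCov_mulVec {f : ℝ → ℝ} (hf : f ∈ specAll) (a : Fin n → ℝ) :
    a ⬝ᵥ (specCov n f *ᵥ a) =
      ∫ ω in (-Real.pi)..Real.pi, Complex.normSq (trigSum a 0 ω) * f ω := by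
  have h1 : ∀ ω, Complex.normSq (trigSum a 0 ω) * f ω = ∑ j, ∑ l, a j * a l *
      ((trigMat n 0 ω j 0 * trigMat n 0 ω l 0 + trigMat n 0 ω j 1 * trigMat n 0 ω l 1) * f ω) := by
    intro ω
    rw [normSq_trigSum, sq, sq, Finset.sum_mul_sum, Finset.sum_mul_sum, ← Finset.sum_add_distrib,
      Finset.sum_mul]
    refine Finset.sum_congr rfl fun j _ => ?_
    rw [← Finset.sum_add_distrib, Finset.sum_mul]
    exact Finset.sum_congr rfl fun l _ => by ring
  have hc : ∀ j l : Fin n, IntervalIntegrable (fun ω => a j * a l *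
      ((trigMat n 0 ω j 0 * trigMat n 0 ω l 0 + trigMat n 0 ω j 1 * trigMat n 0 ω l 1) * f ω))
      volume (-Real.pi) Real.pi := fun j l =>
    (intervalIntegrable_continuous_mul hf
      (((continuous_trigMat 0 j 0).mul (continuous_trigMat 0 l 0)).add
      ((continuous_trigMat 0 j 1).mul (continuous_trigMat 0 l 1)))).const_mul _
  simp only [h1]
  have hc' : ∀ j : Fin n, IntervalIntegrable (fun ω => ∑ l, a j * a l *
      ((trigMat n 0 ω j 0 * trigMat n 0 ω l 0 + trigMat n 0 ω j 1 * trigMat n 0 ω l 1) * f ω))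
      volume (-Real.pi) Real.pi := fun j => by
    simpa only [Finset.sum_fn] using IntervalIntegrable.sum Finset.univ fun l _ => hc j l
  rw [intervalIntegral.integral_finsetSum fun j _ => hc' j]
  simp only [dotProduct, Matrix.mulVec, Finset.mul_sum]
  refine Finset.sum_congr rfl fun j _ => ?_
  rw [intervalIntegral.integral_finsetSum fun l _ => hc j l]
  refine Finset.sum_congr rfl fun l _ => ?_
  rw [intervalIntegral.integral_const_mul, specCov_apply hf]
  ring

/-- By Vandermonde some derivative at frequency 0 is nonzero; the lowest such one bounds the sum
from below by a multiple of |t|^r near 0, so the sum cannot vanish identically. -/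
theorem exists_trigSum_zero_ne_zero {a : Fin n → ℝ} (ha : a ≠ 0) : ∃ γ, trigSum a 0 γ ≠ 0 := by
  by_contra! h
  let L : Submodule ℝ (EuclideanSpace ℝ (Fin n)) := (ℝ ∙ (WithLp.toLp 2 a))ᗮ
  have hL : L ≠ ⊤ := by
    intro hL
    have h1 : WithLp.toLp 2 a ∈ L := hL ▸ trivial
    rw [Submodule.mem_orthogonal_singleton_iff_inner_right, inner_self_eq_zero] at h1
    exact ha (congrArg WithLp.ofLp h1)
  have hex : ∃ s, trigSum a s 0 ≠ 0 := by
    obtain ⟨s, hs⟩ := exists_colSpan_trigMat_not_le 0 hL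
    refine ⟨s, fun h0 => hs ?_⟩
    rw [colSpan_trigMat_le_iff]
    intro c
    rw [Submodule.mem_orthogonal_singleton_iff_inner_right]
    rw [Complex.ext_iff, trigSum_re, trigSum_im] at h0
    simp only [PiLp.inner_apply]
    fin_cases c
    · simpa [mul_comm] using h0.1
    · simpa [mul_comm] using h0.2
  classical
  have hr := Nat.find_spec hex
  have hlt : ∀ s < Nat.find hex, trigSum a s 0 = 0 := fun s hs => by
    simpa using Nat.find_min hex hs
  have h1 := pow_isBigO_trigSum a 0 _ hlt hr
  simp only [zero_add, h] at h1
  rw [Asymptotics.isBigO_zero_right_iff] at h1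
  obtain ⟨ε, hε, hb⟩ := Metric.eventually_nhds_iff.1 h1
  have := hb (y := ε / 2) (by simp [abs_of_pos hε]; linarith)
  simp only [Pi.zero_apply] at this
  exact (pow_pos (half_pos hε) _).ne' this

theorem analyticOnNhd_normSq_trigSum (a : Fin n → ℝ) :
    AnalyticOnNhd ℝ (fun γ => Complex.normSq (trigSum a 0 γ)) Set.univ := by
  simp only [normSq_trigSum]
  have h : ∀ c : Fin 2, AnalyticOnNhd ℝ (fun γ => ∑ j, a j * trigMat n 0 γ j c) Set.univ :=
    fun c => Finset.analyticOnNhd_fun_sum _ fun j _ =>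
      analyticOnNhd_const.mul (analyticOnNhd_trigMat n 0 j c)
  exact ((h 0).pow 2).add ((h 1).pow 2)

/-- A nonzero trigonometric polynomial has countably many zeros, so a vanishing quadratic form would
make f zero almost everywhere, against its integral being one. -/
theorem posDef_specCov {f : ℝ → ℝ} (hf : f ∈ specAll) : (specCov n f).PosDef := by
  refine Matrix.PosDef.of_dotProduct_mulVec_pos ?_ fun a ha => ?_
  · ext j l
    simp only [Matrix.conjTranspose_apply, star_trivial, specCov_apply hf]
    refine intervalIntegral.integral_congr fun ω _ => ?_
    ring
  · rw [star_trivial, dotProduct_specCov_mulVec hf]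
    have hpi : -Real.pi ≤ Real.pi := by linarith [Real.pi_pos]
    have hint := intervalIntegrable_continuous_mul hf
      (Complex.continuous_normSq.comp (continuous_trigSum a 0))
    have hnn : ∀ ω ∈ Set.Ioc (-Real.pi) Real.pi, 0 ≤ Complex.normSq (trigSum a 0 ω) * f ω :=
      fun ω hω => mul_nonneg (Complex.normSq_nonneg _) (hf.2.1 ω (Set.Ioc_subset_Icc_self hω))
    rw [intervalIntegral.integral_of_le hpi]
    have hae : 0 ≤ᵐ[volume.restrict (Set.Ioc (-Real.pi) Real.pi)]
        fun ω => Complex.normSq (trigSum a 0 ω) * f ω :=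
      (ae_restrict_iff' measurableSet_Ioc).2 (Filter.Eventually.of_forall hnn)
    refine lt_of_le_of_ne (integral_nonneg_of_ae hae) fun h0 => ?_
    have h1 := (integral_eq_zero_iff_of_nonneg_ae hae
      ((intervalIntegrable_iff_integrableOn_Ioc_of_le hpi).1 hint)).1 h0.symm
    obtain ⟨γ, hγ⟩ := exists_trigSum_zero_ne_zero ha
    have h2 := (countable_setOf_eq_zero_of_analyticOnNhd (analyticOnNhd_normSq_trigSum a)
      (x₀ := γ) (by simpa using hγ)).ae_notMem (volume.restrict (Set.Ioc (-Real.pi) Real.pi))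
    have h3 : f =ᵐ[volume.restrict (Set.Ioc (-Real.pi) Real.pi)] 0 := by
      filter_upwards [h1, h2] with ω hω1 hω2
      exact (mul_eq_zero.1 hω1).resolve_left hω2
    have h4 := hf.2.2.2
    rw [intervalIntegral.integral_of_le hpi, integral_congr_ae h3] at h4
    simp at h4

theorem specAll_nonempty : specAll.Nonempty := by
  refine ⟨fun _ => (2 * Real.pi)⁻¹, fun _ _ => rfl, fun _ _ => by positivity, ?_, ?_⟩
  · exact integrableOn_const (by simp)
  · rw [intervalIntegral.integral_const, smul_eq_mul]
    have := Real.pi_pos.ne'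
    field_simp; ring

theorem trace_projPerp_mul (N : Submodule ℝ (EuclideanSpace ℝ (Fin n)))
    (S : Matrix (Fin n) (Fin n) ℝ) :
    (projPerp N * S * projPerp N).trace = ∑ i, projPerp N i ⬝ᵥ (S *ᵥ projPerp N i) := by
  rw [Matrix.trace]
  refine Finset.sum_congr rfl fun i _ => ?_
  have hs : ∀ l, projPerp N l i = projPerp N i l := fun l =>
    congrFun (congrFun (transpose_projPerp N) i) l
  rw [Matrix.diag_apply, Matrix.mul_assoc]
  simp only [Matrix.mul_apply, dotProduct, Matrix.mulVec, hs]

/-- The link between the two halves of the argument: pointwise comparison of energies becomes, after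
integration against f, comparison of traces uniformly over the model. -/
theorem trace_projPerp_specCov {f : ℝ → ℝ} (hf : f ∈ specAll)
    (N : Submodule ℝ (EuclideanSpace ℝ (Fin n))) :
    (projPerp N * specCov n f * projPerp N).trace =
      ∫ ω in (-Real.pi)..Real.pi, energy N ω * f ω := by
  rw [trace_projPerp_mul]
  simp only [dotProduct_specCov_mulVec hf, energy, Finset.sum_mul]
  rw [intervalIntegral.integral_finsetSum]
  exact fun i _ => intervalIntegrable_continuous_mul hf
    (Complex.continuous_normSq.comp (continuous_trigSum _ 0))

theorem continuous_energy (N : Submodule ℝ (EuclideanSpace ℝ (Fin n))) : Continuous (energy N) :=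
  continuous_finsetSum _ fun _ _ => Complex.continuous_normSq.comp (continuous_trigSum _ 0)

/-- Testing the quadratic form on eᵢ + eⱼ and eᵢ - eⱼ gives 2|Aᵢⱼ| ≤ Aᵢᵢ + Aⱼⱼ. -/
theorem abs_apply_le_trace {A : Matrix (Fin n) (Fin n) ℝ} (hA : A.PosSemidef) (i j : Fin n) :
    |A i j| ≤ A.trace := by
  have hd : ∀ i, 0 ≤ A i i := fun i => hA.diag_nonneg
  have hle : ∀ i, A i i ≤ A.trace := fun i =>
    Finset.single_le_sum (f := fun i => A i i) (fun i _ => hd i) (Finset.mem_univ i)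
  have hs : A j i = A i j := by simpa using hA.1.apply i j
  have h1 := hA.dotProduct_mulVec_nonneg (Pi.single i 1 + Pi.single j 1)
  have h2 := hA.dotProduct_mulVec_nonneg (Pi.single i 1 - Pi.single j 1)
  simp only [star_trivial, Matrix.mulVec_add, Matrix.mulVec_sub, add_dotProduct, sub_dotProduct,
    dotProduct_add, dotProduct_sub, single_one_dotProduct, Matrix.mulVec_single_one,
    Matrix.col_apply] at h1 h2
  rw [abs_le]
  constructor <;> linarith [hle i, hle j]

theorem frobNorm_le_trace {A : Matrix (Fin n) (Fin n) ℝ} (hA : A.PosSemidef) :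
    frobNorm A ≤ n * A.trace := by
  have h0 : 0 ≤ A.trace := hA.trace_nonneg
  rw [frobNorm, Real.sqrt_le_iff]
  refine ⟨by positivity, ?_⟩
  calc ∑ i, ∑ j, A i j ^ 2 ≤ ∑ _i : Fin n, ∑ _j : Fin n, A.trace ^ 2 :=
        Finset.sum_le_sum fun i _ => Finset.sum_le_sum fun j _ =>
          sq_le_sq.2 ((abs_apply_le_trace hA i j).trans (le_abs_self _))
    _ = (n * A.trace) ^ 2 := by simp; ring

theorem continuous_frobNorm : Continuous (frobNorm (n := n)) := by
  unfold frobNorm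
  refine Real.continuous_sqrt.comp (continuous_finsetSum _ fun i _ => continuous_finsetSum _
    fun j _ => ?_)
  exact (continuous_id.matrix_elem i j).pow 2

theorem abs_apply_le_frobNorm (A : Matrix (Fin n) (Fin n) ℝ) (i j : Fin n) :
    |A i j| ≤ frobNorm A := by
  rw [frobNorm, ← Real.sqrt_sq_eq_abs]
  refine Real.sqrt_le_sqrt ?_
  exact (Finset.single_le_sum (f := fun j => A i j ^ 2) (fun _ _ => sq_nonneg _)
    (Finset.mem_univ j)).trans (Finset.single_le_sum (f := fun i => ∑ j, A i j ^ 2)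
      (fun _ _ => Finset.sum_nonneg fun _ _ => sq_nonneg _) (Finset.mem_univ i))

theorem frobNorm_smul (c : ℝ) (A : Matrix (Fin n) (Fin n) ℝ) :
    frobNorm (c • A) = |c| * frobNorm A := by
  simp only [frobNorm, Matrix.smul_apply, smul_eq_mul, mul_pow, ← Finset.mul_sum]
  rw [Real.sqrt_mul (sq_nonneg c), Real.sqrt_sq_eq_abs]

theorem posSemidef_projPerp_mul {S : Matrix (Fin n) (Fin n) ℝ} (hS : S.PosSemidef)
    (N : Submodule ℝ (EuclideanSpace ℝ (Fin n))) : (projPerp N * S * projPerp N).PosSemidef := by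
  have := hS.mul_mul_conjTranspose_same (projPerp N)
  rwa [Matrix.conjTranspose_eq_transpose_of_trivial, transpose_projPerp] at this

theorem trace_projPerp_mul_pos {S : Matrix (Fin n) (Fin n) ℝ} (hS : S.PosDef)
    {N : Submodule ℝ (EuclideanSpace ℝ (Fin n))} (hN : N ≠ ⊤) :
    0 < (projPerp N * S * projPerp N).trace := by
  rw [trace_projPerp_mul]
  have hb : Nᗮ ≠ ⊥ := fun hb => hN (Submodule.orthogonal_eq_bot_iff.1 hb)
  obtain ⟨v, hv, hv0⟩ := Submodule.exists_mem_ne_zero_of_ne_bot hb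
  have hne : ∃ i, projPerp N i ≠ 0 := by
    by_contra! h0
    apply hv0
    have h1 := (projPerp_mulVec_eq_self_iff N v).2 hv
    ext i
    rw [← h1, Matrix.mulVec, h0 i, zero_dotProduct]
    rfl
  obtain ⟨i, hi⟩ := hne
  refine Finset.sum_pos' (fun j _ => by simpa using hS.posSemidef.dotProduct_mulVec_nonneg _)
    ⟨i, Finset.mem_univ i, by simpa using hS.dotProduct_mulVec_pos hi⟩

theorem frobNorm_pos_of_trace_pos {A : Matrix (Fin n) (Fin n) ℝ} (h : 0 < A.trace) :
    0 < frobNorm A := by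
  refine lt_of_le_of_ne (Real.sqrt_nonneg _) fun h0 => ?_
  have hz : A = 0 := by
    ext i j
    simpa [← h0] using abs_apply_le_frobNorm A i j
  simp [hz] at h

/-- Matrices in the closure of the normalized projected covariance model do not concentrate on
the larger space `M`. -/
theorem exists_forall_mem_closure_normProj {L M : Submodule ℝ (EuclideanSpace ℝ (Fin n))}
    (hLM : L ≤ M) (hL : L ≠ ⊤)
    (h : ∀ γ ∈ Set.Icc 0 Real.pi, ¬ colSpan (trigMat n (rho γ L) γ) ≤ M) :
    ∃ c : ℝ, 0 < c ∧ ∀ A ∈ closure (normProj L '' covModel n),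
      A.PosSemidef ∧ frobNorm A = 1 ∧ projPerp L * A = A ∧
        c ≤ (projPerp M * A * projPerp M).trace := by
  obtain ⟨C, hC, hb⟩ := exists_energy_le hLM h
  have hn : 0 < n := by
    rcases Nat.eq_zero_or_pos n with rfl | hn
    · exact absurd (Subsingleton.elim L ⊤) hL
    · exact hn
  have hn' : (0 : ℝ) < n := by exact_mod_cast hn
  -- The factor C is the energy ratio and n comes from bounding the Frobenius norm by n times the
  -- trace. All four properties are closed conditions, so they need checking only on the model
  -- itself.
  refine ⟨(C * n)⁻¹, by positivity, fun A hA => ?_⟩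
  let K : Set (Matrix (Fin n) (Fin n) ℝ) := {A | A.PosSemidef ∧ frobNorm A = 1 ∧
    projPerp L * A = A ∧ (C * n)⁻¹ ≤ (projPerp M * A * projPerp M).trace}
  have hK : IsClosed K := by
    have h1 : IsClosed {A : Matrix (Fin n) (Fin n) ℝ | A.PosSemidef} := by
      have : {A : Matrix (Fin n) (Fin n) ℝ | A.PosSemidef} = {A | Aᵀ = A} ∩
          ⋂ x : Fin n → ℝ, {A | 0 ≤ x ⬝ᵥ (A *ᵥ x)} := by
        ext A
        simp [Matrix.posSemidef_iff_dotProduct_mulVec, Matrix.IsHermitian]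
      rw [this]
      refine (isClosed_eq continuous_id.matrix_transpose continuous_id).inter
        (isClosed_iInter fun x => isClosed_le continuous_const ?_)
      exact continuous_const.dotProduct (continuous_id.matrix_mulVec continuous_const)
    have h2 : Continuous fun A : Matrix (Fin n) (Fin n) ℝ =>
        (projPerp M * A * projPerp M).trace :=
      ((continuous_const.matrix_mul continuous_id).matrix_mul continuous_const).matrix_trace
    exact h1.inter ((isClosed_eq continuous_frobNorm continuous_const).inter
      ((isClosed_eq (continuous_const.matrix_mul continuous_id) continuous_id).inter
      (isClosed_le continuous_const h2)))
  refine closure_minimal ?_ hK hA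
  rintro _ ⟨_, ⟨f, hf, rfl⟩, rfl⟩
  have hS := posDef_specCov (n := n) hf
  have hps := posSemidef_projPerp_mul hS.posSemidef L
  have htr := trace_projPerp_mul_pos hS hL
  have hfr := frobNorm_pos_of_trace_pos htr
  refine ⟨hps.smul (inv_nonneg.2 hfr.le), ?_, ?_, ?_⟩
  · rw [normProj, frobNorm_smul, abs_of_pos (inv_pos.2 hfr), inv_mul_cancel₀ hfr.ne']
  · rw [normProj, Matrix.mul_smul, ← Matrix.mul_assoc, ← Matrix.mul_assoc, projPerp_mul_self]
  · have e1 : projPerp L * projPerp M = projPerp M := by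
      have := congrArg Matrix.transpose (projPerp_mul_of_le L hLM)
      rwa [Matrix.transpose_mul, transpose_projPerp, transpose_projPerp] at this
    have e2 : projPerp M * normProj L (specCov n f) * projPerp M =
        (frobNorm (projPerp L * specCov n f * projPerp L))⁻¹ •
          (projPerp M * specCov n f * projPerp M) := by
      rw [normProj, Matrix.mul_smul, Matrix.smul_mul]
      congr 1
      calc _ = (projPerp M * projPerp L) * specCov n f * (projPerp L * projPerp M) := by
            simp only [Matrix.mul_assoc]
        _ = _ := by rw [projPerp_mul_of_le L hLM, e1]
    -- The energy inequality integrated against the nonnegative f.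
    have e3 : (projPerp L * specCov n f * projPerp L).trace ≤
        C * (projPerp M * specCov n f * projPerp M).trace := by
      rw [trace_projPerp_specCov hf, trace_projPerp_specCov hf,
        ← intervalIntegral.integral_const_mul]
      refine intervalIntegral.integral_mono_on (by linarith [Real.pi_pos])
        (intervalIntegrable_continuous_mul hf (continuous_energy L))
        ((intervalIntegrable_continuous_mul hf (continuous_energy M)).const_mul C) fun ω hω => ?_
      rw [← mul_assoc]
      exact mul_le_mul_of_nonneg_right (hb ω hω) (hf.2.1 ω hω)
    have e4 := frobNorm_le_trace hps
    rw [e2, Matrix.trace_smul, smul_eq_mul, inv_mul_eq_div, le_div_iff₀ hfr, inv_mul_le_iff₀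
      (by positivity)]
    calc _ ≤ _ := e4
      _ ≤ n * (C * (projPerp M * specCov n f * projPerp M).trace) := by gcongr
      _ = _ := by ring

theorem isCompact_closure_normProj {L : Submodule ℝ (EuclideanSpace ℝ (Fin n))}
    (h : ∀ A ∈ closure (normProj L '' covModel n), frobNorm A = 1) :
    IsCompact (closure (normProj L '' covModel n)) := by
  have hc : IsCompact (Set.univ.pi fun _ : Fin n => Set.univ.pi fun _ : Fin n =>
      Set.Icc (-1 : ℝ) 1) := isCompact_univ_pi fun _ => isCompact_univ_pi fun _ => isCompact_Icc
  refine hc.of_isClosed_subset isClosed_closure fun A hA i _ j _ => ?_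
  exact abs_le.1 ((abs_apply_le_frobNorm A i j).trans (h A hA).le)

/-- For positive definite S the kernel of ΠSΠ is that of Π, namely L. So members of the model are
never rank deficient in the sense of `concSpaces`; only genuine limit points can be. -/
theorem le_rank_normProj {L : Submodule ℝ (EuclideanSpace ℝ (Fin n))}
    {S : Matrix (Fin n) (Fin n) ℝ} (hS : S.PosDef) (hL : L ≠ ⊤) :
    n ≤ (normProj L S).rank + Module.finrank ℝ L := by
  have hfr := frobNorm_pos_of_trace_pos (trace_projPerp_mul_pos hS hL)
  have hker : LinearMap.ker (normProj L S).mulVecLin ≤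
      L.map (WithLp.linearEquiv 2 ℝ (Fin n → ℝ)).toLinearMap := by
    intro x hx
    refine ⟨WithLp.toLp 2 x, ?_, rfl⟩
    have h1 : normProj L S *ᵥ x = 0 := hx
    rw [normProj, Matrix.smul_mulVec] at h1
    have h2 := (smul_eq_zero.1 h1).resolve_left (inv_ne_zero hfr.ne')
    rw [SetLike.mem_coe, ← projPerp_mulVec_eq_zero_iff]
    by_contra hne
    have h3 := hS.dotProduct_mulVec_pos hne
    have h4 : (projPerp L *ᵥ x) ⬝ᵥ (S *ᵥ (projPerp L *ᵥ x)) =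
        x ⬝ᵥ ((projPerp L * S * projPerp L) *ᵥ x) := by
      rw [← Matrix.mulVec_mulVec, ← Matrix.mulVec_mulVec, Matrix.dotProduct_mulVec x,
        ← Matrix.mulVec_transpose, transpose_projPerp]
    rw [star_trivial] at h3
    rw [h2, dotProduct_zero] at h4
    exact h3.ne' h4
  have h5 := (Submodule.finrank_mono hker).trans (Submodule.finrank_map_le _ _)
  have h6 := LinearMap.finrank_range_add_finrank_ker (normProj L S).mulVecLin
  rw [Module.finrank_fin_fun] at h6
  rw [Matrix.rank]
  lia

end CovModel

/-! ### Gaussian measures -/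

section Gaussian

open Filter Topology
open scoped RealInnerProductSpace MatrixOrder

variable {n : ℕ}

theorem measurable_affine (μ' : EuclideanSpace ℝ (Fin n))
    (B : EuclideanSpace ℝ (Fin n) →L[ℝ] EuclideanSpace ℝ (Fin n)) (μ : EuclideanSpace ℝ (Fin n)) :
    Measurable fun y => μ' + B (y - μ) := by fun_prop

/-- Both sides are compared through their characteristic functions. No invertibility of B is needed,
so projections are allowed. -/
theorem map_multivariateGaussian (μ μ' : EuclideanSpace ℝ (Fin n))
    {S : Matrix (Fin n) (Fin n) ℝ} (hS : S.PosSemidef) (B : Matrix (Fin n) (Fin n) ℝ) :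
    (multivariateGaussian μ S).map
      (fun y => μ' + Matrix.toEuclideanCLM (n := Fin n) (𝕜 := ℝ) B (y - μ)) =
      multivariateGaussian μ' (B * S * Bᵀ) := by
  have hB : (B * S * Bᵀ).PosSemidef := by simpa using hS.mul_mul_conjTranspose_same B
  have : IsProbabilityMeasure ((multivariateGaussian μ S).map
      (fun y => μ' + Matrix.toEuclideanCLM (n := Fin n) (𝕜 := ℝ) B (y - μ))) :=
    Measure.isProbabilityMeasure_map (measurable_affine _ _ _).aemeasurable
  apply Measure.ext_of_charFun
  ext t
  rw [charFun_multivariateGaussian hB, charFun_apply,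
    integral_map (measurable_affine _ _ _).aemeasurable
      (Measurable.aestronglyMeasurable (by fun_prop))]
  have key : ∀ y : EuclideanSpace ℝ (Fin n),
      ⟪μ' + Matrix.toEuclideanCLM (n := Fin n) (𝕜 := ℝ) B (y - μ), t⟫ =
      (⟪t, μ'⟫ - ⟪WithLp.toLp 2 (Bᵀ *ᵥ t.ofLp), μ⟫) + ⟪y, WithLp.toLp 2 (Bᵀ *ᵥ t.ofLp)⟫ := by
    intro y
    have e : ∀ z : Fin n → ℝ, t.ofLp ⬝ᵥ (B *ᵥ z) = (Bᵀ *ᵥ t.ofLp) ⬝ᵥ z := fun z => by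
      rw [Matrix.dotProduct_mulVec, Matrix.mulVec_transpose]
    rw [inner_add_left, real_inner_comm t (Matrix.toEuclideanCLM (n := Fin n) (𝕜 := ℝ) B (y - μ)),
      Matrix.inner_toEuclideanCLM]
    simp only [EuclideanSpace.inner_eq_star_dotProduct, star_trivial, WithLp.ofLp_sub,
      Matrix.mulVec_sub, dotProduct_sub, e]
    rw [dotProduct_comm μ.ofLp, dotProduct_comm μ'.ofLp]
    ring
  simp only [key, Complex.ofReal_add, add_mul, Complex.exp_add]
  rw [integral_const_mul, ← charFun_apply, charFun_multivariateGaussian hS, ← Complex.exp_add]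
  congr 1
  have h2 : (Bᵀ *ᵥ t.ofLp) ⬝ᵥ (S *ᵥ (Bᵀ *ᵥ t.ofLp)) = t.ofLp ⬝ᵥ ((B * S * Bᵀ) *ᵥ t.ofLp) := by
    rw [← Matrix.mulVec_mulVec, ← Matrix.mulVec_mulVec, Matrix.dotProduct_mulVec t.ofLp,
      Matrix.mulVec_transpose]
  rw [h2]
  push_cast
  ring

/-- The Gaussian measure as a probability measure. -/
noncomputable def gaussianLaw (μ : EuclideanSpace ℝ (Fin n)) (A : Matrix (Fin n) (Fin n) ℝ) :
    ProbabilityMeasure (EuclideanSpace ℝ (Fin n)) :=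
  ⟨multivariateGaussian μ A, inferInstance⟩

/-- Gaussian measures depend continuously on the covariance matrix. -/
theorem tendsto_multivariateGaussian (μ : EuclideanSpace ℝ (Fin n))
    {A : ℕ → Matrix (Fin n) (Fin n) ℝ} {A₀ : Matrix (Fin n) (Fin n) ℝ}
    (hA : ∀ m, (A m).PosSemidef) (hA₀ : A₀.PosSemidef) (h : Tendsto A atTop (𝓝 A₀)) :
    Tendsto (fun m => gaussianLaw μ (A m)) atTop (𝓝 (gaussianLaw μ A₀)) := by
  apply ProbabilityMeasure.tendsto_of_tendsto_charFun
  intro t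
  simp only [gaussianLaw, ProbabilityMeasure.coe_mk, charFun_multivariateGaussian hA₀,
    fun m => charFun_multivariateGaussian (μ := μ) (hA m)]
  have hc : Continuous fun A : Matrix (Fin n) (Fin n) ℝ => t.ofLp ⬝ᵥ (A *ᵥ t.ofLp) :=
    continuous_const.dotProduct (continuous_id.matrix_mulVec continuous_const)
  have hc' : Continuous fun A : Matrix (Fin n) (Fin n) ℝ =>
      Complex.exp (⟪t, μ⟫ * Complex.I - (t.ofLp ⬝ᵥ (A *ᵥ t.ofLp) : ℝ) / 2) := by
    fun_prop
  exact (hc'.tendsto A₀).comp h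

/-- An analytic function that does not vanish on the support of a Gaussian measure is almost
surely nonzero. -/
theorem forall_or_ae_multivariateGaussian_ne_zero (μ : EuclideanSpace ℝ (Fin n))
    {A : Matrix (Fin n) (Fin n) ℝ} (hA : A.PosSemidef) {f : EuclideanSpace ℝ (Fin n) → ℝ}
    (hf : AnalyticOnNhd ℝ f Set.univ) :
    (∀ x ∈ colSpan A, f (μ + x) = 0) ∨ ∀ᵐ y ∂multivariateGaussian μ A, f y ≠ 0 := by
  obtain ⟨B, hB, hBB⟩ : ∃ B : EuclideanSpace ℝ (Fin n) →L[ℝ] EuclideanSpace ℝ (Fin n),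
      multivariateGaussian μ A = (stdGaussian (EuclideanSpace ℝ (Fin n))).map (fun x => μ + B x) ∧
      B * B = Matrix.toEuclideanCLM (n := Fin n) (𝕜 := ℝ) A :=
    ⟨_, rfl, by rw [← map_mul, CFC.sqrt_mul_sqrt_self _ hA.nonneg]⟩
  by_cases h : ∀ z, f (μ + B z) = 0
  · left
    intro x hx
    obtain ⟨β, hβ⟩ := (mem_colSpan_iff _ _).1 hx
    -- B is the square root of A, so the column span of A is contained in the range of B.
    have : x = B (B (WithLp.toLp 2 β)) := by
      rw [← mul_apply_eq_comp, hBB, Matrix.toEuclideanCLM_toLp, hβ]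
    rw [this]
    exact h _
  · right
    push Not at h
    obtain ⟨z, hz⟩ := h
    have hc : Continuous f := continuousOn_univ.1 hf.continuousOn
    have hm : MeasurableSet {x | f x ≠ 0} := (isOpen_ne.preimage hc).measurableSet
    rw [hB, ae_map_iff (Measurable.aemeasurable (by fun_prop)) hm]
    exact ae_stdGaussian_ne_zero_of_analyticOnNhd
      (hf.comp (analyticOnNhd_const.add (B.analyticOnNhd _)) (Set.mapsTo_univ _ _)) hz

theorem analyticOnNhd_mulVec {κ : Type*} (B : Matrix κ (Fin n) ℝ) (i : κ) :
    AnalyticOnNhd ℝ (fun y : EuclideanSpace ℝ (Fin n) => (B *ᵥ y.ofLp) i) Set.univ := by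
  simp only [Matrix.mulVec, dotProduct]
  exact Finset.analyticOnNhd_fun_sum _ fun j _ => analyticOnNhd_const.mul
    ((EuclideanSpace.proj (𝕜 := ℝ) j).analyticOnNhd _)

theorem ae_multivariateGaussian_notMem {M : Submodule ℝ (EuclideanSpace ℝ (Fin n))}
    {μ : EuclideanSpace ℝ (Fin n)} (hμ : μ ∈ M) {A : Matrix (Fin n) (Fin n) ℝ}
    (hA : A.PosSemidef) (h : ¬ colSpan A ≤ M) : ∀ᵐ y ∂multivariateGaussian μ A, y ∉ M := by
  obtain ⟨x, hx, hxM⟩ := SetLike.not_le_iff_exists.1 h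
  -- The squared distance from M: an analytic function whose zero set is M.
  let f : EuclideanSpace ℝ (Fin n) → ℝ := fun y => ∑ i, (projPerp M *ᵥ y.ofLp) i ^ 2
  have hf : AnalyticOnNhd ℝ f Set.univ :=
    Finset.analyticOnNhd_fun_sum _ fun i _ => (analyticOnNhd_mulVec _ i).pow 2
  have hf0 : ∀ y, f y = 0 ↔ y ∈ M := by
    intro y
    rw [← projPerp_mulVec_eq_zero_iff, Finset.sum_eq_zero_iff_of_nonneg fun _ _ => sq_nonneg _]
    simp [funext_iff]
  rcases forall_or_ae_multivariateGaussian_ne_zero μ hA hf with h1 | h1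
  · exact absurd ((Submodule.add_mem_iff_right _ hμ).1 ((hf0 _).1 (h1 x hx))) hxM
  · filter_upwards [h1] with y hy hyM
    exact hy ((hf0 y).2 hyM)

theorem not_colSpan_le_of_trace_pos {M : Submodule ℝ (EuclideanSpace ℝ (Fin n))}
    {A : Matrix (Fin n) (Fin n) ℝ} (h : 0 < (projPerp M * A * projPerp M).trace) :
    ¬ colSpan A ≤ M := by
  intro hle
  have : projPerp M * A = 0 := by
    ext i j
    have h1 := hle (toLp_mulVec_mem_colSpan A (Pi.single j 1))
    have h2 := congrFun ((projPerp_mulVec_eq_zero_iff M _).2 h1) i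
    simpa [Matrix.mul_apply, Matrix.mulVec, dotProduct, Pi.single_apply] using h2
  rw [this] at h
  simp at h

theorem ae_affineLebesgue_notMem {M S : Submodule ℝ (EuclideanSpace ℝ (Fin n))}
    {μ : EuclideanSpace ℝ (Fin n)} (hμ : μ ∈ M) (h : ¬ S ≤ M) :
    ∀ᵐ y ∂affineLebesgue μ S, y ∈ (fun s => μ + s) '' (S : Set (EuclideanSpace ℝ (Fin n))) \ M := by
  have hme : Measurable fun s : S => μ + (s : EuclideanSpace ℝ (Fin n)) := by fun_prop
  have hms : MeasurableSet ((fun s => μ + s) '' (S : Set (EuclideanSpace ℝ (Fin n))) \ M) := by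
    refine MeasurableSet.diff ?_ M.closed_of_finiteDimensional.measurableSet
    exact ((Homeomorph.addLeft μ).isClosedMap _ S.closed_of_finiteDimensional).measurableSet
  refine (ae_map_iff hme.aemeasurable hms).2 ?_
  have hne : M.comap S.subtype ≠ ⊤ := by
    intro ht
    apply h
    intro x hx
    have : (⟨x, hx⟩ : S) ∈ M.comap S.subtype := ht ▸ trivial
    exact this
  have h0 := Measure.addHaar_submodule (volume : Measure S) _ hne
  have h1 : ∀ᵐ s : S, s ∉ M.comap S.subtype := by
    rw [ae_iff]
    simpa using! h0
  filter_upwards [h1] with s hs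
  exact ⟨⟨s, s.2, rfl⟩, fun hm => hs ((Submodule.add_mem_iff_right _ hμ).1 hm)⟩

end Gaussian

/-! ### Size control for invariant test statistics -/

/-- Test statistics invariant under the affine group of the null hypothesis `M₀`, with direction
space `L`, that are continuous, semi-algebraic in a weak sense and not constant off a linear space
`M` on which they vanish. -/
structure RegularStat {n : ℕ} (M₀ : Set (EuclideanSpace ℝ (Fin n)))
    (L M : Submodule ℝ (EuclideanSpace ℝ (Fin n))) (T : EuclideanSpace ℝ (Fin n) → ℝ) : Prop where
  le : L ≤ M
  ne_top : L ≠ ⊤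
  nonempty : M₀.Nonempty
  subset : M₀ ⊆ M
  invariant : ∀ μ ∈ M₀, ∀ μ' ∈ M₀, ∀ δ : ℝ, 0 < δ → ∀ y,
    T (μ' + δ • Lᗮ.starProjection (y - μ)) = T y
  nonneg : ∀ y, 0 ≤ T y
  eq_zero : ∀ y ∈ M, T y = 0
  continuousOn : ContinuousOn T (M : Set (EuclideanSpace ℝ (Fin n)))ᶜ
  analytic : ∀ c : ℝ, ∃ p : EuclideanSpace ℝ (Fin n) → ℝ, AnalyticOnNhd ℝ p Set.univ ∧ ∀ y ∉ M, p y = 0 ↔ T y = c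
  exists_ne : ∀ c : ℝ, ∃ y ∉ M, T y ≠ c

theorem colSpan_eq_map {n : ℕ} {κ : Type*} [Fintype κ] (A : Matrix (Fin n) κ ℝ) :
    colSpan A = (LinearMap.range A.mulVecLin).map
      (WithLp.linearEquiv 2 ℝ (Fin n → ℝ)).symm.toLinearMap := by
  ext y
  rw [mem_colSpan_iff]
  constructor
  · rintro ⟨β, hβ⟩
    exact ⟨A *ᵥ β, ⟨β, rfl⟩, by rw [hβ]; rfl⟩
  · rintro ⟨_, ⟨β, rfl⟩, rfl⟩
    exact ⟨β, rfl⟩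

theorem finrank_colSpan {n : ℕ} {κ : Type*} [Fintype κ] (A : Matrix (Fin n) κ ℝ) :
    Module.finrank ℝ (colSpan A) = A.rank := by
  rw [colSpan_eq_map, LinearEquiv.finrank_map_eq, Matrix.rank]

namespace RegularStat

open Filter Topology

variable {n : ℕ} {M₀ : Set (EuclideanSpace ℝ (Fin n))}
  {L M : Submodule ℝ (EuclideanSpace ℝ (Fin n))} {T : EuclideanSpace ℝ (Fin n) → ℝ}
  (hT : RegularStat M₀ L M T)

include hT

theorem isClosed_union (c : ℝ) :
    IsClosed ({y | c ≤ T y} ∪ (M : Set (EuclideanSpace ℝ (Fin n)))) := by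
  rw [← isOpen_compl_iff]
  have h := hT.continuousOn.isOpen_inter_preimage
    M.closed_of_finiteDimensional.isOpen_compl (isOpen_Iio (a := c))
  convert h using 1
  ext y
  simp [and_comm]

theorem isOpen_diff (c : ℝ) : IsOpen ({y | c < T y} \ (M : Set (EuclideanSpace ℝ (Fin n)))) := by
  have h := hT.continuousOn.isOpen_inter_preimage
    M.closed_of_finiteDimensional.isOpen_compl (isOpen_Ioi (a := c))
  convert h using 1
  ext y
  simp [and_comm]

theorem measurableSet_le (c : ℝ) : MeasurableSet {y | c ≤ T y} := by
  rcases le_or_gt c 0 with hc | hc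
  · have : {y | c ≤ T y} = Set.univ := Set.eq_univ_of_forall fun y => hc.trans (hT.nonneg y)
    rw [this]; exact MeasurableSet.univ
  · have : {y | c ≤ T y} = ({y | c ≤ T y} ∪ (M : Set (EuclideanSpace ℝ (Fin n)))) \ M := by
      ext y
      simp only [Set.mem_ofPred_eq, Set.mem_sdiff, Set.mem_union, SetLike.mem_coe]
      constructor
      · intro h
        refine ⟨Or.inl h, fun hM => ?_⟩
        rw [hT.eq_zero y hM] at h
        linarith
      · rintro ⟨h | h, hM⟩
        · exact h
        · exact absurd h hM
    rw [this]
    exact (hT.isClosed_union c).measurableSet.diff M.closed_of_finiteDimensional.measurableSet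

/-- By invariance, rejection probabilities depend on the normalized projected covariance only. -/
theorem multivariateGaussian_eq {μ μ₀ : EuclideanSpace ℝ (Fin n)} (hμ : μ ∈ M₀) (hμ₀ : μ₀ ∈ M₀)
    {v : ℝ} (hv : 0 < v) {S : Matrix (Fin n) (Fin n) ℝ} (hS : S.PosDef) (c : ℝ) :
    multivariateGaussian μ (v • S) {y | c ≤ T y} =
      multivariateGaussian μ₀ (normProj L S) {y | c ≤ T y} := by
  have hfr := frobNorm_pos_of_trace_pos (trace_projPerp_mul_pos hS hT.ne_top)
  set fr := frobNorm (projPerp L * S * projPerp L) with hfrdef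
  -- Rescaling by δ² = 1/(v‖ΠSΠ‖) removes the variance v and produces the normalized matrix.
  set δ := Real.sqrt ((v * fr)⁻¹) with hδ
  have hδ0 : 0 < δ := Real.sqrt_pos.2 (by positivity)
  have hδ2 : δ * δ = (v * fr)⁻¹ := Real.mul_self_sqrt (by positivity)
  have hcov : (δ • projPerp L) * (v • S) * (δ • projPerp L)ᵀ = normProj L S := by
    rw [Matrix.transpose_smul, transpose_projPerp, normProj, ← hfrdef]
    simp only [Matrix.smul_mul, Matrix.mul_smul, smul_smul]
    congr 1
    rw [mul_left_comm, hδ2]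
    field_simp
  rw [← hcov, ← map_multivariateGaussian μ μ₀ (hS.posSemidef.smul hv.le),
    Measure.map_apply (measurable_affine _ _ _) (hT.measurableSet_le c)]
  congr 1
  ext y
  simp only [Set.mem_ofPred_eq, Set.mem_preimage, map_smul, toEuclideanCLM_projPerp,
    _root_.smul_apply, hT.invariant μ hμ μ₀ hμ₀ δ hδ0]

theorem testSize_eq {μ₀ : EuclideanSpace ℝ (Fin n)} (hμ₀ : μ₀ ∈ M₀) (c : ℝ) :
    testSize M₀ (covModel n) T c =
      ⨆ A ∈ normProj L '' covModel n, multivariateGaussian μ₀ A {y | c ≤ T y} := by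
  rw [iSup_image, testSize]
  refine le_antisymm ?_ ?_
  · refine iSup₂_le fun μ hμ => iSup₂_le fun v hv => iSup₂_le ?_
    rintro S ⟨f, hf, rfl⟩
    rw [hT.multivariateGaussian_eq hμ hμ₀ hv (posDef_specCov hf)]
    exact le_iSup₂ (f := fun S (_ : S ∈ covModel n) =>
      multivariateGaussian μ₀ (normProj L S) {y | c ≤ T y}) _ ⟨f, hf, rfl⟩
  · refine iSup₂_le ?_
    rintro S ⟨f, hf, rfl⟩
    rw [← hT.multivariateGaussian_eq hμ₀ hμ₀ one_pos (posDef_specCov hf)]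
    refine le_iSup₂_of_le μ₀ hμ₀ (le_iSup₂_of_le 1 (Set.mem_Ioi.2 one_pos) ?_)
    exact le_iSup₂ (f := fun S (_ : S ∈ covModel n) =>
      multivariateGaussian μ₀ ((1 : ℝ) • S) {y | c ≤ T y}) _ ⟨f, hf, rfl⟩

theorem testSize_antitone {c c' : ℝ} (h : c ≤ c') :
    testSize M₀ (covModel n) T c' ≤ testSize M₀ (covModel n) T c := by
  obtain ⟨μ₀, hμ₀⟩ := hT.nonempty
  rw [hT.testSize_eq hμ₀, hT.testSize_eq hμ₀]
  exact iSup₂_mono fun A _ => measure_mono fun y (hy : c' ≤ T y) => h.trans hy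

theorem testSize_of_nonpos {c : ℝ} (hc : c ≤ 0) : testSize M₀ (covModel n) T c = 1 := by
  obtain ⟨μ₀, hμ₀⟩ := hT.nonempty
  rw [hT.testSize_eq hμ₀]
  have : {y | c ≤ T y} = Set.univ := Set.eq_univ_of_forall fun y => hc.trans (hT.nonneg y)
  simp only [this, measure_univ]
  obtain ⟨f, hf⟩ := specAll_nonempty
  exact biSup_const ⟨_, _, ⟨f, hf, rfl⟩, rfl⟩

variable (hγ : ∀ γ ∈ Set.Icc 0 Real.pi, ¬ colSpan (trigMat n (rho γ L) γ) ≤ M)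

include hγ

theorem posSemidef_of_mem {A : Matrix (Fin n) (Fin n) ℝ}
    (hA : A ∈ closure (normProj L '' covModel n)) : A.PosSemidef := by
  obtain ⟨c, _, h⟩ := exists_forall_mem_closure_normProj hT.le hT.ne_top hγ
  exact (h A hA).1

theorem isCompact_closure : IsCompact (closure (normProj L '' covModel n)) := by
  obtain ⟨c, _, h⟩ := exists_forall_mem_closure_normProj hT.le hT.ne_top hγ
  exact isCompact_closure_normProj fun A hA => (h A hA).2.1

theorem not_colSpan_le {A : Matrix (Fin n) (Fin n) ℝ}
    (hA : A ∈ closure (normProj L '' covModel n)) : ¬ colSpan A ≤ M := by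
  obtain ⟨c, hc, h⟩ := exists_forall_mem_closure_normProj hT.le hT.ne_top hγ
  exact not_colSpan_le_of_trace_pos (hc.trans_le (h A hA).2.2.2)

theorem colSpan_le_orthogonal {A : Matrix (Fin n) (Fin n) ℝ}
    (hA : A ∈ closure (normProj L '' covModel n)) : colSpan A ≤ Lᗮ := by
  obtain ⟨c, _, h⟩ := exists_forall_mem_closure_normProj hT.le hT.ne_top hγ
  intro y hy
  obtain ⟨β, hβ⟩ := (mem_colSpan_iff _ _).1 hy
  rw [← projPerp_mulVec_eq_self_iff, ← hβ, Matrix.mulVec_mulVec, (h A hA).2.2.1]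

theorem ae_notMem {μ₀ : EuclideanSpace ℝ (Fin n)} (hμ₀ : μ₀ ∈ M₀) {A : Matrix (Fin n) (Fin n) ℝ}
    (hA : A ∈ closure (normProj L '' covModel n)) : ∀ᵐ y ∂multivariateGaussian μ₀ A, y ∉ M :=
  ae_multivariateGaussian_notMem (hT.subset hμ₀) (hT.posSemidef_of_mem hγ hA)
    (hT.not_colSpan_le hγ hA)

/-- Under limiting Gaussian laws the statistic has no atom at `c`, unless the law concentrates on
a space on which the statistic is constant. -/
theorem ae_ne {μ₀ : EuclideanSpace ℝ (Fin n)} (hμ₀ : μ₀ ∈ M₀) {A : Matrix (Fin n) (Fin n) ℝ}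
    (hA : A ∈ closure (normProj L '' covModel n)) {c : ℝ}
    (h : A ∈ normProj L '' covModel n ∨ cStar M₀ L (covModel n) T < c) :
    ∀ᵐ y ∂multivariateGaussian μ₀ A, T y ≠ c := by
  obtain ⟨p, hp, hpc⟩ := hT.analytic c
  -- Either p vanishes on all of μ₀ + span A, making the statistic equal to c there off M, or {T =
  -- c} is null because M is null too.
  rcases forall_or_ae_multivariateGaussian_ne_zero μ₀ (hT.posSemidef_of_mem hγ hA) hp with h0 | h0
  · exfalso
    have hconst : ∀ x ∈ colSpan A, μ₀ + x ∉ M → T (μ₀ + x) = c := fun x hx hxM =>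
      (hpc _ hxM).1 (h0 x hx)
    rcases lt_or_ge (A.rank + Module.finrank ℝ L) n with hr | hr
    · rcases h with ⟨_, ⟨f, hf, rfl⟩, rfl⟩ | h
      · exact absurd (le_rank_normProj (posDef_specCov hf) hT.ne_top) (not_le.2 hr)
      -- Constancy on a rank-deficient limit space makes c one of the values whose supremum is C^*,
      -- so c cannot exceed C^*.
      · refine (not_le.2 h) (le_sSup ?_)
        refine ⟨c, rfl, colSpan A, ⟨A, hA, hr, rfl⟩, μ₀, hμ₀, ?_⟩
        filter_upwards [ae_affineLebesgue_notMem (hT.subset hμ₀) (hT.not_colSpan_le hγ hA)]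
        rintro _ ⟨⟨x, hx, rfl⟩, hxM⟩
        exact hconst x hx hxM
    -- At full rank the span is all of Lᗮ. Invariance under L then spreads the value c to every
    -- point off M, contradicting nonconstancy.
    · have hle := hT.colSpan_le_orthogonal hγ hA
      have heq : colSpan A = Lᗮ := by
        refine Submodule.eq_of_le_of_finrank_le hle ?_
        have := L.finrank_add_finrank_orthogonal
        rw [finrank_euclideanSpace_fin] at this
        rw [finrank_colSpan]
        omega
      obtain ⟨y, hyM, hyc⟩ := hT.exists_ne c
      have h1 := hT.invariant μ₀ hμ₀ μ₀ hμ₀ 1 one_pos y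
      rw [one_smul] at h1
      rw [← h1] at hyc
      refine hyc (hconst _ ?_ fun hmem => hyM ?_)
      · rw [heq]; exact Submodule.starProjection_apply_mem _ _
      have h2 : (y - μ₀) - Lᗮ.starProjection (y - μ₀) ∈ L := by
        have := Submodule.sub_starProjection_mem_orthogonal (K := Lᗮ) (y - μ₀)
        rwa [Submodule.orthogonal_orthogonal] at this
      have h3 := M.add_mem hmem (hT.le h2)
      have h4 : μ₀ + Lᗮ.starProjection (y - μ₀) + ((y - μ₀) - Lᗮ.starProjection (y - μ₀)) = y := by
        abel
      rwa [h4] at h3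
  · filter_upwards [h0, hT.ae_notMem hγ hμ₀ hA] with y hy hyM hyc
    exact hy ((hpc y hyM).2 hyc)

/-- The set {c ≤ T} need not be closed, but its union with M is. The closed-set half of the
portmanteau theorem applies to the union, and M is null for the limit law. -/
theorem le_of_tendsto {μ₀ : EuclideanSpace ℝ (Fin n)} (hμ₀ : μ₀ ∈ M₀)
    {A : ℕ → Matrix (Fin n) (Fin n) ℝ} (hA : ∀ m, A m ∈ closure (normProj L '' covModel n))
    {A₀ : Matrix (Fin n) (Fin n) ℝ} (hA₀ : A₀ ∈ closure (normProj L '' covModel n))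
    (hlim : Tendsto A atTop (𝓝 A₀)) {a : ENNReal} {C : ℕ → ℝ} {c : ℝ} (hC : ∀ᶠ m in atTop, c ≤ C m)
    (ha : ∀ m, a ≤ multivariateGaussian μ₀ (A m) {y | C m ≤ T y}) :
    a ≤ multivariateGaussian μ₀ A₀ {y | c ≤ T y} := by
  have h1 := ProbabilityMeasure.limsup_measure_closed_le_of_tendsto
    (tendsto_multivariateGaussian μ₀ (fun m => hT.posSemidef_of_mem hγ (hA m))
      (hT.posSemidef_of_mem hγ hA₀) hlim) (hT.isClosed_union c)
  have h2 : a ≤ limsup (fun m => (gaussianLaw μ₀ (A m) : Measure (EuclideanSpace ℝ (Fin n)))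
      ({y | c ≤ T y} ∪ (M : Set (EuclideanSpace ℝ (Fin n))))) atTop := by
    refine le_limsup_of_frequently_le (Eventually.frequently ?_)
    filter_upwards [hC] with m hm
    exact (ha m).trans (measure_mono fun y (hy : C m ≤ T y) => Or.inl (hm.trans hy))
  refine h2.trans (h1.trans (le_of_eq (measure_congr ?_)))
  filter_upwards [hT.ae_notMem hγ hμ₀ hA₀] with y hy
  apply propext
  exact or_iff_left hy

/-- A sequence of lower bounds for rejection probabilities passes to a limit point. -/
theorem exists_limit {μ₀ : EuclideanSpace ℝ (Fin n)} (hμ₀ : μ₀ ∈ M₀) {a : ENNReal} {C : ℕ → ℝ}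
    (ha : ∀ m, a < testSize M₀ (covModel n) T (C m)) :
    ∃ (A : ℕ → Matrix (Fin n) (Fin n) ℝ) (A₀ : Matrix (Fin n) (Fin n) ℝ),
      (∀ m, A m ∈ normProj L '' covModel n) ∧ A₀ ∈ closure (normProj L '' covModel n) ∧
      Tendsto A atTop (𝓝 A₀) ∧ ∀ c, (∀ᶠ m in atTop, c ≤ C m) →
        a ≤ multivariateGaussian μ₀ A₀ {y | c ≤ T y} := by
  have h1 : ∀ m, ∃ A ∈ normProj L '' covModel n,
      a < multivariateGaussian μ₀ A {y | C m ≤ T y} := by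
    intro m
    have := ha m
    rw [hT.testSize_eq hμ₀, lt_iSup_iff] at this
    obtain ⟨A, hA⟩ := this
    obtain ⟨hA', hA⟩ := lt_iSup_iff.1 hA
    exact ⟨A, hA', hA⟩
  choose A hA hA' using h1
  have : FirstCountableTopology (Matrix (Fin n) (Fin n) ℝ) :=
    inferInstanceAs (FirstCountableTopology (Fin n → Fin n → ℝ))
  obtain ⟨A₀, hA₀, φ, hφ, hlim⟩ := (hT.isCompact_closure hγ).tendsto_subseq
    fun m => subset_closure (hA m)
  refine ⟨A ∘ φ, A₀, fun m => hA _, hA₀, hlim, fun c hc => ?_⟩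
  exact hT.le_of_tendsto hγ hμ₀ (fun m => subset_closure (hA _)) hA₀ hlim
    (hφ.tendsto_atTop.eventually hc) fun m => (hA' _).le

/-- If the size exceeded a at every natural number, one limit law would give every event {m ≤ T}
mass at least a. These events decrease to the empty set because T is finite everywhere. -/
theorem exists_testSize_le {a : ENNReal} (ha : 0 < a) : ∃ c, testSize M₀ (covModel n) T c ≤ a := by
  by_contra! h
  obtain ⟨μ₀, hμ₀⟩ := hT.nonempty
  obtain ⟨A, A₀, -, -, -, hlim⟩ := hT.exists_limit hγ hμ₀ (C := fun m => (m : ℝ)) fun m => h m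
  have h1 : Tendsto (fun m : ℕ => multivariateGaussian μ₀ A₀ {y | (m : ℝ) ≤ T y}) atTop
      (𝓝 (multivariateGaussian μ₀ A₀ (⋂ m : ℕ, {y | (m : ℝ) ≤ T y}))) := by
    refine tendsto_measure_iInter_atTop (fun m => (hT.measurableSet_le m).nullMeasurableSet) ?_
      ⟨0, measure_ne_top _ _⟩
    intro m m' hmm y (hy : (m' : ℝ) ≤ T y)
    exact (Nat.cast_le.2 hmm).trans hy
  have h2 : (⋂ m : ℕ, {y | (m : ℝ) ≤ T y}) = ∅ := by
    ext y
    obtain ⟨m, hm⟩ := exists_nat_gt (T y)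
    simp only [Set.mem_iInter, Set.mem_ofPred_eq, Set.mem_empty_iff_false, iff_false, not_forall,
      not_le]
    exact ⟨m, hm⟩
  rw [h2, measure_empty] at h1
  refine ha.not_ge (ge_of_tendsto' h1 fun m => hlim m ?_)
  exact tendsto_natCast_atTop_atTop.eventually_ge_atTop _

/-- The size is right continuous. -/
theorem testSize_le_of_forall_gt {a : ENNReal} {c : ℝ}
    (h : ∀ c', c < c' → testSize M₀ (covModel n) T c' ≤ a) :
    testSize M₀ (covModel n) T c ≤ a := by
  obtain ⟨μ₀, hμ₀⟩ := hT.nonempty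
  rw [hT.testSize_eq hμ₀]
  refine iSup₂_le fun A hA => ?_
  -- Laws from the model itself have no atoms, whatever the position of c relative to C^*; this is
  -- why right continuity needs no lower bound on c.
  have h1 : multivariateGaussian μ₀ A {y | c ≤ T y} = multivariateGaussian μ₀ A {y | c < T y} := by
    refine measure_congr ?_
    filter_upwards [hT.ae_ne hγ hμ₀ (subset_closure hA) (c := c) (Or.inl hA)] with y hy
    apply propext
    exact ⟨fun h => lt_of_le_of_ne h hy.symm, le_of_lt⟩
  have h2 : {y | c < T y} = ⋃ m : ℕ, {y | c + 1 / ((m : ℝ) + 1) ≤ T y} := by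
    ext y
    simp only [Set.mem_ofPred_eq, Set.mem_iUnion]
    constructor
    · intro hy
      obtain ⟨m, hm⟩ := exists_nat_one_div_lt (sub_pos.2 hy)
      exact ⟨m, by linarith⟩
    · rintro ⟨m, hm⟩
      have : 0 < 1 / ((m : ℝ) + 1) := Nat.one_div_pos_of_nat
      linarith
  have h3 : Monotone fun m : ℕ => {y | c + 1 / ((m : ℝ) + 1) ≤ T y} := by
    intro m m' hmm y (hy : c + 1 / ((m : ℝ) + 1) ≤ T y)
    have := Nat.one_div_le_one_div (α := ℝ) hmm
    exact le_trans (by linarith) hy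
  rw [h1, h2, h3.measure_iUnion]
  refine iSup_le fun m => le_trans ?_ (h (c + 1 / ((m : ℝ) + 1)) ?_)
  · rw [hT.testSize_eq hμ₀]
    exact le_iSup₂ (f := fun A (_ : A ∈ normProj L '' covModel n) =>
      multivariateGaussian μ₀ A {y | c + 1 / ((m : ℝ) + 1) ≤ T y}) A hA
  · have : 0 < 1 / ((m : ℝ) + 1) := Nat.one_div_pos_of_nat
    linarith

/-- The size is left continuous above `C^*`. -/
theorem le_testSize_of_forall_lt {a : ENNReal} {c : ℝ} (hc : cStar M₀ L (covModel n) T < c)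
    (h : ∀ c', c' < c → a < testSize M₀ (covModel n) T c') :
    a ≤ testSize M₀ (covModel n) T c := by
  obtain ⟨μ₀, hμ₀⟩ := hT.nonempty
  have hpos : ∀ m : ℕ, 0 < 1 / ((m : ℝ) + 1) := fun m => Nat.one_div_pos_of_nat
  obtain ⟨A, A₀, hA, hA₀, hlim, hle⟩ := hT.exists_limit hγ hμ₀
    (C := fun m => c - 1 / ((m : ℝ) + 1)) fun m => h _ (by linarith [hpos m])
  have hant : Antitone fun m : ℕ => {y | c - 1 / ((m : ℝ) + 1) ≤ T y} := by
    intro m m' hmm y (hy : c - 1 / ((m' : ℝ) + 1) ≤ T y)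
    have := Nat.one_div_le_one_div (α := ℝ) hmm
    exact le_trans (by linarith) hy
  have h1 : Tendsto (fun m : ℕ => multivariateGaussian μ₀ A₀ {y | c - 1 / ((m : ℝ) + 1) ≤ T y})
      atTop (𝓝 (multivariateGaussian μ₀ A₀ (⋂ m : ℕ, {y | c - 1 / ((m : ℝ) + 1) ≤ T y}))) :=
    tendsto_measure_iInter_atTop (fun m => (hT.measurableSet_le _).nullMeasurableSet) hant
      ⟨0, measure_ne_top _ _⟩
  have h2 : (⋂ m : ℕ, {y | c - 1 / ((m : ℝ) + 1) ≤ T y}) = {y | c ≤ T y} := by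
    ext y
    simp only [Set.mem_ofPred_eq, Set.mem_iInter]
    constructor
    · intro hy
      by_contra! hlt
      obtain ⟨m, hm⟩ := exists_nat_one_div_lt (sub_pos.2 hlt)
      linarith [hy m]
    · intro hy m
      linarith [hpos m]
  rw [h2] at h1
  have h3 : a ≤ multivariateGaussian μ₀ A₀ {y | c ≤ T y} := by
    refine ge_of_tendsto' h1 fun m => hle _ ?_
    filter_upwards [eventually_ge_atTop m] with m' hm'
    have := Nat.one_div_le_one_div (α := ℝ) hm'
    linarith
  have h4 : multivariateGaussian μ₀ A₀ {y | c ≤ T y} =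
      multivariateGaussian μ₀ A₀ ({y | c < T y} \ (M : Set (EuclideanSpace ℝ (Fin n)))) := by
    refine measure_congr ?_
    filter_upwards [hT.ae_ne hγ hμ₀ hA₀ (Or.inr hc), hT.ae_notMem hγ hμ₀ hA₀] with y hy hyM
    apply propext
    exact ⟨fun h => ⟨lt_of_le_of_ne h hy.symm, hyM⟩, fun h => le_of_lt h.1⟩
  -- The absence of an atom at c allows {c ≤ T} to be replaced by the open set {c < T} \ M, so the
  -- mass of the limit law is carried back to the approximating members of the model.
  have h5 := ProbabilityMeasure.le_liminf_measure_open_of_tendsto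
    (tendsto_multivariateGaussian μ₀ (fun m => hT.posSemidef_of_mem hγ (subset_closure (hA m)))
      (hT.posSemidef_of_mem hγ hA₀) hlim) (hT.isOpen_diff c)
  rw [h4] at h3
  refine h3.trans (h5.trans ?_)
  refine liminf_le_of_le (by isBoundedDefault) fun b hb => ?_
  obtain ⟨m, hm⟩ := hb.exists
  refine hm.trans ?_
  rw [hT.testSize_eq hμ₀]
  refine le_trans (measure_mono (t := {y | c ≤ T y}) fun y hy => (show c < T y from hy.1).le)
    (le_iSup₂ (f := fun A (_ : A ∈ normProj L '' covModel n) =>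
      multivariateGaussian μ₀ A {y | c ≤ T y}) (A m) (hA m))

/-- The candidate is the smallest critical value of size at most α, which exists by monotonicity and
right continuity. Left continuity gives equality if it lies above C^*; otherwise C^* itself works.
-/
theorem sizeControllable : SizeControllable M₀ L (covModel n) T := by
  intro α hα hα1
  have hpos : 0 < ENNReal.ofReal α := ENNReal.ofReal_pos.2 hα
  have hlt1 : ENNReal.ofReal α < 1 := by rwa [← ENNReal.ofReal_one, ENNReal.ofReal_lt_ofReal_iff one_pos]
  have hex := hT.exists_testSize_le hγ hpos
  refine ⟨hex, fun hαs => ?_⟩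
  let S : Set ℝ := {c | testSize M₀ (covModel n) T c ≤ ENNReal.ofReal α}
  -- Since T ≥ 0, a nonpositive critical value has size one, which exceeds α.
  have hbdd : BddBelow S := by
    refine ⟨0, fun c hc => ?_⟩
    by_contra! hneg
    change testSize M₀ (covModel n) T c ≤ _ at hc
    rw [hT.testSize_of_nonpos hneg.le] at hc
    exact hc.not_gt hlt1
  have hgt : ∀ c, sInf S < c → testSize M₀ (covModel n) T c ≤ ENNReal.ofReal α := by
    intro c hc
    obtain ⟨c', hc', hlt⟩ := exists_lt_of_csInf_lt hex hc
    exact (hT.testSize_antitone hlt.le).trans hc'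
  have hlt : ∀ c, c < sInf S → ENNReal.ofReal α < testSize M₀ (covModel n) T c := by
    intro c hc
    by_contra! h
    exact hc.not_ge (csInf_le hbdd h)
  have h0 := hT.testSize_le_of_forall_gt hγ hgt
  rcases lt_or_ge (cStar M₀ L (covModel n) T) (sInf S : ℝ) with hc | hc
  · exact ⟨sInf S, le_antisymm h0 (hT.le_testSize_of_forall_lt hγ hc hlt)⟩
  · generalize hs : cStar M₀ L (covModel n) T = s at hc
    induction s with
    | bot => simp at hc
    -- No real c exceeds C^*, so α^* is an empty supremum, that is 0, and cannot bound α > 0.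
    | top =>
      simp only [alphaStar, hs, not_top_lt, iSup_false, bot_eq_zero,
        iSup_const] at hαs
      exact absurd hpos (not_lt.2 hαs)
    | coe s =>
      -- At s = C^* the size is at most α because s is not below the infimum, and at least α^*
      -- because every c > s has size at most that of s.
      refine ⟨s, le_antisymm ((hT.testSize_antitone (EReal.coe_le_coe_iff.1 hc)).trans h0)
        (hαs.trans ?_)⟩
      refine iSup₂_le fun c hc' => hT.testSize_antitone ?_
      rw [hs, EReal.coe_lt_coe_iff] at hc'
      exact hc'.le

end RegularStat

/-! ### Quadratic-form statistics -/

section QuadStat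

variable {n q : ℕ} {κ : Type*} [Fintype κ] {X : Matrix (Fin n) κ ℝ} {R : Matrix (Fin q) κ ℝ}

theorem analyticOnNhd_adjugate {E : Type*} [NormedAddCommGroup E] [NormedSpace ℝ E]
    {A : E → Matrix (Fin q) (Fin q) ℝ} (h : ∀ i j, AnalyticOnNhd ℝ (fun y => A y i j) Set.univ)
    (i j : Fin q) : AnalyticOnNhd ℝ (fun y => (A y).adjugate i j) Set.univ := by
  simp only [Matrix.adjugate_apply]
  refine analyticOnNhd_det fun a b => ?_
  by_cases ha : a = j
  · simp only [Matrix.updateRow_apply, ha, if_true]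
    exact analyticOnNhd_const
  · simp only [Matrix.updateRow_apply, ha, if_false]
    exact h a b

theorem exists_mulVec_eq (hR : R.rank = q) (r : Fin q → ℝ) : ∃ β, R *ᵥ β = r := by
  have h : LinearMap.range R.mulVecLin = ⊤ := by
    apply Submodule.eq_top_of_finrank_eq
    rw [← Matrix.rank, hR, Module.finrank_fin_fun]
  obtain ⟨β, hβ⟩ := LinearMap.range_eq_top.1 h r
  exact ⟨β, hβ⟩

theorem nullDir_le_colSpan : nullDir X R ≤ colSpan X := by
  rintro _ ⟨β, rfl, _⟩
  exact toLp_mulVec_mem_colSpan X β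

variable [DecidableEq κ]

theorem ols_sub (y z : EuclideanSpace ℝ (Fin n)) : ols X (y - z) = ols X y - ols X z := by
  simp [ols, Matrix.mulVec_sub]

theorem resid_sub (y z : EuclideanSpace ℝ (Fin n)) : resid X (y - z) = resid X y - resid X z := by
  simp only [resid, ols_sub, Matrix.mulVec_sub, WithLp.ofLp_sub]; abel

theorem omegaOf_smul (a : ℝ) (Ψ : Matrix κ κ ℝ) : omegaOf X R (a • Ψ) = a • omegaOf X R Ψ := by
  simp only [omegaOf, Matrix.mul_smul, Matrix.smul_mul]
  rw [smul_comm]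

/-- Projecting off M₀^lin only subtracts some Xb with Rb = 0, which changes neither residuals nor
Rβ̂. What remains is scaling by δ about the null hypothesis. -/
theorem resid_add_smul_starProjection (hX : ∀ β, X *ᵥ β = 0 → β = 0) {r : Fin q → ℝ}
    {μ μ' : EuclideanSpace ℝ (Fin n)} (hμ : μ ∈ nullMeans X R r) (hμ' : μ' ∈ nullMeans X R r)
    (δ : ℝ) (y : EuclideanSpace ℝ (Fin n)) :
    resid X (μ' + δ • (nullDir X R)ᗮ.starProjection (y - μ)) = δ • resid X y ∧
    R *ᵥ ols X (μ' + δ • (nullDir X R)ᗮ.starProjection (y - μ)) - r =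
      δ • (R *ᵥ ols X y - r) := by
  obtain ⟨β, rfl, hβ⟩ := hμ
  obtain ⟨β', rfl, hβ'⟩ := hμ'
  have hl : y - WithLp.toLp 2 (X *ᵥ β) -
      (nullDir X R)ᗮ.starProjection (y - WithLp.toLp 2 (X *ᵥ β)) ∈ nullDir X R := by
    have := Submodule.sub_starProjection_mem_orthogonal (K := (nullDir X R)ᗮ)
      (y - WithLp.toLp 2 (X *ᵥ β))
    rwa [Submodule.orthogonal_orthogonal] at this
  obtain ⟨b, hb, hb0⟩ := hl
  have hP : (nullDir X R)ᗮ.starProjection (y - WithLp.toLp 2 (X *ᵥ β)) =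
      y - WithLp.toLp 2 (X *ᵥ β) - WithLp.toLp 2 (X *ᵥ b) := by
    rw [← hb]; abel
  have hz : ∀ b, resid X (WithLp.toLp 2 (X *ᵥ b)) = 0 := fun b =>
    (resid_eq_zero_iff hX _).2 (toLp_mulVec_mem_colSpan X b)
  rw [hP]
  constructor
  · rw [resid_add, resid_smul, resid_sub, resid_sub, hz, hz, hz]
    simp
  · rw [ols_add, ols_smul, ols_sub, ols_sub, ols_mulVec hX, ols_mulVec hX, ols_mulVec hX,
      Matrix.mulVec_add, Matrix.mulVec_smul, Matrix.mulVec_sub, Matrix.mulVec_sub, hβ, hβ', hb0]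
    simp

theorem quadStat_of_det_ne_zero {r : Fin q → ℝ} {Ψ : EuclideanSpace ℝ (Fin n) → Matrix κ κ ℝ}
    {y : EuclideanSpace ℝ (Fin n)} (h : (omegaOf X R (Ψ y)).det ≠ 0) :
    quadStat X R r Ψ y =
      (R *ᵥ ols X y - r) ⬝ᵥ ((omegaOf X R (Ψ y))⁻¹ *ᵥ (R *ᵥ ols X y - r)) := by
  rw [quadStat, if_pos h]

/-- Quadratic-form statistics based on covariance estimators that are homogeneous functions of the
residuals and positive definite off `span X` are regular. -/
theorem regularStat_quadStat (hX : ∀ β, X *ᵥ β = 0 → β = 0) (hcard : Fintype.card κ < n)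
    (hR : R.rank = q) (hq : 1 ≤ q) (r : Fin q → ℝ) {Ψ : EuclideanSpace ℝ (Fin n) → Matrix κ κ ℝ}
    {Q : (Fin n → ℝ) → Matrix κ κ ℝ} (hΨ : ∀ y, Ψ y = Q (resid X y))
    (hQ : ∀ (δ : ℝ) u, Q (δ • u) = δ ^ 2 • Q u)
    (hQa : ∀ i j, AnalyticOnNhd ℝ (fun u => Q u i j) Set.univ)
    (hpd : ∀ y ∉ colSpan X, (omegaOf X R (Ψ y)).PosDef) :
    RegularStat (nullMeans X R r) (nullDir X R) (colSpan X) (quadStat X R r Ψ) := by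
  have : Nonempty (Fin q) := ⟨⟨0, hq⟩⟩
  have hQ0 : Q 0 = 0 := by simpa using hQ 0 0
  have hzero : ∀ y ∈ colSpan X, quadStat X R r Ψ y = 0 := by
    intro y hy
    rw [quadStat, if_neg]
    rw [hΨ, (resid_eq_zero_iff hX y).2 hy, hQ0, not_not]
    simp [omegaOf]
  have hpos : ∀ y, y ∉ colSpan X → R *ᵥ ols X y - r ≠ 0 → 0 < quadStat X R r Ψ y := by
    intro y hy hne
    rw [quadStat_of_det_ne_zero (hpd y hy).det_pos.ne']
    simpa using (hpd y hy).inv.dotProduct_mulVec_pos hne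
  have hzero' : ∀ y, R *ᵥ ols X y - r = 0 → quadStat X R r Ψ y = 0 := by
    intro y hy
    rw [quadStat, hy]
    simp
  -- The adjugate clears the denominator: off span X the statistic is N divided by the determinant
  -- of Ω̂, with both analytic.
  let N : EuclideanSpace ℝ (Fin n) → ℝ := fun y =>
    (R *ᵥ ols X y - r) ⬝ᵥ ((omegaOf X R (Ψ y)).adjugate *ᵥ (R *ᵥ ols X y - r))
  have hN : ∀ y ∉ colSpan X,
      quadStat X R r Ψ y = N y / (omegaOf X R (Ψ y)).det := by
    intro y hy
    rw [quadStat_of_det_ne_zero (hpd y hy).det_pos.ne', Matrix.inv_def, Ring.inverse_eq_inv',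
      Matrix.smul_mulVec, dotProduct_smul, smul_eq_mul, inv_mul_eq_div]
  have hres : AnalyticOnNhd ℝ (resid X) Set.univ := by
    rw [analyticOnNhd_pi_iff]
    intro i
    have : (fun y => resid X y i) = fun y : EuclideanSpace ℝ (Fin n) =>
        ((1 - X * ((Xᵀ * X)⁻¹ * Xᵀ)) *ᵥ y.ofLp) i := by
      ext y
      simp [resid, ols, Matrix.sub_mulVec, Matrix.mulVec_mulVec]
    rw [this]
    exact analyticOnNhd_mulVec _ i
  have hΨa : ∀ i j, AnalyticOnNhd ℝ (fun y => Ψ y i j) Set.univ := by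
    intro i j
    simp only [hΨ]
    exact (hQa i j).comp hres (Set.mapsTo_univ _ _)
  have hΩa : ∀ i j, AnalyticOnNhd ℝ (fun y => omegaOf X R (Ψ y) i j) Set.univ := by
    intro i j
    simp only [omegaOf, Matrix.smul_apply, Matrix.mul_apply, smul_eq_mul, Finset.sum_mul,
      Finset.mul_sum]
    repeat' refine Finset.analyticOnNhd_fun_sum _ fun _ _ => ?_
    exact analyticOnNhd_const.mul (((analyticOnNhd_const.mul (hΨa _ _)).mul
      analyticOnNhd_const).mul analyticOnNhd_const)
  have hva : ∀ i, AnalyticOnNhd ℝ (fun y => (R *ᵥ ols X y - r) i) Set.univ := by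
    intro i
    have : (fun y => (R *ᵥ ols X y - r) i) = fun y : EuclideanSpace ℝ (Fin n) =>
        ((R * ((Xᵀ * X)⁻¹ * Xᵀ)) *ᵥ y.ofLp) i - r i := by
      ext y
      simp [ols, Matrix.mulVec_mulVec]
    rw [this]
    exact (analyticOnNhd_mulVec _ i).sub analyticOnNhd_const
  have hNa : AnalyticOnNhd ℝ N Set.univ := by
    simp only [N, dotProduct, Matrix.mulVec]
    exact Finset.analyticOnNhd_fun_sum _ fun i _ => (hva i).mul
      (Finset.analyticOnNhd_fun_sum _ fun j _ => (analyticOnNhd_adjugate hΩa i j).mul (hva j))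
  have hda := analyticOnNhd_det hΩa
  obtain ⟨y₀, hy₀⟩ := exists_notMem_colSpan (X := X) hcard
  -- Adding elements of span X moves β̂ freely while staying outside span X. This yields points
  -- where Rβ̂ = r, with value 0, and points where it is not, with positive value.
  have hshift : ∀ β, ∃ y ∉ colSpan X, ols X y = β := by
    intro β
    refine ⟨y₀ + WithLp.toLp 2 (X *ᵥ (β - ols X y₀)), fun h => hy₀ ?_, ?_⟩
    · exact (Submodule.add_mem_iff_left _ (toLp_mulVec_mem_colSpan X _)).1 h
    · rw [ols_add, ols_mulVec hX]; abel
  refine ⟨nullDir_le_colSpan, ?_, ?_, ?_, ?_, ?_, hzero, ?_, ?_, ?_⟩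
  · exact fun h => colSpan_ne_top (X := X) hcard (top_le_iff.1 (h ▸ nullDir_le_colSpan))
  · obtain ⟨β, hβ⟩ := exists_mulVec_eq hR r
    exact ⟨_, β, rfl, hβ⟩
  · rintro _ ⟨β, rfl, _⟩
    exact toLp_mulVec_mem_colSpan X β
  · intro μ hμ μ' hμ' δ hδ y
    obtain ⟨h1, h2⟩ := resid_add_smul_starProjection hX hμ hμ' δ y
    generalize μ' + δ • (nullDir X R)ᗮ.starProjection (y - μ) = y' at h1 h2
    have hΩ : omegaOf X R (Ψ y') = δ ^ 2 • omegaOf X R (Ψ y) := by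
      rw [hΨ, h1, hQ, omegaOf_smul, hΨ y]
    have hδ2 : δ ^ 2 ≠ 0 := by positivity
    have hy' : y' ∈ colSpan X ↔ y ∈ colSpan X := by
      rw [← resid_eq_zero_iff hX, ← resid_eq_zero_iff hX, h1, smul_eq_zero]
      simp [hδ.ne']
    by_cases hy : y ∈ colSpan X
    · rw [hzero y hy, hzero y' (hy'.2 hy)]
    · have hd := (hpd y hy).det_pos.ne'
      have hd' := (hpd y' fun h => hy (hy'.1 h)).det_pos.ne'
      rw [quadStat_of_det_ne_zero hd, quadStat_of_det_ne_zero hd', h2, hΩ]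
      -- Ω̂ scales by δ² and Rβ̂ - r by δ, so the quadratic form is unchanged.
      have hinv : (δ ^ 2 • omegaOf X R (Ψ y))⁻¹ = (δ ^ 2)⁻¹ • (omegaOf X R (Ψ y))⁻¹ := by
        apply Matrix.inv_eq_left_inv
        rw [Matrix.smul_mul, Matrix.mul_smul, smul_smul, inv_mul_cancel₀ hδ2, one_smul,
          Matrix.nonsing_inv_mul _ hd.isUnit]
      rw [hinv, Matrix.smul_mulVec, Matrix.mulVec_smul, smul_dotProduct, dotProduct_smul,
        dotProduct_smul]
      simp only [smul_eq_mul]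
      field_simp
  · intro y
    by_cases hy : y ∈ colSpan X
    · exact (hzero y hy).ge
    · by_cases hv : R *ᵥ ols X y - r = 0
      · exact (hzero' y hv).ge
      · exact (hpos y hy hv).le
  · have hc1 : Continuous N := continuousOn_univ.1 hNa.continuousOn
    have hc2 : Continuous fun y => (omegaOf X R (Ψ y)).det := continuousOn_univ.1 hda.continuousOn
    refine (hc1.continuousOn.div hc2.continuousOn fun y hy => (hpd y hy).det_pos.ne').congr ?_
    exact fun y hy => hN y hy
  · intro c
    -- Clearing the denominator in N/det = c; the determinant is positive off span X.
    refine ⟨fun y => N y - c * (omegaOf X R (Ψ y)).det,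
      hNa.sub (analyticOnNhd_const.mul hda), fun y hy => ?_⟩
    rw [hN y hy, sub_eq_zero, div_eq_iff (hpd y hy).det_pos.ne']
  · intro c
    by_cases hc : c = 0
    · obtain ⟨β, hβ⟩ := exists_mulVec_eq hR (r + 1)
      obtain ⟨y, hy, hyβ⟩ := hshift β
      refine ⟨y, hy, ?_⟩
      rw [hc]
      refine (hpos y hy ?_).ne'
      rw [hyβ, hβ, add_sub_cancel_left]
      exact one_ne_zero
    · obtain ⟨β, hβ⟩ := exists_mulVec_eq hR r
      obtain ⟨y, hy, hyβ⟩ := hshift β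
      refine ⟨y, hy, ?_⟩
      rw [hzero' y (by rw [hyβ, hβ, sub_self])]
      exact Ne.symm hc

end QuadStat

/-! ### Verification of regularity for the two covariance estimators. -/

section Estimators

variable {n q : ℕ} {κ : Type*} [Fintype κ] [DecidableEq κ] {X : Matrix (Fin n) κ ℝ}
  {R : Matrix (Fin q) κ ℝ}

theorem gammaHat_apply (X : Matrix (Fin n) κ ℝ) (y : EuclideanSpace ℝ (Fin n)) (j : ℤ) (a b : κ) :
    gammaHat X y j a b = (n : ℝ)⁻¹ * ∑ t : Fin n, ∑ s : Fin n,
      if (t : ℤ) - s = j then (resid X y t * X t a) * (resid X y s * X s b) else 0 := by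
  have hnat : ∀ (m : ℕ) (a b : κ), gammaNat X y m a b = (n : ℝ)⁻¹ * ∑ t : Fin n, ∑ s : Fin n,
      if (t : ℕ) = (s : ℕ) + m then (resid X y t * X t a) * (resid X y s * X s b) else 0 := by
    intro m a b
    simp only [gammaNat, Matrix.smul_apply, Matrix.sum_apply, smul_eq_mul]
    congr 1
    refine Finset.sum_congr rfl fun t _ => Finset.sum_congr rfl fun s _ => ?_
    split_ifs <;> simp [Matrix.vecMulVec_apply, vHat]
  rw [gammaHat]
  split_ifs with hj
  · rw [hnat]
    congr 1
    refine Finset.sum_congr rfl fun t _ => Finset.sum_congr rfl fun s _ => ?_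
    exact if_congr (by omega) rfl rfl
  · rw [Matrix.transpose_apply, hnat, Finset.sum_comm]
    congr 1
    refine Finset.sum_congr rfl fun t _ => Finset.sum_congr rfl fun s _ => ?_
    rw [mul_comm (resid X y s * X s b)]
    exact if_congr (by omega) rfl rfl

/-- Summing over lags collects every pair (t, s) once with weight w(t - s). After multiplication by
R(X'X)⁻¹ this exhibits Ω̂ as B(y) 𝒲 B(y)', with 𝒲 the Toeplitz matrix of the weights. -/
theorem psiW_eq (X : Matrix (Fin n) κ ℝ) (w : ℤ → ℝ) (y : EuclideanSpace ℝ (Fin n)) :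
    psiW X w y = (n : ℝ)⁻¹ • ((Matrix.diagonal (resid X y) * X)ᵀ *
      (Matrix.of fun i j : Fin n => w ((i : ℤ) - (j : ℤ))) *
      (Matrix.diagonal (resid X y) * X)) := by
  obtain ⟨V, hV⟩ : ∃ V, V = Matrix.diagonal (resid X y) * X := ⟨_, rfl⟩
  have hV' : ∀ t a, resid X y t * X t a = V t a := fun t a => by rw [hV, Matrix.diagonal_mul]
  rw [← hV]
  ext a b
  simp only [psiW, Matrix.sum_apply, Matrix.smul_apply, smul_eq_mul, gammaHat_apply, hV',
    Matrix.mul_apply, Matrix.transpose_apply, Matrix.of_apply, Finset.mul_sum, Finset.sum_mul]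
  rw [Finset.sum_comm]
  refine Eq.trans (Finset.sum_congr rfl fun t _ => Finset.sum_comm) ?_
  rw [Finset.sum_comm]
  refine Finset.sum_congr rfl fun s _ => Finset.sum_congr rfl fun t _ => ?_
  rw [Finset.sum_eq_single ((t : ℤ) - s)]
  · simp; ring
  · intro j _ hj
    rw [if_neg (Ne.symm hj)]; simp
  · intro h
    exfalso
    apply h
    have := t.isLt; have := s.isLt
    rw [Finset.mem_Icc]; omega

/-- Ω̂ = B(y) 𝒲 B(y)' with 𝒲 positive definite is itself positive definite once B(y) has rank q;
this is where the description of the set 𝖡 as span X enters. -/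
theorem regularStat_statW (hX : ∀ β, X *ᵥ β = 0 → β = 0) (hcard : Fintype.card κ < n)
    (hR : R.rank = q) (hq : 1 ≤ q) (hB : bSet X R = (colSpan X : Set (EuclideanSpace ℝ (Fin n))))
    (r : Fin q → ℝ) {w : ℤ → ℝ} (hw : WeightAssumption n w) :
    RegularStat (nullMeans X R r) (nullDir X R) (colSpan X) (statW X R r w) := by
  have hn : (n : ℝ) ≠ 0 := by
    have : 0 < n := by omega
    positivity
  refine regularStat_quadStat hX hcard hR hq r (Q := fun u => (n : ℝ)⁻¹ •
    ((Matrix.diagonal u * X)ᵀ * (Matrix.of fun i j : Fin n => w ((i : ℤ) - (j : ℤ))) *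
      (Matrix.diagonal u * X))) (psiW_eq X w) ?_ ?_ ?_
  · intro δ u
    have : Matrix.diagonal (δ • u) = δ • Matrix.diagonal u := by
      ext i j; by_cases h : i = j <;> simp [h]
    rw [this]
    simp only [Matrix.smul_mul, Matrix.transpose_smul, Matrix.mul_smul, smul_smul]
    congr 1; ring
  · intro i j
    have hp : ∀ c d, AnalyticOnNhd ℝ (fun u : Fin n → ℝ => (Matrix.diagonal u * X) c d) Set.univ := by
      intro c d
      simp only [Matrix.diagonal_mul]
      exact ((ContinuousLinearMap.proj (R := ℝ) (φ := fun _ : Fin n => ℝ) c).analyticOnNhd _).mul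
        analyticOnNhd_const
    simp only [Matrix.smul_apply, Matrix.mul_apply (M := _ * _), Matrix.mul_apply (M := _ᵀ),
      Matrix.transpose_apply, smul_eq_mul]
    refine analyticOnNhd_const.mul (Finset.analyticOnNhd_fun_sum _ fun a _ => ?_)
    exact (Finset.analyticOnNhd_fun_sum _ fun b _ => (hp _ _).mul analyticOnNhd_const).mul (hp _ _)
  · intro y hy
    have hy' : y ∉ bSet X R := by rw [hB]; exact hy
    have hrank : (bMat X R y).rank = q :=
      le_antisymm (by simpa using Matrix.rank_le_height (bMat X R y)) (not_lt.1 hy')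
    have hΩ : omegaOf X R (psiW X w y) = bMat X R y *
        (Matrix.of fun i j : Fin n => w ((i : ℤ) - (j : ℤ))) * (bMat X R y)ᴴ := by
      have hs : ((Xᵀ * X)⁻¹)ᵀ = (Xᵀ * X)⁻¹ := by
        rw [Matrix.transpose_nonsing_inv]; simp
      rw [psiW_eq, omegaOf_smul, omegaOf, smul_smul, inv_mul_cancel₀ hn, one_smul, bMat]
      simp only [Matrix.conjTranspose_eq_transpose_of_trivial, Matrix.transpose_mul,
        Matrix.diagonal_transpose, Matrix.transpose_transpose, hs, Matrix.mul_assoc]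
    rw [hΩ]
    refine hw.2.2.mul_mul_conjTranspose_same fun a b hab => ?_
    rw [← sub_eq_zero]
    apply (rank_eq_iff_forall_vecMul _).1 hrank
    rw [Matrix.sub_vecMul]
    exact sub_eq_zero.2 hab

/-- The matrix of empirical autocovariances of a vector. -/
def autocovMat (u : Fin n → ℝ) : Matrix (Fin n) (Fin n) ℝ :=
  Matrix.of fun i j => ∑ l : Fin n, ∑ m : Fin n,
    if (l : ℕ) = (m : ℕ) + ((i : ℤ) - (j : ℤ)).natAbs then u l * u m else 0

/-- The matrix whose rows are the shifts of a vector. -/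
def shiftMat (u : Fin n → ℝ) : Matrix (Fin n) (Fin (2 * n)) ℝ :=
  Matrix.of fun i p => ∑ l : Fin n, if (p : ℕ) = (l : ℕ) + (i : ℕ) then u l else 0

/-- The inner product of two shifts of a zero-padded vector depends only on the difference of the
shifts and equals the autocovariance sum at that lag. Width 2n leaves room for all n shifts. -/
theorem autocovMat_eq (u : Fin n → ℝ) : autocovMat u = shiftMat u * (shiftMat u)ᴴ := by
  ext i j
  have h1 : (shiftMat u * (shiftMat u)ᴴ) i j = ∑ l : Fin n, ∑ m : Fin n,
      if (l : ℕ) + i = (m : ℕ) + j then u l * u m else 0 := by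
    simp only [Matrix.mul_apply, Matrix.conjTranspose_apply, star_trivial, shiftMat,
      Matrix.of_apply, Finset.sum_mul_sum]
    rw [Finset.sum_comm]
    refine Finset.sum_congr rfl fun l _ => ?_
    rw [Finset.sum_comm]
    refine Finset.sum_congr rfl fun m _ => ?_
    rw [Finset.sum_eq_single ⟨(l : ℕ) + i, by omega⟩]
    · simp
    · intro p _ hp
      rw [if_neg (fun h => hp (Fin.ext h)), zero_mul]
    · simp
  rw [h1, autocovMat, Matrix.of_apply]
  rcases le_total i j with hij | hij
  · refine Finset.sum_congr rfl fun l _ => Finset.sum_congr rfl fun m _ => ?_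
    exact if_congr (by have := Fin.le_iff_val_le_val.1 hij; omega) rfl rfl
  · rw [Finset.sum_comm]
    refine Finset.sum_congr rfl fun l _ => Finset.sum_congr rfl fun m _ => ?_
    rw [mul_comm]
    exact if_congr (by have := Fin.le_iff_val_le_val.1 hij; omega) rfl rfl

/-- Combining the shifts of u with coefficients a is polynomial multiplication, and the polynomial
ring has no zero divisors. -/
theorem eq_zero_of_vecMul_shiftMat {u : Fin n → ℝ} (hu : u ≠ 0) {a : Fin n → ℝ}
    (h : a ᵥ* shiftMat u = 0) : a = 0 := by
  let P : (Fin n → ℝ) → Polynomial ℝ := fun v => ∑ i : Fin n, Polynomial.monomial (i : ℕ) (v i)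
  have hcoeff : ∀ v (i : Fin n), (P v).coeff i = v i := by
    intro v i
    simp [P, Polynomial.finsetSum_coeff, Polynomial.coeff_monomial, Fin.val_inj]
  have hprod : P a * P u = 0 := by
    ext p
    simp only [P, Finset.sum_mul_sum, Polynomial.finsetSum_coeff, Polynomial.monomial_mul_monomial,
      Polynomial.coeff_monomial, Polynomial.coeff_zero]
    by_cases hp : p < 2 * n
    · have h1 := congrFun h ⟨p, hp⟩
      simp only [Matrix.vecMul, dotProduct, shiftMat, Matrix.of_apply, Pi.zero_apply,
        Finset.mul_sum] at h1
      refine Eq.trans ?_ h1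
      refine Finset.sum_congr rfl fun i _ => Finset.sum_congr rfl fun l _ => ?_
      rw [mul_ite, mul_zero]
      exact if_congr (by omega) rfl rfl
    -- Degrees of the product are at most 2n - 2, so coefficients beyond the width of the shift
    -- matrix vanish.
    · refine Finset.sum_eq_zero fun i _ => Finset.sum_eq_zero fun l _ => ?_
      exact if_neg (by omega)
  rcases mul_eq_zero.1 hprod with h0 | h0
  · ext i
    rw [← hcoeff a, h0]; simp
  · refine absurd ?_ hu
    ext i
    rw [← hcoeff u, h0]; simp

theorem posDef_autocovMat {u : Fin n → ℝ} (hu : u ≠ 0) : (autocovMat u).PosDef := by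
  have := (Matrix.PosDef.one (n := Fin (2 * n)) (R := ℝ)).mul_mul_conjTranspose_same
    (B := shiftMat u) fun a b hab => by
      rw [← sub_eq_zero]
      apply eq_zero_of_vecMul_shiftMat hu
      rw [Matrix.sub_vecMul]
      exact sub_eq_zero.2 hab
  rwa [Matrix.mul_one, ← autocovMat_eq] at this

open scoped MatrixOrder in
/-- A variant of Schur's product theorem. -/
theorem posDef_hadamard {K W : Matrix (Fin n) (Fin n) ℝ} (hK : K.PosDef) (hW : W.PosSemidef)
    (hd : ∀ i, W i i = 1) : (Matrix.hadamard K W).PosDef := by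
  obtain ⟨C, hC⟩ : ∃ C : Matrix (Fin n) (Fin n) ℝ, W = Cᴴ * C :=
    CStarAlgebra.nonneg_iff_eq_star_mul_self.1 hW.nonneg
  refine Matrix.PosDef.of_dotProduct_mulVec_pos (hK.1.hadamard hW.1) fun x hx => ?_
  -- With W = C'C the form splits into a sum over the rows of C, each term being the form of K at x
  -- multiplied entrywise by that row. The unit diagonal of W ensures that some row is nonzero where
  -- x is, so one term is strictly positive.
  have hsum : star x ⬝ᵥ (Matrix.hadamard K W *ᵥ x) =
      ∑ r, (fun i => x i * C r i) ⬝ᵥ (K *ᵥ fun i => x i * C r i) := by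
    simp only [dotProduct, Matrix.mulVec, Finset.mul_sum, hC, Matrix.hadamard_apply,
      Matrix.mul_apply, Matrix.conjTranspose_apply, star_trivial, Finset.sum_mul, Pi.star_apply]
    refine Eq.trans (Finset.sum_congr rfl fun i _ => Finset.sum_comm) (Finset.sum_comm.trans ?_)
    refine Finset.sum_congr rfl fun r _ => Finset.sum_congr rfl fun i _ =>
      Finset.sum_congr rfl fun j _ => by ring
  rw [hsum]
  obtain ⟨i, hi⟩ := Function.ne_iff.1 hx
  obtain ⟨r, hr⟩ : ∃ r, C r i ≠ 0 := by
    by_contra! h0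
    have := hd i
    rw [hC] at this
    simp [Matrix.mul_apply, h0] at this
  refine Finset.sum_pos' (fun r _ => by simpa using hK.posSemidef.dotProduct_mulVec_nonneg _)
    ⟨r, Finset.mem_univ r, ?_⟩
  have hne : (fun i => x i * C r i) ≠ 0 := fun h => by
    have := congrFun h i
    simp [hr] at this
    exact hi this
  simpa using hK.dotProduct_mulVec_pos hne

/-- A nonzero residual already makes K̂ and hence its Hadamard product with W positive definite; Ω̂
inherits this because R(X'X)⁻¹X' has independent rows. -/
theorem regularStat_statE (hX : ∀ β, X *ᵥ β = 0 → β = 0) (hcard : Fintype.card κ < n)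
    (hR : R.rank = q) (hq : 1 ≤ q) (r : Fin q → ℝ) {W : Matrix (Fin n) (Fin n) ℝ}
    (hW : EickerWeights W) :
    RegularStat (nullMeans X R r) (nullDir X R) (colSpan X) (statE X R r W) := by
  have hn0 : (0 : ℝ) < n := by
    have : 0 < n := by omega
    positivity
  have hn := hn0.ne'
  have hk : ∀ y, kHat X y = (n : ℝ)⁻¹ • autocovMat (resid X y) := by
    intro y; ext i j; simp [kHat, autocovMat]
  refine regularStat_quadStat hX hcard hR hq r (Q := fun u => (n : ℝ)⁻¹ •
    (Xᵀ * Matrix.hadamard ((n : ℝ)⁻¹ • autocovMat u) W * X)) (fun y => by rw [psiE, hk]) ?_ ?_ ?_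
  · intro δ u
    have : autocovMat (δ • u) = δ ^ 2 • autocovMat u := by
      ext i j
      simp only [autocovMat, Matrix.of_apply, Matrix.smul_apply, smul_eq_mul, Finset.mul_sum,
        Pi.smul_apply, mul_ite, mul_zero]
      refine Finset.sum_congr rfl fun l _ => Finset.sum_congr rfl fun m _ => ?_
      congr 1; ring
    rw [this, smul_comm (n : ℝ)⁻¹ (δ ^ 2), Matrix.smul_hadamard, Matrix.mul_smul, Matrix.smul_mul,
      smul_comm]
  · intro i j
    simp only [Matrix.smul_apply, Matrix.mul_apply, Matrix.transpose_apply, Matrix.hadamard_apply,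
      smul_eq_mul, Finset.sum_mul, Finset.mul_sum, autocovMat, Matrix.of_apply]
    refine Finset.analyticOnNhd_fun_sum _ fun a _ => Finset.analyticOnNhd_fun_sum _ fun b _ => ?_
    refine Finset.analyticOnNhd_fun_sum _ fun l _ => Finset.analyticOnNhd_fun_sum _ fun m _ => ?_
    have hp : ∀ c : Fin n, AnalyticOnNhd ℝ (fun u : Fin n → ℝ => u c) Set.univ := fun c =>
      (ContinuousLinearMap.proj (R := ℝ) (φ := fun _ : Fin n => ℝ) c).analyticOnNhd _
    split_ifs
    · exact analyticOnNhd_const.mul ((analyticOnNhd_const.mul ((analyticOnNhd_const.mul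
        ((hp _).mul (hp _))).mul analyticOnNhd_const)).mul analyticOnNhd_const)
    · exact analyticOnNhd_const.mul ((analyticOnNhd_const.mul ((analyticOnNhd_const.mul
        analyticOnNhd_const).mul analyticOnNhd_const)).mul analyticOnNhd_const)
  · intro y hy
    have hu : resid X y ≠ 0 := fun h => hy ((resid_eq_zero_iff hX y).1 h)
    have hK : (Matrix.hadamard (kHat X y) W).PosDef := by
      refine posDef_hadamard ?_ hW.1 hW.2.1
      rw [hk]
      exact (posDef_autocovMat hu).smul (inv_pos.2 hn0)
    have hs : ((Xᵀ * X)⁻¹)ᵀ = (Xᵀ * X)⁻¹ := by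
      rw [Matrix.transpose_nonsing_inv]; simp
    have hΩ : omegaOf X R (psiE X W y) = (R * (Xᵀ * X)⁻¹ * Xᵀ) *
        Matrix.hadamard (kHat X y) W * (R * (Xᵀ * X)⁻¹ * Xᵀ)ᴴ := by
      rw [psiE, omegaOf_smul, omegaOf, smul_smul, inv_mul_cancel₀ hn, one_smul]
      simp only [Matrix.conjTranspose_eq_transpose_of_trivial, Matrix.transpose_mul,
        Matrix.transpose_transpose, hs, Matrix.mul_assoc]
    rw [hΩ]
    refine hK.mul_mul_conjTranspose_same fun a b hab => ?_
    rw [← sub_eq_zero]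
    have h0 : (a - b) ᵥ* (R * (Xᵀ * X)⁻¹ * Xᵀ) = 0 := by
      rw [Matrix.sub_vecMul]
      exact sub_eq_zero.2 hab
    rw [vecMul_olsMat] at h0
    refine eq_zero_of_mulVec_inv_gram hX hR ?_
    rw [hX _ h0, Matrix.mulVec_zero]

end Estimators

/-! ### Rank and frequency-index comparisons for the final assembly. -/

section Generic

variable {n k kF q : ℕ} {κ κ' : Type*} [Fintype κ] [Fintype κ']

theorem exists_vecMul_eq_zero (X : Matrix (Fin n) κ ℝ) (hcard : Fintype.card κ < n) :
    ∃ u : Fin n → ℝ, u ≠ 0 ∧ u ᵥ* X = 0 := by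
  have h := LinearMap.ker_ne_bot_of_finrank_lt (f := Xᵀ.mulVecLin) (by simpa using hcard)
  obtain ⟨u, hu, hu0⟩ := Submodule.exists_mem_ne_zero_of_ne_bot h
  refine ⟨u, hu0, ?_⟩
  rw [← Matrix.mulVec_transpose]
  exact hu

theorem lt_rank_fromCols (X : Matrix (Fin n) κ ℝ) (E : Matrix (Fin n) κ' ℝ)
    (h : ¬ colSpan E ≤ colSpan X) : X.rank < (Matrix.fromCols X E).rank := by
  rw [← finrank_colSpan, ← finrank_colSpan]
  apply Submodule.finrank_lt_finrank_of_lt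
  refine lt_of_le_of_ne (fun y hy => ?_) fun he => h fun y hy => ?_
  · obtain ⟨β, hβ⟩ := (mem_colSpan_iff X y).1 hy
    refine (mem_colSpan_iff _ y).2 ⟨Sum.elim β 0, ?_⟩
    rw [Matrix.fromCols_mulVec, ← hβ]; simp
  · rw [he]
    obtain ⟨β, hβ⟩ := (mem_colSpan_iff E y).1 hy
    refine (mem_colSpan_iff _ y).2 ⟨Sum.elim 0 β, ?_⟩
    rw [Matrix.fromCols_mulVec, ← hβ]; simp

/-- If the first E_{n,s}(γ) to leave the small space leaves even the large one, it also leaves every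
space in between, and no earlier one does. -/
theorem rho_eq_rho {L L' M : Submodule ℝ (EuclideanSpace ℝ (Fin n))} {γ : ℝ} (h : L' ≤ L)
    (h' : L ≤ M) (hM : M ≠ ⊤) (hγ : ¬ colSpan (trigMat n (rho γ L') γ) ≤ M) :
    rho γ L = rho γ L' := by
  refine le_antisymm (Nat.sInf_le fun hle => hγ (hle.trans h')) (Nat.sInf_le fun hle => ?_)
  exact rho_mem γ (fun hL => hM (top_le_iff.1 (hL ▸ h'))) (hle.trans h)

end Generic

end SizeControl

/-! ### Assembly of the theorem. -/

theorem mainTheorem3 (n k kF q : ℕ) (hkn : k < n) (hkF : kF < k) (hq : 1 ≤ q)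
    (F : Matrix (Fin n) (Fin kF) ℝ) (hF : F.rank = kF)
    (Rt : Matrix (Fin q) (Fin (k - kF)) ℝ)
    (R : Matrix (Fin q) (Fin kF ⊕ Fin (k - kF)) ℝ)
    (hRt : R = Matrix.fromCols 0 Rt) (hR : R.rank = q)
    (hind : ∀ i : Fin q → Fin n, StrictMono i →
      LinearIndependent ℝ (Sum.elim (fun (a : Fin kF) (t : Fin n) => F t a)
        (fun b : Fin q => (Pi.single (i b) 1 : Fin n → ℝ))))
    (hcond : k + 2 < n ∨ ∃ γ ∈ Set.Ioo 0 Real.pi,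
      (Matrix.fromCols F (SizeControl.trigMat n 0 γ)).rank = kF + 2) :
    ∀ᵐ Xt : Fin n → Fin (k - kF) → ℝ,
      ∀ X : Matrix (Fin n) (Fin kF ⊕ Fin (k - kF)) ℝ,
        X = Matrix.fromCols F (Matrix.of Xt) →
        X.rank = k ∧
        SizeControl.bSet X R =
          (SizeControl.colSpan X : Set (EuclideanSpace ℝ (Fin n))) ∧
        SizeControl.RankAssumption X R ∧
        (∀ γ ∈ Set.Icc 0 Real.pi,
          SizeControl.rho γ (SizeControl.nullDir X R) =
            SizeControl.rho γ (SizeControl.colSpan F)) ∧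
        (∀ γ ∈ Set.Icc 0 Real.pi,
          ¬ (SizeControl.colSpan (SizeControl.trigMat n
              (SizeControl.rho γ (SizeControl.nullDir X R)) γ) :
                Set (EuclideanSpace ℝ (Fin n))) ⊆ SizeControl.bSet X R) ∧
        (∀ γ ∈ Set.Icc 0 Real.pi,
          ¬ SizeControl.colSpan (SizeControl.trigMat n
              (SizeControl.rho γ (SizeControl.nullDir X R)) γ) ≤ SizeControl.colSpan X) ∧
        (∀ γ ∈ Set.Icc 0 Real.pi,
          k < (Matrix.fromCols X (SizeControl.trigMat n
              (SizeControl.rho γ (SizeControl.nullDir X R)) γ)).rank) ∧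
        (∀ (r : Fin q → ℝ) (w : ℤ → ℝ), SizeControl.WeightAssumption n w →
          SizeControl.SizeControllable (SizeControl.nullMeans X R r) (SizeControl.nullDir X R)
            (SizeControl.covModel n) (SizeControl.statW X R r w)) ∧
        (∀ (r : Fin q → ℝ) (W : Matrix (Fin n) (Fin n) ℝ), SizeControl.EickerWeights W →
          SizeControl.SizeControllable (SizeControl.nullMeans X R r) (SizeControl.nullDir X R)
            (SizeControl.covModel n) (SizeControl.statE X R r W)) := by
  open SizeControl Matrix in
  have hk : kF + (k - kF) = k := by omega
  have hcond' : kF + (k - kF) + 2 < n ∨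
      ∃ γ, (Matrix.fromCols F (trigMat n 0 γ)).rank = kF + 2 := by
    rw [hk]
    exact hcond.imp_right fun ⟨γ, _, h⟩ => ⟨γ, h⟩
  have hcardk : Fintype.card (Fin kF ⊕ Fin (k - kF)) = k := by simp [hk]
  have hcard : Fintype.card (Fin kF ⊕ Fin (k - kF)) < n := by rwa [hcardk]
  have hFinj : ∀ b, F *ᵥ b = 0 → b = 0 :=
    (rank_eq_card_iff_forall_mulVec F).1 (by rw [hF, Fintype.card_fin])
  filter_upwards [ae_rows_dichotomy F (m := k - kF) (by omega),
    ae_forall_not_colSpan_trigMat_rho_le F (m := k - kF) (by omega) hcond'] with Xt hdich htrig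
  rintro X rfl
  set X := Matrix.fromCols F (Matrix.of Xt) with hXdef
  have hmul : ∀ β, X *ᵥ β = F *ᵥ (β ∘ Sum.inl) + Matrix.of Xt *ᵥ (β ∘ Sum.inr) :=
    fun β => Matrix.fromCols_mulVec ..
  have hvec : ∀ u, u ᵥ* X = 0 → u ᵥ* F = 0 ∧ u ᵥ* Matrix.of Xt = 0 := by
    intro u h
    rw [hXdef, Matrix.vecMul_fromCols] at h
    exact ⟨funext fun i => congrFun h (Sum.inl i), funext fun i => congrFun h (Sum.inr i)⟩
  have hX : ∀ β, X *ᵥ β = 0 → β = 0 := by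
    intro β hβ
    -- Since k < n, some nonzero u is orthogonal to span X, which rules out the second alternative
    -- for the full row set. The first gives injectivity modulo F.
    rcases hdich Set.univ with h | h
    · have h2 : β ∘ Sum.inr = 0 := h (β ∘ Sum.inl) _ fun i _ => by
        have := congrFun hβ i
        rwa [hmul] at this
      rw [hmul, h2, Matrix.mulVec_zero, add_zero] at hβ
      have h1 := hFinj _ hβ
      ext (i | i)
      · exact congrFun h1 i
      · exact congrFun h2 i
    · obtain ⟨u, hu, hu0⟩ := exists_vecMul_eq_zero X hcard
      exact absurd (h u (by simp) (hvec u hu0).1 (hvec u hu0).2) hu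
  have hrank : X.rank = k := ((rank_eq_card_iff_forall_mulVec X).2 hX).trans hcardk
  have hB : bSet X R = (colSpan X : Set (EuclideanSpace ℝ (Fin n))) := by
    refine bSet_eq_of_forall hX hR hq fun u hu hu0 β hβ => ?_
    -- The vector u is supported on this set and orthogonal to X, so the second alternative would
    -- force u = 0. The first makes the `Xt`-part of β vanish, and R ignores the F-part.
    rcases hdich {i | u i ≠ 0} with h | h
    · have h2 : β ∘ Sum.inr = 0 := h (β ∘ Sum.inl) _ fun i hi => by
        have := hβ i hi
        rwa [hmul] at this
      rw [hRt, Matrix.fromCols_mulVec, h2]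
      simp
    · exact absurd (h u (fun i hi => not_not.1 hi) (hvec u hu).1 (hvec u hu).2) hu0
  have hFL : colSpan F ≤ nullDir X R := by
    intro y hy
    obtain ⟨b, hb⟩ := (mem_colSpan_iff F y).1 hy
    refine ⟨Sum.elim b 0, ?_, ?_⟩
    · rw [hmul]
      ext i
      simp [hb]
    · rw [hRt, Matrix.fromCols_mulVec]
      simp
  have hrho : ∀ γ, rho γ (nullDir X R) = rho γ (colSpan F) := fun γ =>
    rho_eq_rho hFL nullDir_le_colSpan (colSpan_ne_top hcard) (htrig γ)
  have htrig' : ∀ γ, ¬ colSpan (trigMat n (rho γ (nullDir X R)) γ) ≤ colSpan X := fun γ => by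
    rw [hrho γ]
    exact htrig γ
  refine ⟨hrank, hB, rankAssumption_of_bSet_eq hX hcard hB, fun γ _ => hrho γ, fun γ _ => ?_,
    fun γ _ => htrig' γ, fun γ _ => ?_, fun r w hw => ?_, fun r W hW => ?_⟩
  · rw [hB]
    exact htrig' γ
  · exact hrank.symm.trans_lt (lt_rank_fromCols X _ (htrig' γ))
  · exact (regularStat_statW hX hcard hR hq hB r hw).sizeControllable fun γ _ => htrig' γ
  · exact (regularStat_statE hX hcard hR hq r hW).sizeControllable fun γ _ => htrig' γ
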